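/- Let $\alpha>0$, let $\Omega$ be the space of real càdlàg paths on $[0,\infty)$, $X$ the coordinate process, $\mathcal F_t=\sigma(X_s,s\le t)$, $\mathbb R^*=\mathbb R\setminus\{0\}$, and let $(X,\mathbb P_x)_{x\in\mathbb R^*}$ be a real self-similar Markov process of index $\alpha$: $\mathbb P_x(X_0=x)=1$; $x\mapsto\mathbb P_x(B)$ is measurable for every measurable $B\subseteq\Omega$; for every $(\mathcal F_t)$-stopping time $\tau$, conditionally on $\mathcal F_\tau$ and on $\{\tau<\infty,\ X_\tau\neq0\}$, the process $(X_{\tau+t})_{t\ge0}$ has law $\mathbb P_{X_\tau}$; and for all $c>0$, $x\in\mathbb R^*$, the law of $(cX_{c^{-\alpha}t})_{t\ge0}$ under $\mathbb P_x$ is the law of $(X_t)_{t\ge0}$ under $\mathbb P_{cx}$. Let $T=\inf\{t>0:X_t=0\}$ and let $$H_0=0,\qquad H_{n+1}=\inf\{t>H_n: X_tX_{t-}<0\}\quad(n\ge0)$$ be the times of the sign changes. Suppose that for every $x\in\mathbb R^*$ the process changes sign before hitting zero: $\mathbb P_x(H_1<T)=1$ (if $X$ is killed, i.e. stays at $0$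 from time $T$ on, this is the condition $\mathbb P_x(H_1<\infty)=1$). Then, for every $x\in\mathbb R^*$, $\mathbb P_x$-a.s. for all $n\ge0$ one has $H_n<H_{n+1}<T$, $X_{H_n}\neq0$ and $X_{H_{n+1}}X_{H_{n+1}-}<0$, so that the killed paths $$\mathcal X^{(n)}_t=\frac{X_{H_n+|X_{H_n}|^\alpha t}}{|X_{H_n}|},\qquad 0\le t<|X_{H_n}|^{-\alpha}(H_{n+1}-H_n),$$ and the random variables $J_n=X_{H_{n+1}}/X_{H_{n+1}-}$ are well defined, and: (i) Under $\mathbb P_x$ the killed paths $\mathcal X^{(n)}$, $n\ge0$, are independent, and for each $n$ the law of $\mathcal X^{(n)}$ under $\mathbb P_x$ is the law of $(X_t,\,0\le t<H_1)$ under $\mathbb P_{\operatorname{sgn}(x)(-1)^n}$. Moreover they are time-changed Lévy processes killed at an exponential time: for each $n$, with $\varepsilon=\operatorname{sgn}(x)(-1)^n$, there are a real Lévy process $\xi$ and an independent exponential random variable $\zeta$ with some parameter $q>0$ such that $\mathcal X^{(n)}$ under $\mathbb P_x$ has the law of $\big(\varepsilon\exp(\xi_{\tau(t)}),\ 0\le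 t<A_\zeta\big)$, where $A_s=\int_0^s e^{\alpha\xi_u}\,du$ and $\tau(t)=\inf\{s>0:A_s>t\}$. (ii) Under $\mathbb P_x$ the random variables $J_n$, $n\ge0$, are independent, and for each $n$ the law of $J_n$ under $\mathbb P_x$ is the law of $J_0$ under $\mathbb P_{\operatorname{sgn}(x)(-1)^n}$. (iii) For every $n\ge0$, the killed path $\mathcal X^{(n)}$ and the random variable $J_n$ are independent under $\mathbb P_x$. -/

import Mathlib

open MeasureTheory ProbabilityTheory Filter Topology
open scoped NNReal ENNReal

noncomputable section

namespace SelfSimilarMarkov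

/-- A real function on `[0, ∞)` is càdlàg: right-continuous with (finite) left limits. -/
def IsCadlag (f : ℝ≥0 → ℝ) : Prop :=
  (∀ t, ContinuousWithinAt f (Set.Ici t) t) ∧ ∀ t, ∃ l : ℝ, Tendsto f (𝓝[<] t) (𝓝 l)

/-- The space of real càdlàg paths. As a subtype of `ℝ≥0 → ℝ` it carries the σ-algebra generated
by the coordinates. The coordinate process is `X t ω = ω.1 t`. -/
abbrev Path : Type := {f : ℝ≥0 → ℝ // IsCadlag f}

lemma measurable_coord (t : ℝ≥0) : Measurable (fun ω : Path => ω.1 t) :=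
  (measurable_pi_apply t).comp measurable_subtype_coe

/-- The natural filtration `ℱ t = σ(X s, s ≤ t)` of the coordinate process. -/
def pathFiltration : Filtration ℝ≥0 (inferInstance : MeasurableSpace Path) :=
  Filtration.natural (fun (t : ℝ≥0) (ω : Path) => ω.1 t)
    (fun t => (measurable_coord t).stronglyMeasurable)

/-- The value `X τ` of the path at the random time `τ` (relevant only where `τ < ∞`). -/
def valueAt (τ : Path → WithTop ℝ≥0) (ω : Path) : ℝ := ω.1 ((τ ω).untopD 0)

/-- The shifted path `t ↦ X (τ + t)` (relevant only where `τ < ∞`). -/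
def shiftAt (τ : Path → WithTop ℝ≥0) (ω : Path) : ℝ≥0 → ℝ := fun t => ω.1 ((τ ω).untopD 0 + t)

/-- `(X, P x)`, `x ≠ 0`, is a càdlàg strong Markov family with starting points (state space)
`ℝ ∖ {0}`: the strong Markov property holds at every stopping time `τ` of the natural filtration,
on the event that `τ` is finite and `X τ ≠ 0`. The values `P x` are used only for `x ≠ 0`, and
nothing is required of the behaviour from the point `0`, which may be a cemetery
or may be left again. -/
structure IsStrongMarkovFamily (P : ℝ → Measure Path) : Prop where
  isProbabilityMeasure : ∀ x, x ≠ 0 → IsProbabilityMeasure (P x)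
  measurable : ∀ B : Set Path, MeasurableSet B → Measurable (fun x : {x : ℝ // x ≠ 0} => P x B)
  start : ∀ x, x ≠ 0 → ∀ᵐ ω ∂(P x), ω.1 0 = x
  strongMarkov : ∀ x, x ≠ 0 → ∀ (τ : Path → WithTop ℝ≥0) (hτ : IsStoppingTime pathFiltration τ)
    (A : Set Path), MeasurableSet[hτ.measurableSpace] A →
    ∀ B : Set (ℝ≥0 → ℝ), MeasurableSet B →
      P x (A ∩ {ω | τ ω ≠ ⊤ ∧ valueAt τ ω ≠ 0} ∩ {ω | shiftAt τ ω ∈ B}) =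
        ∫⁻ ω in A ∩ {ω | τ ω ≠ ⊤ ∧ valueAt τ ω ≠ 0}, P (valueAt τ ω) {η | η.1 ∈ B} ∂(P x)

/-- A real self-similar Markov process of index `α`: a strong Markov family such that, for all
`c > 0` and `x ≠ 0`, the law of `(c * X (c ^ (-α) * t), t ≥ 0)` under `P x` is the law
of `(X t, t ≥ 0)` under `P (c * x)`. -/
structure IsSelfSimilarMarkov (α : ℝ) (P : ℝ → Measure Path) : Prop
    extends IsStrongMarkovFamily P where
  scaling : ∀ c : ℝ≥0, 0 < c → ∀ x, x ≠ 0 →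
    (P x).map (fun ω (t : ℝ≥0) => (c : ℝ) * ω.1 (c ^ (-α) * t)) =
      (P (c * x)).map (fun ω (t : ℝ≥0) => ω.1 t)

/-- `T = inf {t > 0 : X t = 0}`, the first hitting time of zero. -/
def hitZero (ω : Path) : ℝ≥0∞ := ⨅ (t : ℝ≥0) (_ : 0 < t ∧ ω.1 t = 0), (t : ℝ≥0∞)

/-- The times of the sign changes: `H 0 = 0` and
`H (n + 1) = inf {t > H n : X t * X (t-) < 0}`. -/
def signChange : ℕ → Path → ℝ≥0∞
  | 0, _ => 0
  | n + 1, ω => ⨅ (t : ℝ≥0) (_ : signChange n ω < t ∧ ω.1 t * Function.leftLim ω.1 t < 0),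
      (t : ℝ≥0∞)

/-- `X (H n)` (relevant only where `H n < ∞`). -/
def valueH (n : ℕ) (ω : Path) : ℝ := ω.1 (signChange n ω).toNNReal

/-- `X (H n -)`, the left limit at `H n` (relevant only where `0 < H n < ∞`). -/
def leftValueH (n : ℕ) (ω : Path) : ℝ := Function.leftLim ω.1 (signChange n ω).toNNReal

/-- The `n`-th rescaled path between sign changes,
`t ↦ X (H n + |X (H n)| ^ α * t) / |X (H n)|` on `0 ≤ t < |X (H n)| ^ (-α) * (H (n + 1) - H n)`,
as a path that sits at the cemetery point `⊤` from the end of its lifetime on. -/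
def piece (α : ℝ) (n : ℕ) (ω : Path) : ℝ≥0 → WithTop ℝ := fun t =>
  if (t : ℝ≥0∞) < ((‖valueH n ω‖₊ ^ (-α) : ℝ≥0) : ℝ≥0∞) * (signChange (n + 1) ω - signChange n ω)
  then ((ω.1 ((signChange n ω).toNNReal + ‖valueH n ω‖₊ ^ α * t) / |valueH n ω| : ℝ) : WithTop ℝ)
  else ⊤

/-- The path `(X t, 0 ≤ t < H 1)`, at the cemetery point `⊤` from the time `H 1` on. -/
def firstPiece (ω : Path) : ℝ≥0 → WithTop ℝ := fun t =>
  if (t : ℝ≥0∞) < signChange 1 ω then ((ω.1 t : ℝ) : WithTop ℝ) else ⊤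

/-- The jump ratio `J n = X (H (n + 1)) / X (H (n + 1) -)`. -/
def jumpRatio (n : ℕ) (ω : Path) : ℝ := valueH (n + 1) ω / leftValueH (n + 1) ω

/-- A real Lévy process: càdlàg, started at `0`, with independent and stationary increments. -/
structure IsLevyProcess {Ω : Type*} [MeasurableSpace Ω] (ξ : ℝ≥0 → Ω → ℝ) (μ : Measure Ω) :
    Prop where
  measurable : ∀ t, Measurable (ξ t)
  cadlag : ∀ ω, IsCadlag (fun t => ξ t ω)
  zero : ∀ᵐ ω ∂μ, ξ 0 ω = 0
  indep : HasIndepIncrements ξ μ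
  stationary : ∀ s t : ℝ≥0, IdentDistrib (fun ω => ξ (s + t) ω - ξ s ω) (ξ t) μ μ

/-- The exponential functional `A s = ∫₀ˢ exp (α * f u) du`. -/
def expFunctional (α : ℝ) (f : ℝ≥0 → ℝ) (s : ℝ≥0) : ℝ≥0∞ :=
  ∫⁻ u in Set.Icc (0 : ℝ) s, ENNReal.ofReal (Real.exp (α * f u.toNNReal))

/-- The time change `τ t = inf {s > 0 : A s > t}`. -/
def lampertiTime (α : ℝ) (f : ℝ≥0 → ℝ) (t : ℝ≥0) : ℝ≥0 :=
  sInf {s : ℝ≥0 | 0 < s ∧ (t : ℝ≥0∞) < expFunctional α f s}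

/-- For a path `f` killed at the time `z`: the time changed path `t ↦ ε * exp (f (τ t))`,
`0 ≤ t < A z`, at the cemetery point `⊤` from the time `A z` on. -/
def lampertiPath (α ε : ℝ) (f : ℝ≥0 → ℝ) (z : ℝ≥0) : ℝ≥0 → WithTop ℝ := fun t =>
  if (t : ℝ≥0∞) < expFunctional α f z
  then ((ε * Real.exp (f (lampertiTime α f t)) : ℝ) : WithTop ℝ) else ⊤

/-- The killed process `Z` has the law of `ε * exp (ξ (τ t))`, `0 ≤ t < A ζ`, where `ξ` is a Lévy
process killed at an independent exponential time `ζ` and `τ` is its time change of index `α`. -/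
def IsTimeChangedKilledLevy {Ω : Type*} [MeasurableSpace Ω] (α ε : ℝ)
    (Z : Ω → ℝ≥0 → WithTop ℝ) (μ : Measure Ω) : Prop :=
  ∃ (Ω' : Type) (_ : MeasurableSpace Ω') (μ' : Measure Ω') (ξ : ℝ≥0 → Ω' → ℝ) (ζ : Ω' → ℝ≥0)
    (q : ℝ), IsProbabilityMeasure μ' ∧ IsLevyProcess ξ μ' ∧
      0 < q ∧ Measurable ζ ∧ μ'.map (fun ω => (ζ ω : ℝ)) = expMeasure q ∧
      IndepFun (fun ω (t : ℝ≥0) => ξ t ω) ζ μ' ∧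
      IdentDistrib Z (fun ω => lampertiPath α ε (fun t => ξ t ω) (ζ ω)) μ μ'

end SelfSimilarMarkov

end

/-!
# Real self-similar Markov processes between their changes of sign

By scaling, the process may be started from `1` or `-1`. At the first change of sign the strong
Markov property and the scaling property combine into one statement
(`IsSelfSimilarMarkov.measure_inter_renorm`): the path restarted at a stopping time and divided by
the absolute value of its starting point, in the corresponding time scale, is independent of the
past and has the law `P 1` or `P (-1)`, according to its sign. Iterating this restart at the changes
of sign (`restart`) gives a sequence of paths with alternating laws (`map_iterate_restart`), such that
a functional of each path up to its own first change of sign takes independent values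
(`iIndepFun_restart`). The pieces and the jump ratios are functionals of this kind
(`killedPath`, `lifeRatio`).

The time of the first change of sign is replaced by `life`, the first time at which the path is no
longer bounded away from zero with its initial sign, which satisfies Galmarino's test for stopping
times. Both times agree for a regular path (`IsRegular`), that is, unless the path approaches `0`
continuously. Almost every path is regular: if it came close to `0` before losing its sign, then by
scaling its value after this loss would be arbitrarily small, hence zero, and the path would hit
zero before changing sign (`ae_lifeValue_eq_zero`).

For the Lamperti representation, `logPath` is the logarithm of the absolute value of the path in the
time scale of the clock `∫₀ᵗ |X u| ^ (-α) du`. Restarting at a time of this clock shows that it has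
independent and stationary increments on the event of survival (`IsKilledLevy`,
`isKilledLevy_logPath`), so that its lifetime is exponential (`IsKilledLevy.exists_rate`). An unkilled
Lévy process with the same increments is glued from independent copies of the segment on `[0, 1]`
conditioned on survival; killed at an independent exponential time, it has the law of `logPath`, as
this law is determined by the increments (`IsKilledLevy.exists_isLevyProcess`,
`IsKilledLevy.map_eq`). Finally the path is recovered from `logPath` by the time change
(`IsRegular.exists_logPath_eq`), and this inverse is a measurable functional (`lampertiMap`).

The jump ratio does not change when the path is restarted at a time of the clock before the change
of sign. By the same restart it is therefore independent of the values of `logPath` at any finite set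
of times at which `logPath` is alive, and these events generate
(`indepFun_logPath_lifeRatio`).
-/

open MeasureTheory ProbabilityTheory Filter Topology
open scoped NNReal ENNReal

noncomputable section

namespace SelfSimilarMarkov

/-! ### Càdlàg paths -/

/-- A continuous nondecreasing time change preserves the càdlàg property; where it is constant to
the left of a point, the left limit is a value and not a left limit of `f`. -/
lemma IsCadlag.comp_monotone {f : ℝ≥0 → ℝ} {g : ℝ≥0 → ℝ≥0} (hf : IsCadlag f)
    (hg : Continuous g) (hm : Monotone g) : IsCadlag (fun t => f (g t)) := by
  refine ⟨fun t => (hf.1 (g t)).comp hg.continuousWithinAt (fun x hx => hm hx), fun t => ?_⟩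
  by_cases h : ∃ s < t, g s = g t
  · obtain ⟨s, hs, hst⟩ := h
    refine ⟨f (g t), tendsto_const_nhds.congr' ?_⟩
    filter_upwards [Ioo_mem_nhdsLT hs] with u hu
    rw [le_antisymm (hm hu.2.le) (hst ▸ hm hu.1.le)]
  · push Not at h
    obtain ⟨l, hl⟩ := hf.2 (g t)
    refine ⟨l, hl.comp (tendsto_nhdsWithin_iff.2 ⟨hg.continuousWithinAt, ?_⟩)⟩
    filter_upwards [self_mem_nhdsWithin] with u hu
    exact lt_of_le_of_ne (hm (le_of_lt hu)) (h u hu)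

lemma IsCadlag.div_const {f : ℝ≥0 → ℝ} (hf : IsCadlag f) (c : ℝ) :
    IsCadlag (fun t => f t / c) :=
  ⟨fun t => (hf.1 t).div_const c, fun t => (hf.2 t).imp' (· / c) fun _ h => h.div_const c⟩

lemma IsCadlag.add {f g : ℝ≥0 → ℝ} (hf : IsCadlag f) (hg : IsCadlag g) :
    IsCadlag (fun t => f t + g t) := by
  refine ⟨fun t => (hf.1 t).add (hg.1 t), fun t => ?_⟩
  obtain ⟨l, hl⟩ := hf.2 t
  obtain ⟨l', hl'⟩ := hg.2 t
  exact ⟨l + l', hl.add hl'⟩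

lemma isCadlag_const (c : ℝ) : IsCadlag (fun _ => c) :=
  ⟨fun _ => continuousWithinAt_const, fun _ => ⟨c, tendsto_const_nhds⟩⟩

/-- Being càdlàg is a local property. -/
lemma IsCadlag.congr_of_eqOn_Iio {f : ℝ≥0 → ℝ}
    (h : ∀ t, ∃ g, IsCadlag g ∧ ∃ b, t < b ∧ Set.EqOn f g (Set.Iio b)) : IsCadlag f := by
  refine ⟨fun t => ?_, fun t => ?_⟩ <;> obtain ⟨g, hg, b, hb, he⟩ := h t
  · refine (hg.1 t).congr_of_eventuallyEq ?_ (he hb)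
    filter_upwards [mem_nhdsWithin_of_mem_nhds (Iio_mem_nhds hb)] with u hu using he hu
  · obtain ⟨l, hl⟩ := hg.2 t
    refine ⟨l, hl.congr' ?_⟩
    filter_upwards [mem_nhdsWithin_of_mem_nhds (Iio_mem_nhds hb)] with u hu using (he hu).symm

lemma IsCadlag.tendsto_leftLim {f : ℝ≥0 → ℝ} (hf : IsCadlag f) (t : ℝ≥0) :
    Tendsto f (𝓝[<] t) (𝓝 (Function.leftLim f t)) :=
  tendsto_leftLim_of_tendsto (hf.2 t)

lemma nhdsLT_neBot_of_pos {t : ℝ≥0} (ht : 0 < t) : (𝓝[<] t).NeBot :=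
  nhdsLT_neBot_of_exists_lt ⟨0, ht⟩

lemma leftLim_zero (f : ℝ≥0 → ℝ) : Function.leftLim f 0 = f 0 :=
  leftLim_eq_of_isBot isBot_bot

/-- The left limit depends only on the path strictly before the time, provided this is positive. -/
lemma leftLim_congr {f g : ℝ≥0 → ℝ} {t : ℝ≥0} (hg : IsCadlag g) (ht : 0 < t)
    (h : ∀ s < t, f s = g s) : Function.leftLim f t = Function.leftLim g t := by
  have := nhdsLT_neBot_of_pos ht
  refine leftLim_eq_of_tendsto ((hg.tendsto_leftLim t).congr' ?_)
  filter_upwards [self_mem_nhdsWithin] with s hs using (h s hs).symm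

lemma coord_ext {ω η : Path} (h : ∀ t, ω.1 t = η.1 t) : ω = η := Subtype.ext (funext h)

/-- The smallest multiple of `1 / (n + 1)` that is strictly larger than `t`. -/
def gridAbove (n : ℕ) (t : ℝ≥0) : ℝ≥0 := ((⌊((n : ℝ≥0) + 1) * t⌋₊ + 1 : ℕ) : ℝ≥0) / (n + 1)

lemma lt_gridAbove (n : ℕ) (t : ℝ≥0) : t < gridAbove n t := by
  rw [gridAbove, lt_div_iff₀ (by positivity), mul_comm]
  exact_mod_cast Nat.lt_floor_add_one _

lemma gridAbove_le (n : ℕ) (t : ℝ≥0) : gridAbove n t ≤ t + 1 / ((n : ℝ≥0) + 1) := by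
  rw [gridAbove, div_le_iff₀ (by positivity), add_mul t, one_div,
    inv_mul_cancel₀ (by positivity), mul_comm t]
  push_cast
  gcongr
  exact Nat.floor_le (by positivity)

lemma tendsto_gridAbove (t : ℝ≥0) : Tendsto (fun n => gridAbove n t) atTop (𝓝[>] t) := by
  refine tendsto_nhdsWithin_iff.2 ⟨?_, .of_forall fun n => lt_gridAbove n t⟩
  refine tendsto_of_tendsto_of_tendsto_of_le_of_le tendsto_const_nhds ?_
    (fun n => (lt_gridAbove n t).le) (fun n => gridAbove_le n t)
  have h := (tendsto_const_nhds (x := t)).add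
    (tendsto_one_div_add_atTop_nhds_zero_nat (𝕜 := ℝ≥0))
  simpa using h

/-- A function of the grid points `gridAbove n t` is measurable in `t` and a parameter as soon as it
is measurable in the parameter: the grid is countable. -/
lemma measurable_comp_gridAbove {Ω E : Type*} [MeasurableSpace Ω] [MeasurableSpace E]
    {X : ℝ≥0 → Ω → E} (hX : ∀ t, Measurable (X t)) (n : ℕ) :
    Measurable (fun p : ℝ≥0 × Ω => X (gridAbove n p.1) p.2) := by
  have h1 : Measurable (fun p : ℕ × Ω => X (((p.1 + 1 : ℕ) : ℝ≥0) / (n + 1)) p.2) :=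
    measurable_from_prod_countable_right fun k =>
      hX (((k + 1 : ℕ) : ℝ≥0) / (n + 1))
  have h2 : Measurable (fun p : ℝ≥0 × Ω => (⌊((n : ℝ≥0) + 1) * p.1⌋₊, p.2)) :=
    (Nat.measurable_floor.comp (measurable_fst.const_mul _)).prodMk measurable_snd
  exact h1.comp h2

/-- Joint measurability of the evaluation map, by approximation from the right. -/
lemma measurable_eval : Measurable (fun p : ℝ≥0 × Path => p.2.1 p.1) := by
  refine measurable_of_tendsto_metrizable
    (measurable_comp_gridAbove (X := fun t (ω : Path) => ω.1 t) measurable_coord) ?_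
  rw [tendsto_pi_nhds]
  rintro ⟨t, ω⟩
  exact ((ω.2.1 t).tendsto.mono_left (nhdsWithin_mono _ Set.Ioi_subset_Ici_self)).comp
    (tendsto_gridAbove t)

lemma _root_.Measurable.eval_path {Ω : Type*} [MeasurableSpace Ω] {τ : Ω → ℝ≥0} {f : Ω → Path}
    (hτ : Measurable τ) (hf : Measurable f) : Measurable (fun ω => (f ω).1 (τ ω)) :=
  measurable_eval.comp (hτ.prodMk hf)

lemma measurable_path_mk {Ω : Type*} [MeasurableSpace Ω] {f : Ω → ℝ≥0 → ℝ}
    (hc : ∀ ω, IsCadlag (f ω)) (hf : ∀ t, Measurable (fun ω => f ω t)) :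
    Measurable (fun ω => (⟨f ω, hc ω⟩ : Path)) :=
  (measurable_pi_lambda _ hf).subtype_mk

lemma _root_.Measurable.leftLim_path {Ω : Type*} [MeasurableSpace Ω] {τ : Ω → ℝ≥0} {f : Ω → Path}
    (hτ : Measurable τ) (hf : Measurable f) :
    Measurable (fun ω => Function.leftLim (f ω).1 (τ ω)) := by
  -- The left limit at `τ` is the limit of the values at the times `τ * (n / (n + 1))`; at `τ = 0`
  -- it is by convention the value.
  have h (n : ℕ) : Measurable (fun ω => (f ω).1 (τ ω * ((n : ℝ≥0) / (n + 1)))) :=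
    (hτ.mul_const _).eval_path hf
  refine measurable_of_tendsto_metrizable h ?_
  rw [tendsto_pi_nhds]
  intro ω
  rcases eq_or_ne (τ ω) 0 with h0 | h0
  · simp [h0, leftLim_zero]
  · refine ((f ω).2.tendsto_leftLim (τ ω)).comp (tendsto_nhdsWithin_iff.2 ⟨?_, ?_⟩)
    · have h1 : Tendsto (fun n : ℕ => (n : ℝ≥0) / (n + 1)) atTop (𝓝 1) := by
        rw [← NNReal.tendsto_coe]
        push_cast
        exact tendsto_natCast_div_add_atTop (1 : ℝ)
      simpa using h1.const_mul (τ ω)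
    · refine .of_forall fun n => ?_
      have : (n : ℝ≥0) / (n + 1) < 1 := by
        rw [div_lt_one (by positivity)]; exact lt_add_one _
      exact mul_lt_of_lt_one_right (pos_iff_ne_zero.2 h0) this

/-! ### Stopped paths and stopping times of the natural filtration -/

/-- The path `s ↦ X (min s t)` stopped at the deterministic time `t`. -/
def stopPath (t : ℝ≥0) (ω : Path) : Path :=
  ⟨fun s => ω.1 (min s t), ω.2.comp_monotone (continuous_id.min continuous_const)
    (fun _ _ h => min_le_min_right t h)⟩

lemma stopPath_apply {t s : ℝ≥0} (h : s ≤ t) (ω : Path) : (stopPath t ω).1 s = ω.1 s := by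
  simp [stopPath, min_eq_left h]

lemma measurable_stopPath (t : ℝ≥0) : Measurable[pathFiltration t] (stopPath t) := by
  refine measurable_iff_comap_le.2 ?_
  change MeasurableSpace.comap _ (MeasurableSpace.comap _ MeasurableSpace.pi) ≤ _
  simp only [MeasurableSpace.pi, MeasurableSpace.comap_iSup, MeasurableSpace.comap_comp]
  exact iSup_le fun s => le_iSup₂_of_le (f := fun j (_ : j ≤ t) => MeasurableSpace.comap _ _)
    (min s t) (min_le_right s t) le_rfl

lemma iSup_pathFiltration : (inferInstance : MeasurableSpace Path) ≤ ⨆ t, pathFiltration t := by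
  change MeasurableSpace.comap _ MeasurableSpace.pi ≤ _
  simp only [MeasurableSpace.pi, MeasurableSpace.comap_iSup]
  refine iSup_le fun t => le_iSup_of_le t ?_
  rw [MeasurableSpace.comap_comp]
  exact le_iSup₂_of_le (f := fun j (_ : j ≤ t) => MeasurableSpace.comap _ _) t le_rfl le_rfl

/-- A measurable event which depends only on the path stopped at `t` belongs to `ℱ t`. -/
lemma measurableSet_pathFiltration {t : ℝ≥0} {A : Set Path} (hA : MeasurableSet A)
    (h : ∀ ω, ω ∈ A ↔ stopPath t ω ∈ A) : MeasurableSet[pathFiltration t] A := by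
  have : A = stopPath t ⁻¹' A := Set.ext h
  rw [this]
  exact measurable_stopPath t hA

/-- Galmarino's test for stopping times. -/
lemma isStoppingTime_of_stopPath {τ : Path → WithTop ℝ≥0}
    (hm : ∀ t : ℝ≥0, MeasurableSet {ω | τ ω ≤ t})
    (h : ∀ (t : ℝ≥0) ω, τ ω ≤ t ↔ τ (stopPath t ω) ≤ t) : IsStoppingTime pathFiltration τ :=
  fun t => measurableSet_pathFiltration (hm t) (h t)

/-- Galmarino's test for events of the past of a stopping time. -/
lemma measurableSet_past_of_stopPath {τ : Path → WithTop ℝ≥0}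
    (hm : ∀ t : ℝ≥0, MeasurableSet {ω | τ ω ≤ t})
    (h : ∀ (t : ℝ≥0) ω, τ ω ≤ t ↔ τ (stopPath t ω) ≤ t) {A : Set Path} (hA : MeasurableSet A)
    (hAτ : ∀ (t : ℝ≥0) ω, τ ω ≤ t → (ω ∈ A ↔ stopPath t ω ∈ A)) :
    MeasurableSet[(isStoppingTime_of_stopPath hm h).measurableSpace] A := by
  refine ⟨iSup_pathFiltration _ hA, fun t => ?_⟩
  refine measurableSet_pathFiltration (hA.inter (hm t)) fun ω => ?_
  simp only [Set.mem_inter_iff, Set.mem_ofPred_eq, ← h t ω]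
  exact ⟨fun hh => ⟨(hAτ t ω hh.2).1 hh.1, hh.2⟩, fun hh => ⟨(hAτ t ω hh.2).2 hh.1, hh.2⟩⟩

lemma measurable_withTop_of_le {Ω : Type*} [MeasurableSpace Ω] {τ : Ω → WithTop ℝ≥0}
    (hm : ∀ t : ℝ≥0, MeasurableSet {ω | τ ω ≤ t}) : Measurable τ := by
  refine measurable_of_Iic fun a => ?_
  induction a using WithTop.recTopCoe with
  | top => simp
  | coe a => exact hm a


/-! ### The event that the path has kept its sign -/

/-- On `[0, t]` the path has the sign of its starting point and is bounded away from zero. Requiring a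
bound, and not only a sign, makes the first failure of this property a stopping time of the natural
filtration, which is not assumed to be right-continuous. -/
def KeepsSign (ω : Path) (t : ℝ≥0) : Prop :=
  ∃ k : ℕ, ∀ u ≤ t, 1 / ((k : ℝ) + 1) ≤ ω.1 u * ω.1 0

lemma keepsSign_of_forall {ω : Path} {t : ℝ≥0} {c : ℝ} (hc : 0 < c)
    (h : ∀ u ≤ t, c ≤ ω.1 u * ω.1 0) : KeepsSign ω t := by
  obtain ⟨k, hk⟩ := exists_nat_one_div_lt hc
  exact ⟨k, fun u hu => hk.le.trans (h u hu)⟩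

lemma KeepsSign.exists_pos {ω : Path} {t : ℝ≥0} (h : KeepsSign ω t) :
    ∃ c : ℝ, 0 < c ∧ ∀ u ≤ t, c ≤ ω.1 u * ω.1 0 := by
  obtain ⟨k, hk⟩ := h
  exact ⟨_, by positivity, hk⟩

lemma KeepsSign.mul_pos {ω : Path} {t u : ℝ≥0} (h : KeepsSign ω t) (hu : u ≤ t) :
    0 < ω.1 u * ω.1 0 := by
  obtain ⟨c, hc, hk⟩ := h.exists_pos
  exact hc.trans_le (hk u hu)

lemma KeepsSign.ne_zero {ω : Path} {t u : ℝ≥0} (h : KeepsSign ω t) (hu : u ≤ t) :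
    ω.1 u ≠ 0 := left_ne_zero_of_mul (h.mul_pos hu).ne'

lemma KeepsSign.mono {ω : Path} {t u : ℝ≥0} (h : KeepsSign ω t) (hu : u ≤ t) :
    KeepsSign ω u := by
  obtain ⟨k, hk⟩ := h
  exact ⟨k, fun v hv => hk v (hv.trans hu)⟩

lemma keepsSign_zero {ω : Path} (h : ω.1 0 ≠ 0) : KeepsSign ω 0 :=
  keepsSign_of_forall (mul_self_pos.2 h) fun u hu => by rw [nonpos_iff_eq_zero.1 hu]

lemma KeepsSign.exists_gt {ω : Path} {t : ℝ≥0} (h : KeepsSign ω t) :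
    ∃ t', t < t' ∧ KeepsSign ω t' := by
  obtain ⟨c, hc, hk⟩ := h.exists_pos
  have h1 : ∀ᶠ u in 𝓝[≥] t, c / 2 < ω.1 u * ω.1 0 :=
    ((ω.2.1 t).mul_const (ω.1 0)).eventually_const_lt (by linarith [hk t le_rfl])
  obtain ⟨b, hb, hb'⟩ := (mem_nhdsGE_iff_exists_Icc_subset).1 h1
  refine ⟨b, hb, keepsSign_of_forall (half_pos hc) fun u hu => ?_⟩
  rcases le_total u t with hut | hut
  · linarith [hk u hut]
  · exact le_of_lt (hb' ⟨hut, hu⟩)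

lemma keepsSign_stopPath {ω : Path} {t u : ℝ≥0} (h : u ≤ t) :
    KeepsSign (stopPath t ω) u ↔ KeepsSign ω u := by
  refine exists_congr fun k => forall₂_congr fun v hv => ?_
  rw [stopPath_apply (hv.trans h), stopPath_apply zero_le]

lemma measurableSet_keepsSign (t : ℝ≥0) : MeasurableSet {ω | KeepsSign ω t} := by
  have : {ω | KeepsSign ω t} = ⋃ k : ℕ, ⋂ n : ℕ,
      {ω : Path | 1 / ((k : ℝ) + 1) ≤
        ω.1 (min (TopologicalSpace.denseSeq ℝ≥0 n) t) * ω.1 0} := by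
    ext ω
    simp only [KeepsSign, Set.mem_ofPred_eq, Set.mem_iUnion, Set.mem_iInter]
    refine exists_congr fun k => ⟨fun h n => h _ (min_le_right _ _), fun h u hu => ?_⟩
    rcases hu.eq_or_lt with rfl | hu
    · obtain ⟨_, ⟨n, rfl⟩, hn⟩ := (TopologicalSpace.denseRange_denseSeq ℝ≥0).exists_ge u
      simpa [min_eq_right hn] using h n
    -- By right-continuity the bound extends from a dense set of times to all times before `t`.
    by_contra! hlt
    have h1 : ∀ᶠ v in 𝓝[≥] u, ω.1 v * ω.1 0 < 1 / ((k : ℝ) + 1) :=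
      ((ω.2.1 u).mul_const (ω.1 0)).eventually_lt_const hlt
    obtain ⟨b, hb, hb'⟩ := (mem_nhdsGE_iff_exists_Icc_subset).1 h1
    obtain ⟨_, ⟨n, rfl⟩, hn⟩ := (TopologicalSpace.denseRange_denseSeq ℝ≥0).exists_between
      (lt_min hb hu)
    have h2 := hb' ⟨hn.1.le, hn.2.le.trans (min_le_left _ _)⟩
    have h3 := h n
    rw [min_eq_left (hn.2.le.trans (min_le_right _ _))] at h3
    exact absurd h3 (not_le.2 h2)
  rw [this]
  exact .iUnion fun k => .iInter fun n =>
    measurableSet_le measurable_const ((measurable_coord _).mul (measurable_coord _))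

open Classical in
/-- The first time at which the path fails to have kept its sign; it is `⊤` if there is none. -/
def life (ω : Path) : WithTop ℝ≥0 :=
  if ∃ t, ¬ KeepsSign ω t then ((sInf {t | ¬ KeepsSign ω t} : ℝ≥0) : WithTop ℝ≥0) else ⊤

/-- `KeepsSign ω` fails at the time `life ω` itself, by right-continuity. -/
lemma life_le_iff {ω : Path} {t : ℝ≥0} : life ω ≤ t ↔ ¬ KeepsSign ω t := by
  by_cases h : ∃ t, ¬ KeepsSign ω t
  · rw [life, if_pos h, WithTop.coe_le_coe]
    refine ⟨fun hle hk => ?_, fun hk => csInf_le (OrderBot.bddBelow _) hk⟩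
    obtain ⟨t', ht', hk'⟩ := hk.exists_gt
    obtain ⟨u, hu, hut⟩ := exists_lt_of_csInf_lt h (hle.trans_lt ht')
    exact hu (hk'.mono hut.le)
  · push Not at h
    rw [life, if_neg (by simpa using h)]
    exact iff_of_false (not_le.2 (WithTop.coe_lt_top t)) (not_not.2 (h t))

lemma lt_life_iff {ω : Path} {t : ℝ≥0} : (t : WithTop ℝ≥0) < life ω ↔ KeepsSign ω t := by
  rw [← not_le, life_le_iff, not_not]

lemma measurableSet_life_le (t : ℝ≥0) : MeasurableSet {ω | life ω ≤ t} := by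
  simp_rw [life_le_iff]
  exact (measurableSet_keepsSign t).compl

lemma life_stopPath_le_iff (t : ℝ≥0) (ω : Path) : life ω ≤ t ↔ life (stopPath t ω) ≤ t := by
  rw [life_le_iff, life_le_iff, keepsSign_stopPath le_rfl]

lemma measurable_life : Measurable life := measurable_withTop_of_le measurableSet_life_le

lemma life_stopPath {t : ℝ≥0} {ω : Path} (h : life ω ≤ t) : life (stopPath t ω) = life ω := by
  have h' := (life_stopPath_le_iff t ω).1 h
  obtain ⟨a, ha⟩ := WithTop.ne_top_iff_exists.1 (ne_top_of_le_ne_top WithTop.coe_ne_top h)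
  obtain ⟨b, hb⟩ := WithTop.ne_top_iff_exists.1 (ne_top_of_le_ne_top WithTop.coe_ne_top h')
  rw [← ha, WithTop.coe_le_coe] at h
  rw [← hb, WithTop.coe_le_coe] at h'
  have key (s : ℝ≥0) (hs : s ≤ t) : life (stopPath t ω) ≤ s ↔ life ω ≤ s := by
    rw [life_le_iff, life_le_iff, keepsSign_stopPath hs]
  refine le_antisymm ?_ ?_
  · rw [← ha]; exact (key a h).2 ha.ge
  · rw [← hb]; exact (key b h').1 hb.ge

/-! ### Exponential functionals -/

lemma expFunctional_mono (α : ℝ) (f : ℝ≥0 → ℝ) : Monotone (expFunctional α f) := fun _ _ h =>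
  lintegral_mono_set (Set.Icc_subset_Icc_right (NNReal.coe_le_coe.2 h))

lemma expFunctional_zero (α : ℝ) (f : ℝ≥0 → ℝ) : expFunctional α f 0 = 0 := by
  simp [expFunctional]

lemma expFunctional_congr {α : ℝ} {f g : ℝ≥0 → ℝ} {s : ℝ≥0} (h : ∀ u ≤ s, f u = g u) :
    expFunctional α f s = expFunctional α g s := by
  refine setLIntegral_congr_fun measurableSet_Icc fun u hu => ?_
  rw [h _ (Real.toNNReal_le_iff_le_coe.2 hu.2)]

lemma expFunctional_eq_add (α : ℝ) (f : ℝ≥0 → ℝ) {s t : ℝ≥0} (h : s ≤ t) :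
    expFunctional α f t = expFunctional α f s +
      ∫⁻ u in Set.Icc (s : ℝ) t, ENNReal.ofReal (Real.exp (α * f u.toNNReal)) := by
  rw [← setLIntegral_congr Ioc_ae_eq_Icc, expFunctional, expFunctional,
    ← lintegral_union measurableSet_Ioc,
    Set.Icc_union_Ioc_eq_Icc s.coe_nonneg (NNReal.coe_le_coe.2 h)]
  exact Set.disjoint_left.2 fun x hx hx' => not_le.2 hx'.1 hx.2

lemma measurable_exp_integrand {α : ℝ} {f : ℝ≥0 → ℝ} (hf : Measurable f) :
    Measurable (fun u : ℝ => Real.exp (α * f u.toNNReal)) :=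
  ((hf.comp measurable_real_toNNReal).const_mul α).exp

lemma expFunctional_lt {α : ℝ} {f : ℝ≥0 → ℝ} (hf : Measurable f) {s t : ℝ≥0} (h : s < t)
    (hfin : expFunctional α f s ≠ ⊤) : expFunctional α f s < expFunctional α f t := by
  rw [expFunctional_eq_add α f h.le]
  refine ENNReal.lt_add_right hfin ?_
  rw [← pos_iff_ne_zero, setLIntegral_pos_iff (measurable_exp_integrand hf).ennreal_ofReal]
  have : Function.support (fun u : ℝ => ENNReal.ofReal (Real.exp (α * f u.toNNReal))) =
      Set.univ := by
    ext u
    simp [Real.exp_pos]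
  rw [this, Set.univ_inter, Real.volume_Icc]
  simpa using h

/-- The exponential functional takes every value below a finite value. -/
lemma exists_expFunctional_eq {α : ℝ} {f : ℝ≥0 → ℝ} (hf : Measurable f) {t : ℝ≥0}
    (hfin : expFunctional α f t ≠ ⊤) {s : ℝ≥0∞} (hs : s ≤ expFunctional α f t) :
    ∃ u ≤ t, expFunctional α f u = s := by
  set g : ℝ → ℝ := fun u => Real.exp (α * f u.toNNReal) with hg
  have hgm : Measurable g := measurable_exp_integrand hf
  have hint : IntegrableOn g (Set.Icc 0 (t : ℝ)) := by
    refine ⟨hgm.aestronglyMeasurable, ?_⟩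
    rw [hasFiniteIntegral_iff_ofReal (.of_forall fun u => (Real.exp_pos _).le)]
    exact lt_top_iff_ne_top.2 hfin
  have heq (u : ℝ≥0) (hu : u ≤ t) :
      expFunctional α f u = ENNReal.ofReal (∫ x in Set.Icc 0 (u : ℝ), g x) := by
    rw [ofReal_integral_eq_lintegral_ofReal
      (hint.mono_set (Set.Icc_subset_Icc_right (NNReal.coe_le_coe.2 hu)))
      (.of_forall fun u => (Real.exp_pos _).le)]
    rfl
  have hcont := intervalIntegral.continuousOn_primitive_Icc hint
  have hsfin : s ≠ ⊤ := ne_top_of_le_ne_top hfin hs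
  have hmem : s.toReal ∈ Set.Icc (∫ x in Set.Icc 0 (0 : ℝ), g x)
      (∫ x in Set.Icc 0 (t : ℝ), g x) := by
    refine ⟨by simp, ?_⟩
    rw [heq t le_rfl] at hs
    exact (ENNReal.toReal_le_of_le_ofReal
      (setIntegral_nonneg measurableSet_Icc fun u _ => (Real.exp_pos _).le) hs)
  obtain ⟨u, hu, hus⟩ := intermediate_value_Icc t.coe_nonneg hcont hmem
  lift u to ℝ≥0 using hu.1
  refine ⟨u, NNReal.coe_le_coe.1 hu.2, ?_⟩
  beta_reduce at hus
  rw [heq u (NNReal.coe_le_coe.1 hu.2), hus, ENNReal.ofReal_toReal hsfin]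

/-- Left-continuity of the exponential functional. -/
lemma exists_lt_expFunctional {α : ℝ} {f : ℝ≥0 → ℝ} {z : ℝ≥0} {r : ℝ≥0∞}
    (h : r < expFunctional α f z) : ∃ s < z, r < expFunctional α f s := by
  have hz : 0 < z := by
    rw [pos_iff_ne_zero]; rintro rfl; simp [expFunctional_zero] at h
  obtain ⟨v, hv, hvz, hvt⟩ := exists_seq_strictMono_tendsto' hz
  have hU : Set.Ico (0 : ℝ) z = ⋃ n, Set.Icc (0 : ℝ) (v n) := by
    ext x
    simp only [Set.mem_Ico, Set.mem_iUnion, Set.mem_Icc]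
    refine ⟨fun hx => ?_, fun ⟨n, hn⟩ => ⟨hn.1, hn.2.trans_lt (NNReal.coe_lt_coe.2 (hvz n).2)⟩⟩
    obtain ⟨n, hn⟩ := (((NNReal.tendsto_coe.2 hvt).eventually_const_lt hx.2)).exists
    exact ⟨n, hx.1, hn.le⟩
  have hr : expFunctional α f z = ⨆ n, expFunctional α f (v n) := by
    rw [expFunctional, ← setLIntegral_congr Ico_ae_eq_Icc, hU, setLIntegral_iUnion_of_directed]
    · rfl
    · exact Monotone.directed_le fun m n hmn =>
        Set.Icc_subset_Icc_right (NNReal.coe_le_coe.2 (hv.monotone hmn))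
  rw [hr, lt_iSup_iff] at h
  obtain ⟨n, hn⟩ := h
  exact ⟨v n, (hvz n).2, hn⟩

lemma measurable_expFunctional {Ω : Type*} [MeasurableSpace Ω] (α : ℝ) {X : ℝ≥0 → Ω → ℝ}
    (hX : Measurable (fun p : ℝ≥0 × Ω => X p.1 p.2)) (s : ℝ≥0) :
    Measurable (fun ω => expFunctional α (fun u => X u ω) s) := by
  refine Measurable.lintegral_prod_right' (f := fun p : Ω × ℝ =>
    ENNReal.ofReal (Real.exp (α * X p.2.toNNReal p.1))) ?_
  refine (Measurable.exp ?_).ennreal_ofReal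
  exact (hX.comp ((measurable_real_toNNReal.comp measurable_snd).prodMk
    measurable_fst)).const_mul α

/-! ### The clock, its inverse and the time-changed logarithm of the path -/

lemma Path.measurable (ω : Path) : Measurable ω.1 :=
  measurable_id.eval_path (f := fun _ => ω) measurable_const

/-- The clock `∫₀ᵗ |X u| ^ (-α) du`; recall that `Real.log x = log |x|`. The junk value
`Real.log 0 = 0` is harmless, since the clock is used only while the path keeps its sign. -/
def clock (α : ℝ) (ω : Path) (t : ℝ≥0) : ℝ≥0∞ :=
  expFunctional (-α) (fun u => Real.log (ω.1 u)) t

lemma clock_stopPath {α : ℝ} {ω : Path} {t u : ℝ≥0} (h : u ≤ t) :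
    clock α (stopPath t ω) u = clock α ω u :=
  expFunctional_congr fun v hv => by rw [stopPath_apply (hv.trans h)]

lemma measurable_clock (α : ℝ) (t : ℝ≥0) : Measurable (fun ω => clock α ω t) :=
  measurable_expFunctional (-α) (X := fun u (ω : Path) => Real.log (ω.1 u)) measurable_eval.log t

lemma measurable_log_path (ω : Path) : Measurable (fun u => Real.log (ω.1 u)) :=
  ω.measurable.log

lemma clock_mono (α : ℝ) (ω : Path) : Monotone (clock α ω) := expFunctional_mono _ _

lemma clock_zero (α : ℝ) (ω : Path) : clock α ω 0 = 0 := expFunctional_zero _ _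

lemma clock_ne_top_of_forall_lt {α : ℝ} (hα : 0 < α) {ω : Path} {t : ℝ≥0} {c : ℝ} (hc : 0 < c)
    (h0 : ω.1 0 ≠ 0) (h : ∀ u < t, c ≤ ω.1 u * ω.1 0) : clock α ω t ≠ ⊤ := by
  replace h0 : 0 < |ω.1 0| := abs_pos.2 h0
  have hb : ∀ u : ℝ, u ∈ Set.Ico (0 : ℝ) t →
      ENNReal.ofReal (Real.exp (-α * Real.log (ω.1 u.toNNReal))) ≤
        ENNReal.ofReal (Real.exp (-α * Real.log (c / |ω.1 0|))) := by
    intro u hu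
    refine ENNReal.ofReal_le_ofReal (Real.exp_le_exp.2 ?_)
    have h1 : c / |ω.1 0| ≤ |ω.1 u.toNNReal| := by
      rw [div_le_iff₀ h0, ← abs_mul]
      exact (h _ ((Real.toNNReal_lt_iff_lt_coe hu.1).2 hu.2)).trans (le_abs_self _)
    have h2 := Real.log_le_log (by positivity) h1
    rw [Real.log_abs (ω.1 u.toNNReal)] at h2
    nlinarith
  rw [clock, expFunctional, ← setLIntegral_congr Ico_ae_eq_Icc]
  refine ne_top_of_le_ne_top ?_ (setLIntegral_mono measurable_const hb)
  rw [lintegral_const]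
  exact ENNReal.mul_ne_top ENNReal.ofReal_ne_top (by simp)

lemma KeepsSign.clock_ne_top {α : ℝ} (hα : 0 < α) {ω : Path} {t : ℝ≥0} (h : KeepsSign ω t) :
    clock α ω t ≠ ⊤ := by
  obtain ⟨c, hc, hk⟩ := h.exists_pos
  exact clock_ne_top_of_forall_lt hα hc (h.ne_zero zero_le) fun u hu => hk u hu.le

lemma KeepsSign.clock_lt {α : ℝ} (hα : 0 < α) {ω : Path} {s t : ℝ≥0} (h : KeepsSign ω s)
    (hst : s < t) : clock α ω s < clock α ω t :=
  expFunctional_lt (measurable_log_path ω) hst (h.clock_ne_top hα)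

open Classical in
/-- The inverse of the clock: the time at which the clock shows `s`, provided that the path has kept
its sign up to this time, and `⊤` otherwise. -/
def invClock (α : ℝ) (s : ℝ≥0) (ω : Path) : WithTop ℝ≥0 :=
  if h : ∃ t, KeepsSign ω t ∧ clock α ω t = s then (h.choose : WithTop ℝ≥0) else ⊤

lemma invClock_eq_coe_iff {α : ℝ} (hα : 0 < α) {s t : ℝ≥0} {ω : Path} :
    invClock α s ω = t ↔ KeepsSign ω t ∧ clock α ω t = s := by
  by_cases h : ∃ t, KeepsSign ω t ∧ clock α ω t = s
  · rw [invClock, dif_pos h, WithTop.coe_inj]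
    refine ⟨fun hh => hh ▸ h.choose_spec, fun hh => ?_⟩
    obtain ⟨h1, h2⟩ := h.choose_spec
    rcases lt_trichotomy h.choose t with hlt | heq | hgt
    · exact absurd (h2.trans hh.2.symm) (h1.clock_lt hα hlt).ne
    · exact heq
    · exact absurd (hh.2.trans h2.symm) (hh.1.clock_lt hα hgt).ne
  · rw [invClock, dif_neg h]
    simp only [WithTop.top_ne_coe, false_iff]
    exact fun hh => h ⟨t, hh⟩

lemma invClock_ne_top_iff {α : ℝ} (hα : 0 < α) {s : ℝ≥0} {ω : Path} :
    invClock α s ω ≠ ⊤ ↔ ∃ t, KeepsSign ω t ∧ clock α ω t = s := by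
  rw [WithTop.ne_top_iff_exists]
  exact exists_congr fun t => by rw [eq_comm, invClock_eq_coe_iff hα]

lemma invClock_le_iff {α : ℝ} (hα : 0 < α) {s t : ℝ≥0} {ω : Path} :
    invClock α s ω ≤ t ↔ ∃ u ≤ t, KeepsSign ω u ∧ clock α ω u = s := by
  rw [WithTop.le_coe_iff]
  constructor
  · rintro ⟨u, hu, hut⟩
    exact ⟨u, hut, (invClock_eq_coe_iff hα).1 hu⟩
  · rintro ⟨u, hut, hu⟩
    exact ⟨u, (invClock_eq_coe_iff hα).2 hu, hut⟩

lemma KeepsSign.exists_clock_eq {α : ℝ} (hα : 0 < α) {ω : Path} {t : ℝ≥0} (h : KeepsSign ω t)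
    {s : ℝ≥0∞} (hs : s ≤ clock α ω t) : ∃ u ≤ t, KeepsSign ω u ∧ clock α ω u = s := by
  obtain ⟨u, hu, hus⟩ := exists_expFunctional_eq (measurable_log_path ω) (h.clock_ne_top hα) hs
  exact ⟨u, hu, h.mono hu, hus⟩

lemma invClock_ne_top_of_le {α : ℝ} (hα : 0 < α) {s s' : ℝ≥0} {ω : Path} (h : s ≤ s')
    (hs' : invClock α s' ω ≠ ⊤) : invClock α s ω ≠ ⊤ := by
  rw [invClock_ne_top_iff hα] at hs' ⊢
  obtain ⟨t, ht, hts⟩ := hs'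
  obtain ⟨u, -, hu⟩ := ht.exists_clock_eq hα (s := s) (by rw [hts]; exact_mod_cast h)
  exact ⟨u, hu⟩

lemma measurableSet_invClock_le {α : ℝ} (hα : 0 < α) (s t : ℝ≥0) :
    MeasurableSet {ω | invClock α s ω ≤ t} := by
  have : {ω | invClock α s ω ≤ t} = ⋃ n : ℕ,
      {ω | KeepsSign ω (min (TopologicalSpace.denseSeq ℝ≥0 n) t)} ∩
        {ω | (s : ℝ≥0∞) ≤ clock α ω (min (TopologicalSpace.denseSeq ℝ≥0 n) t)} := by
    ext ω
    simp only [Set.mem_iUnion, Set.mem_inter_iff, Set.mem_ofPred_eq, invClock_le_iff hα]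
    constructor
    · rintro ⟨u, hut, hu, hus⟩
      obtain ⟨n, hn, hn'⟩ : ∃ n, u ≤ min (TopologicalSpace.denseSeq ℝ≥0 n) t ∧
          KeepsSign ω (min (TopologicalSpace.denseSeq ℝ≥0 n) t) := by
        rcases hut.eq_or_lt with rfl | hut
        · obtain ⟨_, ⟨n, rfl⟩, hn⟩ := (TopologicalSpace.denseRange_denseSeq ℝ≥0).exists_ge u
          exact ⟨n, by simp [min_eq_right hn], by rwa [min_eq_right hn]⟩
        · obtain ⟨b, hb, hb'⟩ := hu.exists_gt
          obtain ⟨_, ⟨n, rfl⟩, hn⟩ := (TopologicalSpace.denseRange_denseSeq ℝ≥0).exists_between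
            (lt_min hb hut)
          exact ⟨n, le_min hn.1.le hut.le, hb'.mono ((min_le_left _ _).trans
            (hn.2.le.trans (min_le_left _ _)))⟩
      exact ⟨n, hn', hus ▸ clock_mono α ω hn⟩
    · rintro ⟨n, h1, h2⟩
      obtain ⟨u, hu, h⟩ := h1.exists_clock_eq hα h2
      exact ⟨u, hu.trans (min_le_right _ _), h⟩
  rw [this]
  exact .iUnion fun n => (measurableSet_keepsSign _).inter
    (measurableSet_le measurable_const (measurable_clock α _))

lemma measurable_invClock {α : ℝ} (hα : 0 < α) (s : ℝ≥0) : Measurable (invClock α s) :=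
  measurable_withTop_of_le (measurableSet_invClock_le hα s)

lemma invClock_stopPath_le_iff {α : ℝ} (hα : 0 < α) (s t : ℝ≥0) (ω : Path) :
    invClock α s ω ≤ t ↔ invClock α s (stopPath t ω) ≤ t := by
  rw [invClock_le_iff hα, invClock_le_iff hα]
  refine exists_congr fun u => and_congr_right fun hu => ?_
  rw [keepsSign_stopPath hu, clock_stopPath hu]

lemma invClock_stopPath {α : ℝ} (hα : 0 < α) {s t : ℝ≥0} {ω : Path} (h : invClock α s ω ≤ t) :
    invClock α s (stopPath t ω) = invClock α s ω := by
  obtain ⟨u, hu, hut⟩ := WithTop.le_coe_iff.1 h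
  rw [hu, invClock_eq_coe_iff hα, keepsSign_stopPath hut, clock_stopPath hut]
  exact (invClock_eq_coe_iff hα).1 hu

/-- The Lamperti transform of the path up to its first change of sign, `s ↦ log |X (invClock s)|`,
as a path which is at the cemetery point `⊤` from the end of its lifetime on. -/
def logPath (α : ℝ) (ω : Path) (s : ℝ≥0) : WithTop ℝ :=
  (invClock α s ω).map fun t => Real.log (ω.1 t)

lemma logPath_ne_top_iff {α : ℝ} {s : ℝ≥0} {ω : Path} :
    logPath α ω s ≠ ⊤ ↔ invClock α s ω ≠ ⊤ := by
  simp [logPath]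

lemma logPath_eq_ite (α : ℝ) (ω : Path) (s : ℝ≥0) : logPath α ω s =
    if invClock α s ω = ⊤ then ⊤ else
      ((Real.log (ω.1 ((invClock α s ω).untopD 0)) : ℝ) : WithTop ℝ) := by
  rw [logPath]
  cases invClock α s ω with
  | top => simp
  | coe t => rw [if_neg WithTop.coe_ne_top, WithTop.map_coe, WithTop.untopD_coe]

lemma measurable_logPath {α : ℝ} (hα : 0 < α) (s : ℝ≥0) :
    Measurable (fun ω => logPath α ω s) := by
  simp_rw [logPath_eq_ite]
  have hm := measurable_invClock hα s
  exact Measurable.ite (hm (measurableSet_singleton ⊤)) measurable_const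
    (((hm.untopD 0).eval_path measurable_id).log).withTop_coe

lemma logPath_stopPath {α : ℝ} (hα : 0 < α) {s t : ℝ≥0} {ω : Path} (h : invClock α s ω ≤ t) :
    logPath α (stopPath t ω) s = logPath α ω s := by
  obtain ⟨u, hu, hut⟩ := WithTop.le_coe_iff.1 h
  rw [logPath, logPath, invClock_stopPath hα h, hu, WithTop.map_coe, WithTop.map_coe,
    stopPath_apply hut]


/-! ### Restarting and rescaling a path -/

/-- The path restarted at time `a` and rescaled so as to start from `1` or `-1`,
`t ↦ X (a + |X a| ^ α * t) / |X a|`. -/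
def renorm (α : ℝ) (a : ℝ≥0) (ω : Path) : Path :=
  ⟨fun t => ω.1 (a + ‖ω.1 a‖₊ ^ α * t) / |ω.1 a|,
    (ω.2.comp_monotone (by fun_prop) (fun _ _ h => by gcongr)).div_const _⟩

lemma renorm_apply (α : ℝ) (a : ℝ≥0) (ω : Path) (t : ℝ≥0) :
    (renorm α a ω).1 t = ω.1 (a + ‖ω.1 a‖₊ ^ α * t) / |ω.1 a| := rfl

lemma renorm_zero_apply (α : ℝ) (a : ℝ≥0) (ω : Path) :
    (renorm α a ω).1 0 = ω.1 a / |ω.1 a| := by simp [renorm_apply]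

lemma measurable_renorm {Ω : Type*} [MeasurableSpace Ω] (α : ℝ) {τ : Ω → ℝ≥0} {f : Ω → Path}
    (hτ : Measurable τ) (hf : Measurable f) : Measurable (fun x => renorm α (τ x) (f x)) := by
  refine measurable_path_mk _ fun t => ?_
  have h := hτ.eval_path hf
  exact ((hτ.add ((h.nnnorm.pow_const α).mul_const t)).eval_path hf).div h.abs

section Renorm

variable {α : ℝ} {a : ℝ≥0} {ω : Path}

lemma scale_pos (ha : ω.1 a ≠ 0) : 0 < ‖ω.1 a‖₊ ^ α := NNReal.rpow_pos (by simpa using ha)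

lemma exists_eq_add_mul {c a t : ℝ≥0} (hc : 0 < c) (h : a ≤ t) : ∃ t', t = a + c * t' :=
  ⟨(t - a) / c, by rw [mul_div_cancel₀ _ hc.ne', add_tsub_cancel_of_le h]⟩

lemma leftLim_renorm (ha : ω.1 a ≠ 0) {t : ℝ≥0} (ht : 0 < t) :
    Function.leftLim (renorm α a ω).1 t =
      Function.leftLim ω.1 (a + ‖ω.1 a‖₊ ^ α * t) / |ω.1 a| := by
  have := nhdsLT_neBot_of_pos ht
  have hc := scale_pos (α := α) ha
  refine leftLim_eq_of_tendsto (Tendsto.div_const ?_ _)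
  refine (ω.2.tendsto_leftLim _).comp (tendsto_nhdsWithin_iff.2 ⟨?_, ?_⟩)
  · exact (Continuous.continuousWithinAt (by fun_prop))
  · filter_upwards [self_mem_nhdsWithin] with u hu
    have hu : u < t := hu
    simp only [Set.mem_Iio]
    gcongr

lemma signChange_renorm_iff (ha : ω.1 a ≠ 0) {t : ℝ≥0} (ht : 0 < t) :
    (renorm α a ω).1 t * Function.leftLim (renorm α a ω).1 t < 0 ↔
      ω.1 (a + ‖ω.1 a‖₊ ^ α * t) * Function.leftLim ω.1 (a + ‖ω.1 a‖₊ ^ α * t) < 0 := by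
  rw [leftLim_renorm ha ht, renorm_apply, div_mul_div_comm, div_lt_iff₀ (by positivity), zero_mul]

/-- Restarting turns the changes of sign after a given time into those of the restarted path. -/
lemma iInf_signChange_renorm (ha : ω.1 a ≠ 0) (h : ℝ≥0∞) :
    (⨅ (t : ℝ≥0) (_ : (a : ℝ≥0∞) + (‖ω.1 a‖₊ ^ α : ℝ≥0) * h < t ∧
        ω.1 t * Function.leftLim ω.1 t < 0), (t : ℝ≥0∞)) =
      a + (‖ω.1 a‖₊ ^ α : ℝ≥0) * ⨅ (t : ℝ≥0) (_ : h < t ∧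
        (renorm α a ω).1 t * Function.leftLim (renorm α a ω).1 t < 0), (t : ℝ≥0∞) := by
  have hc := scale_pos (α := α) ha
  have hc0 : ((‖ω.1 a‖₊ ^ α : ℝ≥0) : ℝ≥0∞) ≠ 0 := ENNReal.coe_ne_zero.2 hc.ne'
  have hiff (t : ℝ≥0) : (a : ℝ≥0∞) + (‖ω.1 a‖₊ ^ α : ℝ≥0) * h <
      ((a + ‖ω.1 a‖₊ ^ α * t : ℝ≥0) : ℝ≥0∞) ↔ h < t := by
    rw [ENNReal.coe_add, ENNReal.coe_mul, ENNReal.add_lt_add_iff_left ENNReal.coe_ne_top,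
      ENNReal.mul_lt_mul_iff_right (by simpa using hc.ne') ENNReal.coe_ne_top]
  refine le_antisymm ?_ (le_iInf₂ fun t ht => ?_)
  · rw [← tsub_le_iff_left, ← ENNReal.div_le_iff' hc0 ENNReal.coe_ne_top]
    refine le_iInf₂ fun t ht => ?_
    rw [ENNReal.div_le_iff' hc0 ENNReal.coe_ne_top, tsub_le_iff_left]
    refine (iInf₂_le (a + ‖ω.1 a‖₊ ^ α * t) ⟨(hiff t).2 ht.1, ?_⟩).trans_eq ?_
    · rw [ENNReal.coe_add, ENNReal.coe_mul]
    · exact (signChange_renorm_iff ha (by exact_mod_cast (zero_le.trans_lt ht.1))).1 ht.2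
  · have hat : a ≤ t := by exact_mod_cast (le_self_add.trans ht.1.le)
    obtain ⟨t', rfl⟩ := exists_eq_add_mul hc hat
    have h1 := (hiff t').1 ht.1
    push_cast
    gcongr
    exact iInf₂_le t' ⟨h1,
      (signChange_renorm_iff ha (by exact_mod_cast (zero_le.trans_lt h1))).2 ht.2⟩

/-- If the path is restarted at its `j`-th change of sign then its later changes of sign are those
of the restarted path. -/
lemma signChange_add (ha : ω.1 a ≠ 0) {j : ℕ} (hj : signChange j ω = a) (n : ℕ) :
    signChange (n + j) ω = a + (‖ω.1 a‖₊ ^ α : ℝ≥0) * signChange n (renorm α a ω) := by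
  induction n with
  | zero => simp [signChange, hj]
  | succ n ih =>
    rw [show n + 1 + j = (n + j) + 1 by ring, signChange, signChange, ih]
    exact iInf_signChange_renorm ha _

lemma KeepsSign.mul_leftLim_nonneg {t u : ℝ≥0} (h : KeepsSign ω t) (hu : u ≤ t) :
    0 ≤ ω.1 u * Function.leftLim ω.1 u := by
  rcases eq_or_ne u 0 with rfl | hu0
  · rw [leftLim_zero]; exact mul_self_nonneg _
  have := nhdsLT_neBot_of_pos (pos_iff_ne_zero.2 hu0)
  have h1 : 0 ≤ Function.leftLim ω.1 u * ω.1 0 := by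
    refine ge_of_tendsto ((ω.2.tendsto_leftLim u).mul_const (ω.1 0)) ?_
    filter_upwards [self_mem_nhdsWithin] with v hv
    exact (h.mul_pos (le_of_lt hv |>.trans hu)).le
  have h2 := h.mul_pos hu
  have h3 : 0 < ω.1 0 * ω.1 0 := mul_self_pos.2 (h.ne_zero zero_le)
  refine nonneg_of_mul_nonneg_left ?_ h3
  nlinarith [mul_nonneg h1 h2.le]

/-- No change of sign occurs as long as the path is bounded away from zero on one side. -/
lemma KeepsSign.lt_signChange {t : ℝ≥0} (h : KeepsSign ω t) : (t : ℝ≥0∞) < signChange 1 ω := by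
  obtain ⟨b, hb, hb'⟩ := h.exists_gt
  refine (ENNReal.coe_lt_coe.2 hb).trans_le (le_iInf₂ fun u hu => ?_)
  by_contra! hlt
  exact absurd hu.2 (not_lt.2 (hb'.mul_leftLim_nonneg (by exact_mod_cast hlt.le)))

lemma add_hitZero_renorm_le (ha : ω.1 a ≠ 0) (h : (a : ℝ≥0∞) < hitZero ω) :
    a + (‖ω.1 a‖₊ ^ α : ℝ≥0) * hitZero (renorm α a ω) ≤ hitZero ω := by
  refine le_iInf₂ fun t ht => ?_
  have hat : a < t := by exact_mod_cast h.trans_le (iInf₂_le t ht)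
  obtain ⟨t', rfl⟩ := exists_eq_add_mul (scale_pos (α := α) ha) hat.le
  push_cast
  gcongr
  refine iInf₂_le t' ⟨?_, ?_⟩
  · rw [pos_iff_ne_zero]; rintro rfl; simp at hat
  · rw [renorm_apply, ht.2, zero_div]

/-- If two times of changes of sign correspond to each other under restarting then so do the values
of the paths. -/
lemma valueH_renorm (ha : ω.1 a ≠ 0) {m n : ℕ}
    (h : signChange m ω = a + (‖ω.1 a‖₊ ^ α : ℝ≥0) * signChange n (renorm α a ω))
    (hn : signChange n (renorm α a ω) ≠ ⊤) :
    (signChange m ω).toNNReal = a + ‖ω.1 a‖₊ ^ α * (signChange n (renorm α a ω)).toNNReal ∧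
      valueH m ω = |ω.1 a| * valueH n (renorm α a ω) := by
  have h1 : (signChange m ω).toNNReal =
      a + ‖ω.1 a‖₊ ^ α * (signChange n (renorm α a ω)).toNNReal := by
    rw [h, ENNReal.toNNReal_add ENNReal.coe_ne_top (ENNReal.mul_ne_top ENNReal.coe_ne_top hn),
      ENNReal.toNNReal_mul, ENNReal.toNNReal_coe, ENNReal.toNNReal_coe]
  refine ⟨h1, ?_⟩
  rw [valueH, valueH, h1, renorm_apply, mul_div_cancel₀ _ (abs_pos.2 ha).ne']

lemma leftValueH_renorm (ha : ω.1 a ≠ 0) {m n : ℕ}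
    (h : signChange m ω = a + (‖ω.1 a‖₊ ^ α : ℝ≥0) * signChange n (renorm α a ω))
    (hn : signChange n (renorm α a ω) ≠ ⊤) (hn0 : 0 < signChange n (renorm α a ω)) :
    leftValueH m ω = |ω.1 a| * leftValueH n (renorm α a ω) := by
  rw [leftValueH, leftValueH, leftLim_renorm ha (ENNReal.toNNReal_pos hn0.ne' hn),
    (valueH_renorm ha h hn).1, mul_div_cancel₀ _ (abs_pos.2 ha).ne']

lemma jumpRatio_renorm (ha : ω.1 a ≠ 0) {m n : ℕ}
    (h : signChange (m + 1) ω = a + (‖ω.1 a‖₊ ^ α : ℝ≥0) * signChange (n + 1) (renorm α a ω))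
    (hn : signChange (n + 1) (renorm α a ω) ≠ ⊤)
    (hn0 : 0 < signChange (n + 1) (renorm α a ω)) :
    jumpRatio m ω = jumpRatio n (renorm α a ω) := by
  rw [jumpRatio, jumpRatio, (valueH_renorm ha h hn).2, leftValueH_renorm ha h hn hn0,
    mul_div_mul_left _ _ (abs_pos.2 ha).ne']

lemma piece_renorm (ha : ω.1 a ≠ 0) {m n : ℕ}
    (h : signChange m ω = a + (‖ω.1 a‖₊ ^ α : ℝ≥0) * signChange n (renorm α a ω))
    (h' : signChange (m + 1) ω = a + (‖ω.1 a‖₊ ^ α : ℝ≥0) * signChange (n + 1) (renorm α a ω))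
    (hn : signChange n (renorm α a ω) ≠ ⊤) :
    piece α m ω = piece α n (renorm α a ω) := by
  obtain ⟨h1, h2⟩ := valueH_renorm ha h hn
  have hc := scale_pos (α := α) ha
  funext t
  have hnorm : ‖valueH m ω‖₊ = ‖ω.1 a‖₊ * ‖valueH n (renorm α a ω)‖₊ := by
    rw [h2, nnnorm_mul]; simp
  have hlen : ((‖valueH m ω‖₊ ^ (-α) : ℝ≥0) : ℝ≥0∞) * (signChange (m + 1) ω - signChange m ω) =
      ((‖valueH n (renorm α a ω)‖₊ ^ (-α) : ℝ≥0) : ℝ≥0∞) *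
        (signChange (n + 1) (renorm α a ω) - signChange n (renorm α a ω)) := by
    rw [h, h', ENNReal.add_sub_add_eq_sub_left ENNReal.coe_ne_top,
      ← ENNReal.mul_sub (fun _ _ => ENNReal.coe_ne_top), ← mul_assoc, ← ENNReal.coe_mul, hnorm,
      NNReal.mul_rpow, mul_right_comm, NNReal.rpow_neg, inv_mul_cancel₀ hc.ne', one_mul]
  rw [piece, piece, hlen]
  congr 2
  rw [h1, hnorm, NNReal.mul_rpow, h2, abs_mul, abs_abs, renorm_apply, div_div, mul_add, mul_assoc,
    add_assoc]

lemma piece_zero (α : ℝ) {ω : Path} (h : |ω.1 0| = 1) : piece α 0 ω = firstPiece ω := by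
  have hv : valueH 0 ω = ω.1 0 := by simp [valueH, signChange]
  have hn : ‖valueH 0 ω‖₊ = 1 := by
    rw [hv]; ext; simpa using h
  funext t
  rw [piece, firstPiece, hn, hv, h]
  simp [signChange]

/-! ### Restarting before the first change of sign -/

lemma keepsSign_add_iff (h : KeepsSign ω a) {t : ℝ≥0} :
    KeepsSign ω (a + ‖ω.1 a‖₊ ^ α * t) ↔ KeepsSign (renorm α a ω) t := by
  have ha := h.ne_zero le_rfl
  have hc := scale_pos (α := α) ha
  have h0 := h.ne_zero zero_le
  have h0' : 0 < ω.1 0 ^ 2 := by positivity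
  have ha' : 0 < ω.1 a ^ 2 := by positivity
  have hpos := h.mul_pos le_rfl
  have hη (w : ℝ≥0) : (renorm α a ω).1 w * (renorm α a ω).1 0 =
      ω.1 (a + ‖ω.1 a‖₊ ^ α * w) * ω.1 a / ω.1 a ^ 2 := by
    rw [renorm_zero_apply, renorm_apply, div_mul_div_comm, ← sq, sq_abs]
  constructor
  · intro hk
    obtain ⟨c, hc0, hk⟩ := hk.exists_pos
    refine keepsSign_of_forall (c := c * (ω.1 a * ω.1 0) / ω.1 0 ^ 2 / ω.1 a ^ 2)
      (by positivity) fun w hw => ?_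
    have h1 := hk (a + ‖ω.1 a‖₊ ^ α * w) (by gcongr)
    rw [hη]
    gcongr
    rw [div_le_iff₀ h0']
    nlinarith [mul_le_mul_of_nonneg_right h1 hpos.le]
  · intro hk
    obtain ⟨c, hc0, hk⟩ := hk.exists_pos
    obtain ⟨c', hc0', hk'⟩ := h.exists_pos
    refine keepsSign_of_forall (c := min c' (c * (ω.1 a * ω.1 0)))
      (by positivity) fun u hu => ?_
    rcases le_total u a with hua | hua
    · exact (min_le_left _ _).trans (hk' u hua)
    · obtain ⟨w, rfl⟩ := exists_eq_add_mul hc hua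
      refine (min_le_right _ _).trans ?_
      have hw : w ≤ t := le_of_mul_le_mul_left (le_of_add_le_add_left hu) hc
      have h1 := hk w hw
      rw [hη, le_div_iff₀ ha'] at h1
      have h2 := mul_le_mul_of_nonneg_right h1 hpos.le
      refine le_of_mul_le_mul_right ?_ ha'
      nlinarith

/-- Self-similarity makes the clock additive: the factor from rescaling space cancels the one from
rescaling time. -/
lemma clock_add (h : KeepsSign ω a) {t : ℝ≥0} (ht : KeepsSign (renorm α a ω) t) :
    clock α ω (a + ‖ω.1 a‖₊ ^ α * t) = clock α ω a + clock α (renorm α a ω) t := by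
  have ha := h.ne_zero le_rfl
  have hc := scale_pos (α := α) ha
  set c : ℝ≥0 := ‖ω.1 a‖₊ ^ α with hcdef
  have hc' : (0 : ℝ) < c := NNReal.coe_pos.2 hc
  rw [clock, expFunctional_eq_add _ _ (le_self_add : a ≤ a + c * t)]
  congr 1
  have himg : Set.Icc (a : ℝ) ((a + c * t : ℝ≥0) : ℝ) =
      (fun w : ℝ => (c : ℝ) * w + a) '' Set.Icc 0 (t : ℝ) := by
    rw [Set.image_affine_Icc' hc']; push_cast; ring_nf
  rw [himg, lintegral_image_eq_lintegral_abs_deriv_mul (f' := fun _ => (c : ℝ)) measurableSet_Icc]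
  · refine setLIntegral_congr_fun measurableSet_Icc fun w hw => ?_
    have hwt := Real.toNNReal_le_iff_le_coe.2 hw.2
    have h1 : ((c : ℝ) * w + a).toNNReal = a + c * w.toNNReal := by
      rw [Real.toNNReal_add (by positivity [hw.1]) a.coe_nonneg, Real.toNNReal_mul c.coe_nonneg,
        Real.toNNReal_coe, Real.toNNReal_coe, add_comm]
    have h2 : ω.1 (a + c * w.toNNReal) ≠ 0 := by
      have := ht.ne_zero hwt
      rw [renorm_apply] at this
      exact (div_ne_zero_iff.1 this).1
    beta_reduce
    rw [h1, renorm_apply, Real.log_div h2 (abs_pos.2 ha).ne', abs_of_pos hc',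
      ← ENNReal.ofReal_mul hc'.le, mul_sub, sub_eq_add_neg, Real.exp_add, mul_comm]
    congr 2
    rw [hcdef, NNReal.coe_rpow, coe_nnnorm, Real.norm_eq_abs, Real.rpow_def_of_pos (abs_pos.2 ha)]
    congr 1
    ring
  · intro w _
    simpa using (((hasDerivAt_id w).const_mul (c : ℝ)).add_const (a : ℝ)).hasDerivWithinAt
  · intro x _ y _ hxy
    simpa [hc'.ne'] using hxy

lemma invClock_add (hα : 0 < α) {s : ℝ≥0} (hs : invClock α s ω = a) (t : ℝ≥0) :
    invClock α (s + t) ω = (invClock α t (renorm α a ω)).map (fun b => a + ‖ω.1 a‖₊ ^ α * b) := by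
  obtain ⟨h, hcl⟩ := (invClock_eq_coe_iff hα).1 hs
  have hc := scale_pos (α := α) (h.ne_zero le_rfl)
  cases hb : invClock α t (renorm α a ω) with
  | coe b =>
    obtain ⟨h1, h2⟩ := (invClock_eq_coe_iff hα).1 hb
    rw [WithTop.map_coe, invClock_eq_coe_iff hα, keepsSign_add_iff h, clock_add h h1, hcl, h2]
    exact ⟨h1, by push_cast; rfl⟩
  | top =>
    rw [WithTop.map_top]
    by_contra hne
    obtain ⟨u, hu⟩ := WithTop.ne_top_iff_exists.1 hne
    obtain ⟨h1, h2⟩ := (invClock_eq_coe_iff hα).1 hu.symm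
    have hau : a ≤ u := by
      by_contra! hlt
      have h3 := h1.clock_lt hα hlt
      rw [h2, hcl] at h3
      exact absurd h3 (not_lt.2 (by simp))
    obtain ⟨b, rfl⟩ := exists_eq_add_mul hc hau
    rw [keepsSign_add_iff h] at h1
    rw [clock_add h h1, hcl, ENNReal.coe_add, ENNReal.add_right_inj ENNReal.coe_ne_top] at h2
    have := (invClock_eq_coe_iff hα).2 ⟨h1, h2⟩
    rw [hb] at this
    exact WithTop.top_ne_coe this

/-- The increments of the Lamperti transform are those of the Lamperti transform of the restarted
path. -/
lemma logPath_add (hα : 0 < α) {s : ℝ≥0} (hs : invClock α s ω = a) (t : ℝ≥0) :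
    logPath α ω (s + t) = (logPath α (renorm α a ω) t).map (fun x => Real.log (ω.1 a) + x) := by
  have h := ((invClock_eq_coe_iff hα).1 hs).1
  have ha := abs_pos.2 (h.ne_zero le_rfl)
  rw [logPath, logPath, invClock_add hα hs]
  cases hb : invClock α t (renorm α a ω) with
  | top => rfl
  | coe b =>
    have h1 := ((invClock_eq_coe_iff hα).1 hb).1
    rw [← keepsSign_add_iff h] at h1
    rw [WithTop.map_coe, WithTop.map_coe, WithTop.map_coe, WithTop.map_coe, renorm_apply,
      Real.log_div (h1.ne_zero le_rfl) ha.ne', Real.log_abs]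
    congr 1
    ring

lemma invClock_zero (hα : 0 < α) (h : ω.1 0 ≠ 0) : invClock α 0 ω = (0 : ℝ≥0) := by
  rw [invClock_eq_coe_iff hα, clock_zero]
  exact ⟨keepsSign_zero h, rfl⟩

lemma logPath_zero (hα : 0 < α) (h : ω.1 0 ≠ 0) :
    logPath α ω 0 = (Real.log (ω.1 0) : ℝ) := by
  rw [logPath, invClock_zero hα h, WithTop.map_coe]

end Renorm


/-! ### The strong Markov property in rescaled form -/

section Markov

variable {α : ℝ} {P : ℝ → Measure Path}

lemma ne_zero_of_abs_eq_one {ε : ℝ} (hε : |ε| = 1) : ε ≠ 0 := by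
  rintro rfl; simp at hε

lemma div_abs_eq {ε v : ℝ} (hε : |ε| = 1) (h : 0 < v * ε) : v / |v| = ε := by
  rcases (abs_eq zero_le_one).1 hε with rfl | rfl
  · rw [abs_of_pos (by linarith), div_self (by linarith)]
  · rw [abs_of_neg (by linarith), div_neg, div_self (by linarith)]

/-- Rescaling the starting point to `1` or `-1`. -/
lemma IsSelfSimilarMarkov.map_renorm_zero (hP : IsSelfSimilarMarkov α P) {x : ℝ} (hx : x ≠ 0) :
    (P x).map (renorm α 0) = P (x / |x|) := by
  have hm : Measurable (renorm α 0) := measurable_renorm α measurable_const measurable_id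
  have hx' : 0 < ‖x‖₊ := by simpa using hx
  ext B hB
  rw [Measure.map_apply hm hB]
  obtain ⟨B', hB', rfl⟩ := hB
  have hsc := congrArg (fun μ => μ B') (hP.scaling ‖x‖₊⁻¹ (inv_pos.2 hx') x hx)
  have h1 : ((‖x‖₊⁻¹ : ℝ≥0) : ℝ) * x = x / |x| := by
    rw [NNReal.coe_inv, coe_nnnorm, Real.norm_eq_abs]; ring
  have hm1 : Measurable fun (ω : Path) (t : ℝ≥0) =>
      ((‖x‖₊⁻¹ : ℝ≥0) : ℝ) * ω.1 (‖x‖₊⁻¹ ^ (-α) * t) :=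
    measurable_pi_lambda _ fun t => (measurable_coord _).const_mul _
  have hm2 : Measurable fun (ω : Path) (t : ℝ≥0) => ω.1 t :=
    measurable_pi_lambda _ fun t => measurable_coord t
  rw [h1, Measure.map_apply hm1 hB', Measure.map_apply hm2 hB'] at hsc
  refine Eq.trans (measure_congr ?_) hsc
  filter_upwards [hP.start x hx] with ω hω
  refine propext ?_
  have : (renorm α 0 ω).1 = fun t =>
      ((‖x‖₊⁻¹ : ℝ≥0) : ℝ) * ω.1 (‖x‖₊⁻¹ ^ (-α) * t) := by
    funext t
    rw [renorm_apply, hω, zero_add, NNReal.inv_rpow, NNReal.rpow_neg, inv_inv, NNReal.coe_inv,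
      coe_nnnorm, Real.norm_eq_abs]
    ring
  change (renorm α 0 ω).1 ∈ B' ↔ _ ∈ B'
  rw [this]

/-- The strong Markov property together with the scaling property: if the path has the sign `ε` at
the stopping time `τ` then the path restarted at `τ` and rescaled is independent of the past
of `τ`, with law `P ε`. -/
lemma IsSelfSimilarMarkov.measure_inter_renorm (hP : IsSelfSimilarMarkov α P) {x : ℝ} (hx : x ≠ 0)
    {ε : ℝ} (hε : |ε| = 1) {τ : Path → WithTop ℝ≥0} (hτ : IsStoppingTime pathFiltration τ)
    {A : Set Path} (hA : MeasurableSet[hτ.measurableSpace] A)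
    (hAτ : ∀ ω ∈ A, ∃ t : ℝ≥0, τ ω = t ∧ 0 < ω.1 t * ε) {B : Set Path} (hB : MeasurableSet B) :
    P x (A ∩ {ω | renorm α ((τ ω).untopD 0) ω ∈ B}) = P x A * P ε B := by
  have hm : Measurable (renorm α 0) := measurable_renorm α measurable_const measurable_id
  obtain ⟨B', hB', hBB'⟩ := hm hB
  have hA' : A ∩ {ω | τ ω ≠ ⊤ ∧ valueAt τ ω ≠ 0} = A := by
    refine Set.inter_eq_left.2 fun ω hω => ?_
    obtain ⟨t, ht, hpos⟩ := hAτ ω hω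
    refine ⟨ht ▸ WithTop.coe_ne_top, ?_⟩
    rw [valueAt, ht, WithTop.untopD_coe]
    exact left_ne_zero_of_mul hpos.ne'
  have hS : {ω | shiftAt τ ω ∈ B'} = {ω | renorm α ((τ ω).untopD 0) ω ∈ B} := by
    ext ω
    set a := (τ ω).untopD 0
    let η : Path := ⟨fun t => ω.1 (a + t),
      ω.2.comp_monotone (by fun_prop) (fun _ _ h => by gcongr)⟩
    have h1 : renorm α 0 η = renorm α a ω := by
      refine coord_ext fun t => ?_
      simp [renorm_apply, η]
    have h2 : η ∈ Subtype.val ⁻¹' B' ↔ η ∈ renorm α 0 ⁻¹' B := by rw [hBB']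
    change shiftAt τ ω ∈ B' ↔ renorm α a ω ∈ B
    rw [← h1]
    exact h2
  have hM := hP.strongMarkov x hx τ hτ A hA B' hB'
  rw [hA', hS] at hM
  rw [hM, setLIntegral_congr_fun (g := fun _ => P ε B) (hτ.measurableSpace_le A hA),
    setLIntegral_const, mul_comm]
  intro ω hω
  obtain ⟨t, ht, hpos⟩ := hAτ ω hω
  have hv : valueAt τ ω = ω.1 t := by rw [valueAt, ht, WithTop.untopD_coe]
  beta_reduce
  rw [hv]
  have h2 := hP.map_renorm_zero (left_ne_zero_of_mul hpos.ne')
  rw [div_abs_eq hε hpos] at h2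
  rw [← h2, Measure.map_apply hm hB, ← hBB']
  rfl

end Markov

/-! ### Regular paths -/

/-- The path, at the cemetery point `⊤` from its first loss of sign on. -/
def killedPath (ω : Path) (t : ℝ≥0) : WithTop ℝ :=
  if (t : WithTop ℝ≥0) < life ω then ((ω.1 t : ℝ) : WithTop ℝ) else ⊤

/-- The quotient of the values after and before the first loss of sign. -/
def lifeRatio (ω : Path) : ℝ :=
  ω.1 ((life ω).untopD 0) / Function.leftLim ω.1 ((life ω).untopD 0)

/-- The path restarted at its first loss of sign and rescaled. -/
def restart (α : ℝ) (ω : Path) : Path := renorm α ((life ω).untopD 0) ω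

lemma measurable_killedPath : Measurable killedPath := by
  refine measurable_pi_lambda _ fun t => ?_
  exact Measurable.ite (measurableSet_lt measurable_const measurable_life)
    (measurable_coord t).withTop_coe measurable_const

lemma measurable_lifeRatio : Measurable lifeRatio :=
  ((measurable_life.untopD 0).eval_path measurable_id).div
    ((measurable_life.untopD 0).leftLim_path measurable_id)

lemma measurable_restart (α : ℝ) : Measurable (restart α) :=
  measurable_renorm α (measurable_life.untopD 0) measurable_id

lemma killedPath_stopPath {t : ℝ≥0} {ω : Path} (h : life ω ≤ t) :
    killedPath (stopPath t ω) = killedPath ω := by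
  funext s
  rw [killedPath, killedPath, life_stopPath h]
  split_ifs with hs
  · rw [stopPath_apply (WithTop.coe_le_coe.1 (hs.le.trans h))]
  · rfl

lemma lifeRatio_stopPath {t : ℝ≥0} {ω : Path} (h : life ω ≤ t) :
    lifeRatio (stopPath t ω) = lifeRatio ω := by
  obtain ⟨u, hu, hut⟩ := WithTop.le_coe_iff.1 h
  rw [lifeRatio, lifeRatio, life_stopPath h, hu, WithTop.untopD_coe, stopPath_apply hut]
  rcases eq_or_ne u 0 with rfl | h0
  · rw [leftLim_zero, leftLim_zero, stopPath_apply zero_le]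
  · rw [leftLim_congr ω.2 (pos_iff_ne_zero.2 h0)
      fun s hs => stopPath_apply (hs.le.trans hut) ω]

/-- A path is regular if it starts from a nonzero point and changes sign before hitting zero, by a
jump at the very time at which it ceases to be bounded away from zero. -/
structure IsRegular (ω : Path) : Prop where
  zero_ne : ω.1 0 ≠ 0
  exists_life : ∃ l : ℝ≥0, life ω = l ∧ signChange 1 ω = l ∧ (l : ℝ≥0∞) < hitZero ω ∧
    ω.1 l * Function.leftLim ω.1 l < 0

/-- A path which does not approach `0` continuously at its first loss of sign, and which changes
sign before hitting zero, changes sign at this very time. -/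
lemma isRegular_of_leftLim_ne_zero {ω : Path} (h0 : ω.1 0 ≠ 0)
    (hH : signChange 1 ω < hitZero ω)
    (hl : ∀ l : ℝ≥0, life ω = l → Function.leftLim ω.1 l ≠ 0) : IsRegular ω := by
  refine ⟨h0, ?_⟩
  have hH' : signChange 1 ω ≠ ⊤ := ne_top_of_lt hH
  have hle : life ω ≤ ((signChange 1 ω).toNNReal : ℝ≥0) := by
    rw [life_le_iff]
    intro hk
    have := hk.lt_signChange
    rw [ENNReal.coe_toNNReal hH'] at this
    exact lt_irrefl _ this
  obtain ⟨l, hlife, hlH⟩ := WithTop.le_coe_iff.1 hle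
  replace hlH : (l : ℝ≥0∞) ≤ signChange 1 ω := by
    rw [← ENNReal.coe_toNNReal hH']; exact_mod_cast hlH
  have hnk : ¬ KeepsSign ω l := life_le_iff.1 hlife.le
  have hk {s : ℝ≥0} (hs : s < l) : KeepsSign ω s :=
    lt_life_iff.1 (by rw [hlife]; exact_mod_cast hs)
  have hl0 : 0 < l := by
    rw [pos_iff_ne_zero]
    rintro rfl
    exact hnk (keepsSign_zero h0)
  have hne := nhdsLT_neBot_of_pos hl0
  have hlim := (ω.2.tendsto_leftLim l).mul_const (ω.1 0)
  have hpos : 0 < Function.leftLim ω.1 l * ω.1 0 := by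
    refine lt_of_le_of_ne ?_ (mul_ne_zero (hl l hlife) h0).symm
    refine ge_of_tendsto hlim ?_
    filter_upwards [self_mem_nhdsWithin] with v hv
    exact ((hk hv).mul_pos le_rfl).le
  -- Otherwise the path would have kept its sign up to time `l`.
  have hval : ω.1 l * ω.1 0 ≤ 0 := by
    by_contra! hval
    refine hnk ?_
    have h1 := hlim.eventually_const_lt (half_lt_self hpos)
    obtain ⟨b, hb, hb'⟩ := (mem_nhdsLT_iff_exists_Ioo_subset' hl0).1 h1
    have hb : b < l := hb
    obtain ⟨b', hbb', hb'l⟩ := exists_between hb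
    obtain ⟨c, hc, hcc⟩ := (hk hb'l).exists_pos
    refine keepsSign_of_forall (c := min c (min (Function.leftLim ω.1 l * ω.1 0 / 2)
      (ω.1 l * ω.1 0))) (by positivity) fun u hu => ?_
    rcases hu.eq_or_lt with rfl | hu
    · exact (min_le_right _ _).trans (min_le_right _ _)
    rcases le_total u b' with hub | hub
    · exact (min_le_left _ _).trans (hcc u hub)
    · exact (min_le_right _ _).trans ((min_le_left _ _).trans
        (le_of_lt (hb' ⟨hbb'.trans_le hub, hu⟩)))
  have hlT : (l : ℝ≥0∞) < hitZero ω := hlH.trans_lt hH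
  have hval0 : ω.1 l ≠ 0 := fun h => not_lt.2 (iInf₂_le l ⟨hl0, h⟩) hlT
  have hneg : ω.1 l * Function.leftLim ω.1 l < 0 := by
    have h1 : ω.1 l * ω.1 0 < 0 := lt_of_le_of_ne hval (mul_ne_zero hval0 h0)
    have h2 : 0 < ω.1 0 * ω.1 0 := mul_self_pos.2 h0
    refine neg_of_mul_neg_left ?_ h2.le
    nlinarith [mul_neg_of_neg_of_pos h1 hpos]
  refine ⟨l, hlife, le_antisymm (iInf₂_le l ⟨?_, hneg⟩) hlH, hlT, hneg⟩
  simpa [signChange] using hl0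

lemma IsRegular.lt_signChange_iff {ω : Path} (h : IsRegular ω) {t : ℝ≥0} :
    (t : ℝ≥0∞) < signChange 1 ω ↔ (t : WithTop ℝ≥0) < life ω := by
  obtain ⟨l, h1, h2, -⟩ := h.exists_life
  rw [h1, h2, ENNReal.coe_lt_coe, WithTop.coe_lt_coe]

lemma IsRegular.firstPiece_eq {ω : Path} (h : IsRegular ω) : firstPiece ω = killedPath ω := by
  funext t
  simp only [firstPiece, killedPath, h.lt_signChange_iff]

lemma IsRegular.jumpRatio_eq {ω : Path} (h : IsRegular ω) : jumpRatio 0 ω = lifeRatio ω := by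
  obtain ⟨l, h1, h2, -⟩ := h.exists_life
  rw [jumpRatio, lifeRatio, valueH, leftValueH, zero_add, h2, h1, ENNReal.toNNReal_coe,
    WithTop.untopD_coe]

/-- A path all of whose successive restarts at changes of sign are regular. -/
def IsPersistent (α : ℝ) (ω : Path) : Prop := ∀ n, IsRegular ((restart α)^[n] ω)

lemma IsPersistent.tail {α : ℝ} {ω : Path} (h : IsPersistent α ω) :
    IsPersistent α (restart α ω) := fun n => by
  rw [← Function.iterate_succ_apply]; exact h (n + 1)

lemma IsPersistent.signChange_succ {α : ℝ} {ω : Path} (h : IsPersistent α ω) :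
    ∃ l : ℝ≥0, life ω = l ∧ ω.1 l ≠ 0 ∧ restart α ω = renorm α l ω ∧ (l : ℝ≥0∞) < hitZero ω ∧
      ω.1 l * Function.leftLim ω.1 l < 0 ∧
      ∀ n, signChange (n + 1) ω =
        l + (‖ω.1 l‖₊ ^ α : ℝ≥0) * signChange n (restart α ω) := by
  obtain ⟨l, h1, h2, h3, h4⟩ := (h 0).exists_life
  simp only [Function.iterate_zero, id_eq] at h1 h2 h3 h4
  have hr : restart α ω = renorm α l ω := by
    rw [restart, h1, WithTop.untopD_coe]
  have h0 := left_ne_zero_of_mul h4.ne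
  refine ⟨l, h1, h0, hr, h3, h4, fun n => ?_⟩
  rw [hr]
  exact signChange_add h0 h2 n

lemma IsPersistent.wellDefined {α : ℝ} (n : ℕ) {ω : Path} (h : IsPersistent α ω) :
    signChange n ω < signChange (n + 1) ω ∧ signChange (n + 1) ω < hitZero ω ∧
      valueH n ω ≠ 0 ∧ valueH (n + 1) ω * leftValueH (n + 1) ω < 0 := by
  obtain ⟨l, h1, h0, hr, h3, h4, h5⟩ := h.signChange_succ
  have hc := scale_pos (α := α) h0
  have hc' : ((‖ω.1 l‖₊ ^ α : ℝ≥0) : ℝ≥0∞) ≠ 0 := ENNReal.coe_ne_zero.2 hc.ne'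
  have hl : signChange 1 ω = l := by simpa [signChange] using h5 0
  induction n generalizing ω l with
  | zero =>
    have hω0 := (h 0).zero_ne
    simp only [Function.iterate_zero, id_eq] at hω0
    refine ⟨?_, by rw [hl]; exact h3, by simpa [valueH, signChange] using hω0, ?_⟩
    · refine (keepsSign_zero hω0).lt_signChange.trans_eq' ?_
      simp [signChange]
    · rw [valueH, leftValueH, hl]; simpa using h4
  | succ n ih =>
    obtain ⟨l', k1, k0, kr, k3, k4, k5⟩ := h.tail.signChange_succ
    have kc := scale_pos (α := α) k0
    obtain ⟨i1, i2, i3, i4⟩ := ih h.tail l' k1 k0 kr k3 k4 k5 kc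
      (ENNReal.coe_ne_zero.2 kc.ne') (by simpa [signChange] using k5 0)
    have hn := ne_top_of_lt i1
    have hn' := ne_top_of_lt i2
    have hpos := zero_le.trans_lt i1
    have e1 := h5 n
    have e2 := h5 (n + 1)
    rw [hr] at e1 e2 i1 i2 i3 i4 hn hn' hpos
    refine ⟨?_, ?_, ?_, ?_⟩
    · rw [e1, e2]
      exact (ENNReal.add_lt_add_iff_left ENNReal.coe_ne_top).2
        ((ENNReal.mul_lt_mul_iff_right hc' ENNReal.coe_ne_top).2 i1)
    · rw [e2]
      refine lt_of_lt_of_le ?_ (add_hitZero_renorm_le (α := α) h0 h3)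
      exact (ENNReal.add_lt_add_iff_left ENNReal.coe_ne_top).2
        ((ENNReal.mul_lt_mul_iff_right hc' ENNReal.coe_ne_top).2 i2)
    · rw [(valueH_renorm h0 e1 hn).2]
      exact mul_ne_zero (abs_pos.2 h0).ne' i3
    · rw [(valueH_renorm h0 e2 hn').2, leftValueH_renorm h0 e2 hn' hpos,
        mul_mul_mul_comm]
      exact mul_neg_of_pos_of_neg (by positivity) i4

lemma IsPersistent.piece_eq {α : ℝ} (n : ℕ) {ω : Path} (h : IsPersistent α ω)
    (h1 : |ω.1 0| = 1) : piece α n ω = killedPath ((restart α)^[n] ω) := by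
  induction n generalizing ω with
  | zero => rw [piece_zero α h1]; exact (h 0).firstPiece_eq
  | succ n ih =>
    obtain ⟨l, -, h0, hr, -, -, h5⟩ := h.signChange_succ
    have e1 := h5 n
    have e2 := h5 (n + 1)
    have hn := ne_top_of_lt (h.tail.wellDefined n).1
    rw [Function.iterate_succ_apply, ← ih h.tail]
    · rw [hr] at e1 e2 hn ⊢
      exact piece_renorm h0 e1 e2 hn
    · rw [hr, renorm_zero_apply, abs_div, abs_abs, div_self (abs_pos.2 h0).ne']

lemma IsPersistent.jumpRatio_eq {α : ℝ} (n : ℕ) {ω : Path} (h : IsPersistent α ω) :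
    jumpRatio n ω = lifeRatio ((restart α)^[n] ω) := by
  induction n generalizing ω with
  | zero => exact (h 0).jumpRatio_eq
  | succ n ih =>
    obtain ⟨l, -, h0, hr, -, -, h5⟩ := h.signChange_succ
    have e2 := h5 (n + 1)
    obtain ⟨i1, i2, -⟩ := h.tail.wellDefined n
    have hn := ne_top_of_lt i2
    have hpos := zero_le.trans_lt i1
    rw [Function.iterate_succ_apply, ← ih h.tail]
    rw [hr] at e2 hn hpos ⊢
    exact jumpRatio_renorm h0 e2 hn hpos


/-! ### Almost sure regularity -/

section Regular

variable {α : ℝ} {P : ℝ → Measure Path}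

/-- The first loss of sign, in terms of the path restarted before it. -/
lemma life_renorm {ω : Path} {a : ℝ≥0} (h : KeepsSign ω a) :
    life ω = (life (renorm α a ω)).map (fun b => a + ‖ω.1 a‖₊ ^ α * b) := by
  have hc := scale_pos (α := α) (h.ne_zero le_rfl)
  have key (b : ℝ≥0) : life ω ≤ ((a + ‖ω.1 a‖₊ ^ α * b : ℝ≥0) : WithTop ℝ≥0) ↔
      life (renorm α a ω) ≤ b := by
    rw [life_le_iff, life_le_iff, keepsSign_add_iff h]
  have hex {u : ℝ≥0} (hu : life ω ≤ u) : ∃ b, u = a + ‖ω.1 a‖₊ ^ α * b := by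
    refine exists_eq_add_mul hc ?_
    by_contra! hlt
    exact life_le_iff.1 hu (h.mono hlt.le)
  cases hb : life (renorm α a ω) with
  | coe b =>
    rw [WithTop.map_coe]
    refine le_antisymm ((key b).2 hb.le) ?_
    by_contra! hlt
    obtain ⟨u, hu⟩ := WithTop.ne_top_iff_exists.1 hlt.ne_top
    obtain ⟨b', rfl⟩ := hex hu.symm.le
    have h1 := (key b').1 hu.symm.le
    rw [hb, WithTop.coe_le_coe] at h1
    rw [← hu, WithTop.coe_lt_coe] at hlt
    exact absurd hlt (not_lt.2 (by gcongr))
  | top =>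
    rw [WithTop.map_top]
    by_contra hne
    obtain ⟨u, hu⟩ := WithTop.ne_top_iff_exists.1 hne
    obtain ⟨b', rfl⟩ := hex hu.symm.le
    have h1 := (key b').1 hu.symm.le
    rw [hb] at h1
    exact absurd h1 (not_le.2 (WithTop.coe_lt_top b'))

/-- The absolute value of the path at its first loss of sign. -/
def lifeValue (ω : Path) : ℝ := |ω.1 ((life ω).untopD 0)|

lemma measurable_lifeValue : Measurable lifeValue :=
  ((measurable_life.untopD 0).eval_path measurable_id).abs

lemma lifeValue_renorm {ω : Path} {a : ℝ≥0} (h : KeepsSign ω a)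
    (hl : life ω ≠ ⊤) : lifeValue ω = |ω.1 a| * lifeValue (renorm α a ω) := by
  rw [lifeValue, lifeValue]
  rw [life_renorm (α := α) h] at hl ⊢
  cases hb : life (renorm α a ω) with
  | top => simp [hb] at hl
  | coe b =>
    rw [WithTop.map_coe, WithTop.untopD_coe, WithTop.untopD_coe, renorm_apply, abs_div, abs_abs,
      mul_div_cancel₀ _ (abs_pos.2 (h.ne_zero le_rfl)).ne']

lemma abs_div_abs {x : ℝ} (hx : x ≠ 0) : abs (x / |x|) = 1 := by
  rw [abs_div, abs_abs, div_self (abs_pos.2 hx).ne']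

lemma mul_div_abs_pos {x y : ℝ} (h : 0 < y * x) : 0 < y * (x / |x|) := by
  have : x ≠ 0 := right_ne_zero_of_mul h.ne'
  rw [← mul_div_assoc]
  positivity

/-- The first dyadic time of order `n` at which the path is at most `r` in absolute value is
`i / 2 ^ n`, and the path has kept its sign up to this time. -/
def dyadicHit (r : ℝ) (n i : ℕ) : Set Path :=
  {ω | KeepsSign ω (i / 2 ^ n) ∧ |ω.1 (i / 2 ^ n)| ≤ r ∧ ∀ j < i, r < |ω.1 (j / 2 ^ n)|}

lemma measurableSet_dyadicHit (r : ℝ) (n i : ℕ) : MeasurableSet (dyadicHit r n i) := by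
  have h (t : ℝ≥0) : Measurable (fun ω : Path => |ω.1 t|) := (measurable_coord t).abs
  have : dyadicHit r n i = {ω | KeepsSign ω (i / 2 ^ n)} ∩ ({ω | |ω.1 (i / 2 ^ n)| ≤ r} ∩
      ⋂ j : ℕ, ⋂ _ : j < i, {ω | r < |ω.1 (j / 2 ^ n)|}) := by
    ext ω; simp [dyadicHit]
  rw [this]
  exact (measurableSet_keepsSign _).inter ((measurableSet_le (h _) measurable_const).inter
    (.iInter fun j => .iInter fun _ => measurableSet_lt measurable_const (h _)))

lemma disjoint_dyadicHit (r : ℝ) (n : ℕ) :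
    Pairwise (Function.onFun Disjoint (dyadicHit r n)) := by
  have key (i j : ℕ) (hij : i < j) : Disjoint (dyadicHit r n i) (dyadicHit r n j) :=
    Set.disjoint_left.2 fun ω hi hj => absurd hi.2.1 (not_le.2 (hj.2.2 i hij))
  intro i j hij
  rcases lt_or_gt_of_ne hij with h | h
  · exact key i j h
  · exact (key j i h).symm

lemma exists_mem_dyadicHit {r : ℝ} {n i : ℕ} {ω : Path} (h : KeepsSign ω (i / 2 ^ n))
    (h' : |ω.1 (i / 2 ^ n)| ≤ r) : ω ∈ ⋃ j, dyadicHit r n j := by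
  classical
  have hex : ∃ i : ℕ, |ω.1 (i / 2 ^ n)| ≤ r := ⟨i, h'⟩
  refine Set.mem_iUnion.2 ⟨Nat.find hex, h.mono ?_, Nat.find_spec hex, fun j hj => ?_⟩
  · gcongr
    exact Nat.find_min' hex h'
  · exact not_le.1 (Nat.find_min hex hj)

lemma monotone_iUnion_dyadicHit (r : ℝ) : Monotone (fun n => ⋃ i, dyadicHit r n i) := by
  refine monotone_nat_of_le_succ fun n ω hω => ?_
  obtain ⟨i, h1, h2, -⟩ := Set.mem_iUnion.1 hω
  have : (i : ℝ≥0) / 2 ^ n = ((2 * i : ℕ) : ℝ≥0) / 2 ^ (n + 1) := by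
    push_cast; rw [pow_succ]; field_simp
  rw [this] at h1 h2
  exact exists_mem_dyadicHit h1 h2

lemma exists_dyadic_btwn {a b : ℝ≥0} (h : a < b) : ∃ n i : ℕ, a < i / 2 ^ n ∧
    (i : ℝ≥0) / 2 ^ n < b := by
  obtain ⟨n, hn⟩ := exists_pow_lt_of_lt_one (tsub_pos_of_lt h) (NNReal.half_lt_self one_ne_zero)
  have h2 : (0 : ℝ≥0) < 2 ^ n := by positivity
  refine ⟨n, ⌊a * 2 ^ n⌋₊ + 1, ?_, ?_⟩
  · rw [lt_div_iff₀ h2]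
    exact_mod_cast Nat.lt_floor_add_one _
  · rw [div_lt_iff₀ h2]
    have h3 : ((⌊a * 2 ^ n⌋₊ + 1 : ℕ) : ℝ≥0) ≤ a * 2 ^ n + 1 := by
      push_cast; gcongr; exact Nat.floor_le (by positivity)
    refine h3.trans_lt ?_
    rw [one_div, inv_pow, inv_lt_iff_one_lt_mul₀' h2] at hn
    calc a * 2 ^ n + 1 < a * 2 ^ n + 2 ^ n * (b - a) := by gcongr
      _ = (a + (b - a)) * 2 ^ n := by ring
      _ = b * 2 ^ n := by rw [add_tsub_cancel_of_le h.le]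

/-- If the path is at most `r` in absolute value at a time at which it is restarted, then a value
larger than `δ` at its first loss of sign corresponds to a value larger than `δ / r` for the
restarted path. -/
lemma IsSelfSimilarMarkov.measure_dyadicHit_inter_le (hP : IsSelfSimilarMarkov α P)
    {x : ℝ} (hx : x ≠ 0) {r δ : ℝ} (hr : 0 < r) (n i : ℕ) :
    P x (dyadicHit r n i ∩ {ω | life ω ≠ ⊤ ∧ δ < lifeValue ω}) ≤
      P x (dyadicHit r n i) * P (x / |x|) {ω | δ / r < lifeValue ω} := by
  set t : ℝ≥0 := i / 2 ^ n with ht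
  have hτ := isStoppingTime_const pathFiltration t
  set A : Set Path := dyadicHit r n i ∩ {ω | ω.1 0 = x} with hA
  have hAm : MeasurableSet[hτ.measurableSpace] A := by
    rw [IsStoppingTime.measurableSpace_const]
    refine measurableSet_pathFiltration ((measurableSet_dyadicHit r n i).inter
      (measurable_coord 0 (measurableSet_singleton x))) fun ω => ?_
    have h1 : ∀ j ≤ i, (stopPath t ω).1 (j / 2 ^ n) = ω.1 (j / 2 ^ n) := fun j hj =>
      stopPath_apply (by rw [ht]; gcongr) ω
    simp only [hA, dyadicHit, Set.mem_inter_iff, Set.mem_ofPred_eq, ← ht, keepsSign_stopPath le_rfl]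
    rw [h1 i le_rfl, stopPath_apply zero_le]
    refine and_congr_left fun _ => and_congr_right fun _ => and_congr_right fun _ =>
      forall₂_congr fun j hj => ?_
    rw [h1 j hj.le]
  have hM := hP.measure_inter_renorm hx (abs_div_abs hx) hτ hAm
    (fun ω hω => ⟨t, rfl, mul_div_abs_pos (by
      have h1 := hω.1.1.mul_pos le_rfl
      rwa [hω.2] at h1)⟩)
    (measurableSet_lt (measurable_const (a := δ / r)) measurable_lifeValue)
  calc P x (dyadicHit r n i ∩ {ω | life ω ≠ ⊤ ∧ δ < lifeValue ω})
      ≤ P x (A ∩ {ω | renorm α t ω ∈ {ω | δ / r < lifeValue ω}}) := by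
        refine measure_mono_ae ?_
        filter_upwards [hP.start x hx] with ω hω0 hω
        refine ⟨⟨hω.1, hω0⟩, ?_⟩
        have h1 := lifeValue_renorm (α := α) hω.1.1 hω.2.1
        have h2 := hω.2.2
        have h3 : |ω.1 t| ≤ r := hω.1.2.1
        rw [h1] at h2
        change δ / r < lifeValue _
        rw [div_lt_iff₀ hr, mul_comm]
        refine h2.trans_le (mul_le_mul_of_nonneg_right h3 (abs_nonneg _))
    _ = P x A * P (x / |x|) {ω | δ / r < lifeValue ω} := hM
    _ ≤ _ := by gcongr; exact Set.inter_subset_left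

/-- The path does not leave `0` by a jump: when it loses its sign by reaching `0` continuously, its
value at this time is of a smaller order of magnitude than any fixed multiple of a value which it
takes before, hence it vanishes. -/
lemma IsSelfSimilarMarkov.ae_lifeValue_eq_zero (hP : IsSelfSimilarMarkov α P) {x : ℝ}
    (hx : x ≠ 0) : ∀ᵐ ω ∂(P x), ∀ l : ℝ≥0, life ω = l → Function.leftLim ω.1 l = 0 →
      ω.1 l = 0 := by
  have hx' : x / |x| ≠ 0 := ne_zero_of_abs_eq_one (abs_div_abs hx)
  have := hP.isProbabilityMeasure x hx
  have := hP.isProbabilityMeasure _ hx'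
  set Z : Set Path := {ω | ∃ l : ℝ≥0, life ω = l ∧ l ≠ 0 ∧ Function.leftLim ω.1 l = 0}
  -- A path in `Z` is below `r` before its first loss of sign; it is restarted at the first such
  -- time of a dyadic grid.
  have hbound {δ r : ℝ} (hr : 0 < r) : P x (Z ∩ {ω | life ω ≠ ⊤ ∧ δ < lifeValue ω}) ≤
      P (x / |x|) {ω | δ / r < lifeValue ω} := by
    set D : Set Path := {ω | life ω ≠ ⊤ ∧ δ < lifeValue ω}
    have hD : MeasurableSet D :=
      (measurable_life (measurableSet_singleton ⊤)).compl.inter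
        (measurableSet_lt measurable_const measurable_lifeValue)
    have hsub : Z ∩ D ⊆ ⋃ n, (⋃ i, dyadicHit r n i) ∩ D := by
      rintro ω ⟨⟨l, hl, hl0, hlim⟩, hωD⟩
      have h1 := ((ω.2.tendsto_leftLim l).abs).eventually_lt_const
        (by rw [hlim, abs_zero]; exact hr)
      obtain ⟨b, hb, hb'⟩ := (mem_nhdsLT_iff_exists_Ioo_subset' (pos_iff_ne_zero.2 hl0)).1 h1
      obtain ⟨n, i, hi1, hi2⟩ := exists_dyadic_btwn hb
      have hk : KeepsSign ω (i / 2 ^ n) := lt_life_iff.1 (by rw [hl]; exact_mod_cast hi2)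
      exact Set.mem_iUnion.2 ⟨n, exists_mem_dyadicHit hk (le_of_lt (hb' ⟨hi1, hi2⟩)), hωD⟩
    refine (measure_mono hsub).trans ?_
    have hmono : Monotone fun n => (⋃ i, dyadicHit r n i) ∩ D := fun m n hmn =>
      Set.inter_subset_inter_left _ (monotone_iUnion_dyadicHit r hmn)
    rw [hmono.measure_iUnion]
    refine iSup_le fun n => ?_
    rw [Set.iUnion_inter]
    calc P x (⋃ i, dyadicHit r n i ∩ D) ≤ ∑' i, P x (dyadicHit r n i ∩ D) := measure_iUnion_le _
      _ ≤ ∑' i, P x (dyadicHit r n i) * P (x / |x|) {ω | δ / r < lifeValue ω} :=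
          ENNReal.tsum_le_tsum fun i => hP.measure_dyadicHit_inter_le hx hr n i
      _ = P x (⋃ i, dyadicHit r n i) * P (x / |x|) {ω | δ / r < lifeValue ω} := by
          rw [ENNReal.tsum_mul_right, measure_iUnion (disjoint_dyadicHit r n)
            (measurableSet_dyadicHit r n)]
      _ ≤ 1 * P (x / |x|) {ω | δ / r < lifeValue ω} := by gcongr; exact prob_le_one
      _ = _ := one_mul _
  -- Let `r` tend to `0` in `hbound`.
  have hzero (m : ℕ) :
      P x (Z ∩ {ω | life ω ≠ ⊤ ∧ 1 / ((m : ℝ) + 1) < lifeValue ω}) = 0 := by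
    have hlim : Tendsto (fun k : ℕ => P (x / |x|) {ω | (k : ℝ) < lifeValue ω}) atTop (𝓝 0) := by
      have h := tendsto_measure_iInter_atTop (μ := P (x / |x|))
        (s := fun k : ℕ => {ω | (k : ℝ) < lifeValue ω})
        (fun k => (measurableSet_lt measurable_const measurable_lifeValue).nullMeasurableSet)
        (fun k k' hk ω (hω : (k' : ℝ) < _) => (Nat.cast_le.2 hk).trans_lt hω)
        ⟨0, measure_ne_top _ _⟩
      have hempty : ⋂ k : ℕ, {ω : Path | (k : ℝ) < lifeValue ω} = ∅ := by
        refine Set.eq_empty_iff_forall_notMem.2 fun ω hω => ?_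
        obtain ⟨k, hk⟩ := exists_nat_gt (lifeValue ω)
        exact lt_asymm hk (Set.mem_iInter.1 hω k)
      rwa [hempty, measure_empty] at h
    refine le_antisymm (ge_of_tendsto hlim ?_) zero_le
    filter_upwards [eventually_ge_atTop 1] with k hk
    have hk : (0 : ℝ) < k := by exact_mod_cast hk
    have h := hbound (δ := 1 / ((m : ℝ) + 1)) (r := 1 / ((m : ℝ) + 1) / k) (by positivity)
    rwa [div_div_cancel₀ (by positivity)] at h
  have hall := ae_all_iff.2 fun m => measure_eq_zero_iff_ae_notMem.1 (hzero m)
  filter_upwards [hall] with ω hω l hl hlim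
  -- At time `0` the left limit is by convention the value.
  rcases eq_or_ne l 0 with rfl | hl0
  · rwa [leftLim_zero] at hlim
  by_contra hne
  obtain ⟨m, hm⟩ := exists_nat_one_div_lt (abs_pos.2 hne)
  refine hω m ⟨⟨l, hl, hl0, hlim⟩, hl ▸ WithTop.coe_ne_top, ?_⟩
  rw [lifeValue, hl]
  exact hm

/-- Under a law for which the path changes sign before hitting zero, it cannot lose its sign by
approaching `0`, since it would hit zero at this time, before any change of sign. -/
lemma IsSelfSimilarMarkov.ae_isRegular (hP : IsSelfSimilarMarkov α P)
    (hH : ∀ x, x ≠ 0 → ∀ᵐ ω ∂(P x), signChange 1 ω < hitZero ω) {x : ℝ} (hx : x ≠ 0) :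
    ∀ᵐ ω ∂(P x), IsRegular ω := by
  filter_upwards [hP.ae_lifeValue_eq_zero hx, hP.start x hx, hH x hx] with ω h1 h2 h3
  have h0 : ω.1 0 ≠ 0 := h2 ▸ hx
  refine isRegular_of_leftLim_ne_zero h0 h3 fun l hl hlim => ?_
  have hz := h1 l hl hlim
  have hl0 : 0 < l := by
    rw [pos_iff_ne_zero]; rintro rfl; exact h0 hz
  have hT : hitZero ω ≤ l := iInf₂_le l ⟨hl0, hz⟩
  have hk : KeepsSign ω (signChange 1 ω).toNNReal := by
    refine lt_life_iff.1 ?_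
    rw [hl]
    have := h3.trans_le hT
    rw [← ENNReal.coe_toNNReal (ne_top_of_lt h3)] at this
    exact_mod_cast this
  have := hk.lt_signChange
  rw [ENNReal.coe_toNNReal (ne_top_of_lt h3)] at this
  exact lt_irrefl _ this

/-! ### Independence of the successive restarts -/

/-- At its first loss of sign, a regular path jumps to the other side of `0` from its starting
point. -/
lemma IsRegular.exists_life_neg {ω : Path} (h : IsRegular ω) :
    ∃ l : ℝ≥0, life ω = l ∧ ω.1 l * ω.1 0 < 0 := by
  obtain ⟨l, hl, -, -, hneg⟩ := h.exists_life
  refine ⟨l, hl, ?_⟩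
  have hl0 : 0 < l := by
    rw [pos_iff_ne_zero]; rintro rfl
    rw [leftLim_zero] at hneg
    exact absurd hneg (not_lt.2 (mul_self_nonneg _))
  have := nhdsLT_neBot_of_pos hl0
  have h1 : 0 ≤ Function.leftLim ω.1 l * ω.1 0 := by
    refine ge_of_tendsto ((ω.2.tendsto_leftLim l).mul_const (ω.1 0)) ?_
    filter_upwards [self_mem_nhdsWithin] with v hv
    have hv : v < l := hv
    exact ((lt_life_iff.1 (by rw [hl]; exact_mod_cast hv) : KeepsSign ω v).mul_pos le_rfl).le
  have h2 : 0 < Function.leftLim ω.1 l * ω.1 0 :=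
    lt_of_le_of_ne h1 (mul_ne_zero (right_ne_zero_of_mul hneg.ne) h.zero_ne).symm
  by_contra! hcon
  have h3 := mul_nonneg hcon h2.le
  have h4 : 0 < ω.1 0 * ω.1 0 := mul_self_pos.2 h.zero_ne
  nlinarith [mul_neg_of_neg_of_pos hneg h4]

/-- The path restarted at its first change of sign is independent of the past, and has the law of
the process started with the opposite sign. -/
lemma IsSelfSimilarMarkov.measure_inter_restart (hP : IsSelfSimilarMarkov α P)
    (hH : ∀ x, x ≠ 0 → ∀ᵐ ω ∂(P x), signChange 1 ω < hitZero ω) {x : ℝ} (hx : x ≠ 0)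
    {A : Set Path} (hA : MeasurableSet A)
    (hAs : ∀ (t : ℝ≥0) ω, life ω ≤ t → (ω ∈ A ↔ stopPath t ω ∈ A))
    {B : Set Path} (hB : MeasurableSet B) :
    P x (A ∩ restart α ⁻¹' B) = P x A * P (-(x / |x|)) B := by
  -- The strong Markov property is applied on an event of probability one, on which the restart is
  -- well defined and its sign is known.
  set N : Set Path := {ω | life ω ≠ ⊤ ∧ ω.1 ((life ω).untopD 0) * x < 0}
  have hN : MeasurableSet N :=
    (measurable_life (measurableSet_singleton ⊤)).compl.inter (measurableSet_lt
      (((measurable_life.untopD 0).eval_path measurable_id).mul_const x) measurable_const)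
  have hNae : ∀ᵐ ω ∂(P x), ω ∈ N := by
    filter_upwards [hP.ae_isRegular hH hx, hP.start x hx] with ω h h0
    obtain ⟨l, hl, hneg⟩ := h.exists_life_neg
    refine ⟨hl ▸ WithTop.coe_ne_top, ?_⟩
    rw [hl, WithTop.untopD_coe, ← h0]
    exact hneg
  have hM := hP.measure_inter_renorm hx (ε := -(x / |x|)) (by rw [abs_neg]; exact abs_div_abs hx)
    (isStoppingTime_of_stopPath measurableSet_life_le life_stopPath_le_iff)
    (A := A ∩ N) (measurableSet_past_of_stopPath measurableSet_life_le life_stopPath_le_iff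
      (hA.inter hN) fun t ω ht => ?_) (fun ω hω => ?_) hB
  · have h1 : (A ∩ N : Set Path) =ᵐ[P x] A := by
      filter_upwards [hNae] with ω hω
      exact propext ⟨fun h => h.1, fun h => ⟨h, hω⟩⟩
    rw [measure_congr h1] at hM
    rw [← hM]
    refine measure_congr ?_
    filter_upwards [hNae] with ω hω
    exact propext ⟨fun h => ⟨⟨h.1, hω⟩, h.2⟩, fun h => ⟨h.1.1, h.2⟩⟩
  · obtain ⟨u, hu, hut⟩ := WithTop.le_coe_iff.1 ht
    rw [Set.mem_inter_iff, Set.mem_inter_iff, hAs t ω ht]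
    refine and_congr_right fun _ => ?_
    simp only [N, Set.mem_ofPred_eq]
    rw [life_stopPath ht, hu, WithTop.untopD_coe, stopPath_apply hut]
  · obtain ⟨-, h1, h2⟩ := hω
    obtain ⟨l, hl⟩ := WithTop.ne_top_iff_exists.1 h1
    rw [← hl, WithTop.untopD_coe] at h2
    refine ⟨l, hl.symm, ?_⟩
    rw [← neg_div]
    have := mul_div_abs_pos (x := -x) (y := ω.1 l) (by linarith)
    rwa [abs_neg] at this

lemma IsSelfSimilarMarkov.map_restart (hP : IsSelfSimilarMarkov α P)
    (hH : ∀ x, x ≠ 0 → ∀ᵐ ω ∂(P x), signChange 1 ω < hitZero ω) {x : ℝ} (hx : x ≠ 0) :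
    (P x).map (restart α) = P (-(x / |x|)) := by
  have := hP.isProbabilityMeasure x hx
  ext B hB
  rw [Measure.map_apply (measurable_restart α) hB]
  simpa using hP.measure_inter_restart hH hx MeasurableSet.univ (by simp) hB

lemma IsSelfSimilarMarkov.ae_isPersistent (hP : IsSelfSimilarMarkov α P)
    (hH : ∀ x, x ≠ 0 → ∀ᵐ ω ∂(P x), signChange 1 ω < hitZero ω) {x : ℝ} (hx : x ≠ 0) :
    ∀ᵐ ω ∂(P x), IsPersistent α ω := by
  refine ae_all_iff.2 fun n => ?_
  induction n generalizing x with
  | zero => exact hP.ae_isRegular hH hx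
  | succ n ih =>
    have h := ih (x := -(x / |x|)) (neg_ne_zero.2 (ne_zero_of_abs_eq_one (abs_div_abs hx)))
    rw [← hP.map_restart hH hx] at h
    exact ae_of_ae_map (measurable_restart α).aemeasurable h

lemma IsSelfSimilarMarkov.map_iterate_restart (hP : IsSelfSimilarMarkov α P)
    (hH : ∀ x, x ≠ 0 → ∀ᵐ ω ∂(P x), signChange 1 ω < hitZero ω) {ε : ℝ} (hε : |ε| = 1) (n : ℕ) :
    (P ε).map (restart α)^[n] = P (ε * (-1) ^ n) := by
  induction n generalizing ε with
  | zero => simp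
  | succ n ih =>
    rw [Function.iterate_succ, ← Measure.map_map ((measurable_restart α).iterate n)
      (measurable_restart α), hP.map_restart hH (ne_zero_of_abs_eq_one hε), hε, div_one,
      ih (by rwa [abs_neg]), pow_succ]
    congr 1
    ring

/-- Independence of a sequence can be tested on its initial segments. -/
lemma iIndepFun_of_forall_range {Ω E : Type*} [MeasurableSpace Ω] [MeasurableSpace E]
    {μ : Measure Ω} [IsProbabilityMeasure μ] {f : ℕ → Ω → E}
    (h : ∀ (n : ℕ) (B : ℕ → Set E), (∀ i, MeasurableSet (B i)) →
      μ (⋂ i ∈ Finset.range n, f i ⁻¹' B i) = ∏ i ∈ Finset.range n, μ (f i ⁻¹' B i)) :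
    iIndepFun f μ := by
  rw [iIndepFun_iff_measure_inter_preimage_eq_mul]
  intro S B hB
  classical
  obtain ⟨n, hn⟩ : ∃ n, S ⊆ Finset.range n := S.exists_nat_subset_range
  have h := h n (fun i => if i ∈ S then B i else Set.univ)
    (fun i => by split_ifs with hi; exacts [hB i hi, .univ])
  have h1 : ⋂ i ∈ Finset.range n, f i ⁻¹'
      (if i ∈ S then B i else Set.univ) =
      ⋂ i ∈ S, f i ⁻¹' B i := by
    ext ω
    simp only [Set.mem_iInter, Set.mem_preimage]
    constructor
    · intro hh i hi
      simpa [hi] using hh i (hn hi)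
    · intro hh i _
      split_ifs with hi
      exacts [hh i hi, Set.mem_univ _]
  rw [h1] at h
  rw [h, ← Finset.prod_subset hn]
  · exact Finset.prod_congr rfl fun i hi => by simp [hi]
  · intro i _ hi
    simp [hi]

/-- Functionals of the past of the first change of sign, evaluated along the successive restarts,
are independent. -/
lemma IsSelfSimilarMarkov.iIndepFun_restart (hP : IsSelfSimilarMarkov α P)
    (hH : ∀ x, x ≠ 0 → ∀ᵐ ω ∂(P x), signChange 1 ω < hitZero ω) {E : Type*} [MeasurableSpace E]
    {Y : Path → E} (hY : Measurable Y)
    (hYs : ∀ (t : ℝ≥0) ω, life ω ≤ t → Y (stopPath t ω) = Y ω) {ε : ℝ} (hε : |ε| = 1) :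
    iIndepFun (fun n ω => Y ((restart α)^[n] ω)) (P ε) := by
  have := hP.isProbabilityMeasure ε (ne_zero_of_abs_eq_one hε)
  have hm (n : ℕ) : Measurable (fun ω => Y ((restart α)^[n] ω)) :=
    hY.comp ((measurable_restart α).iterate n)
  have key (n : ℕ) : ∀ {ε : ℝ}, |ε| = 1 → ∀ B : ℕ → Set E, (∀ i, MeasurableSet (B i)) →
      P ε (⋂ i ∈ Finset.range n, (fun ω => Y ((restart α)^[i] ω)) ⁻¹' B i) =
        ∏ i ∈ Finset.range n, P ε ((fun ω => Y ((restart α)^[i] ω)) ⁻¹' B i) := by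
    induction n with
    | zero =>
      intro ε hε B _
      have := hP.isProbabilityMeasure ε (ne_zero_of_abs_eq_one hε)
      simp
    | succ n ih =>
      intro ε hε B hB
      have hx := ne_zero_of_abs_eq_one hε
      have := hP.isProbabilityMeasure ε hx
      set C : Set Path :=
        ⋂ i ∈ Finset.range n, (fun ω => Y ((restart α)^[i] ω)) ⁻¹' B (i + 1) with hC
      have hCm : MeasurableSet C := .biInter (Finset.countable_toSet _) fun i _ => hm i (hB _)
      have hset : ⋂ i ∈ Finset.range (n + 1), (fun ω => Y ((restart α)^[i] ω)) ⁻¹' B i =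
          Y ⁻¹' B 0 ∩ restart α ⁻¹' C := by
        ext ω
        simp only [hC, Set.mem_iInter, Finset.mem_range, Set.mem_inter_iff, Set.mem_preimage]
        constructor
        · exact fun h => ⟨h 0 n.succ_pos, fun i hi => h (i + 1) (by omega)⟩
        · rintro ⟨h0, h1⟩ (_ | i) hi
          · exact h0
          · exact h1 i (by omega)
      have hA := fun {B' : Set Path} (hB' : MeasurableSet B') =>
        hP.measure_inter_restart hH hx (hY (hB 0))
        (fun t ω ht => by rw [Set.mem_preimage, Set.mem_preimage, hYs t ω ht]) hB'
      rw [hset, hA hCm, hε, div_one, hC, ih (by rwa [abs_neg]) (fun i => B (i + 1))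
        (fun i => hB _), Finset.prod_range_succ', mul_comm]
      congr 1
      refine Finset.prod_congr rfl fun i _ => ?_
      have h1 := hP.map_restart hH hx
      rw [hε, div_one] at h1
      rw [← h1, Measure.map_apply (measurable_restart α) (hm i (hB _))]
      rfl
  exact iIndepFun_of_forall_range fun n B hB => key n hε B hB

end Regular


/-! ### Killed Lévy processes and their laws -/

/-- The sets of paths whose values at finitely many times are real and lie in given sets. -/
def realRect (I : Finset ℝ≥0) (B : ℝ≥0 → Set ℝ) : Set (ℝ≥0 → WithTop ℝ) :=
  {f | ∀ t ∈ I, ∃ x ∈ B t, f t = (x : WithTop ℝ)}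

/-- The π-system of the sets `realRect I B`. It avoids conditions on the paths that are at the
cemetery point `⊤`. -/
def realRects : Set (Set (ℝ≥0 → WithTop ℝ)) :=
  {S | ∃ I B, (∀ t, MeasurableSet (B t)) ∧ S = realRect I B}

lemma isPiSystem_realRects : IsPiSystem realRects := by
  classical
  rintro _ ⟨I, B, hB, rfl⟩ _ ⟨I', B', hB', rfl⟩ -
  refine ⟨I ∪ I', fun t => {x | (t ∈ I → x ∈ B t) ∧ (t ∈ I' → x ∈ B' t)}, fun t => ?_, ?_⟩
  · by_cases h : t ∈ I <;> by_cases h' : t ∈ I' <;> simp only [h, h', forall_const, false_imp_iff,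
      true_and, and_true]
    · exact (hB t).inter (hB' t)
    · exact hB t
    · exact hB' t
    · exact .univ
  · ext f
    simp only [realRect, Set.mem_inter_iff, Set.mem_ofPred_eq, Finset.mem_union]
    constructor
    · rintro ⟨h1, h2⟩ t (ht | ht)
      · obtain ⟨x, hx, hfx⟩ := h1 t ht
        refine ⟨x, ⟨fun _ => hx, fun ht' => ?_⟩, hfx⟩
        obtain ⟨y, hy, hfy⟩ := h2 t ht'
        rwa [WithTop.coe_injective (hfx.symm.trans hfy)]
      · obtain ⟨x, hx, hfx⟩ := h2 t ht
        refine ⟨x, ⟨fun ht' => ?_, fun _ => hx⟩, hfx⟩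
        obtain ⟨y, hy, hfy⟩ := h1 t ht'
        rwa [WithTop.coe_injective (hfx.symm.trans hfy)]
    · intro h
      refine ⟨fun t ht => ?_, fun t ht => ?_⟩
      · obtain ⟨x, hx, hfx⟩ := h t (.inl ht)
        exact ⟨x, hx.1 ht, hfx⟩
      · obtain ⟨x, hx, hfx⟩ := h t (.inr ht)
        exact ⟨x, hx.2 ht, hfx⟩

lemma realRect_singleton (t : ℝ≥0) (B : Set ℝ) :
    realRect {t} (fun _ => B) = {f | f t ∈ ((↑) : ℝ → WithTop ℝ) '' B} := by
  ext f
  simp [realRect, eq_comm]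

lemma measurableSet_coe_image {B : Set ℝ} (hB : MeasurableSet B) :
    MeasurableSet (((↑) : ℝ → WithTop ℝ) '' B) := by
  have : ((↑) : ℝ → WithTop ℝ) '' B = WithTop.untopD 0 ⁻¹' B ∩ {⊤}ᶜ := by
    ext x
    cases x with
    | top => simp
    | coe x => simp
  rw [this]
  exact (WithTop.measurable_untopD 0 hB).inter (measurableSet_singleton ⊤).compl

lemma measurableSet_realRect {I : Finset ℝ≥0} {B : ℝ≥0 → Set ℝ} (hB : ∀ t, MeasurableSet (B t)) :
    MeasurableSet (realRect I B) := by
  have : realRect I B = ⋂ t ∈ I, (fun f : ℝ≥0 → WithTop ℝ => f t) ⁻¹'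
      (((↑) : ℝ → WithTop ℝ) '' B t) := by
    ext f; simp [realRect, eq_comm]
  rw [this]
  exact .biInter (Finset.countable_toSet _) fun t _ =>
    measurable_pi_apply t (measurableSet_coe_image (hB t))

lemma generateFrom_realRects :
    (MeasurableSpace.pi : MeasurableSpace (ℝ≥0 → WithTop ℝ)) =
      MeasurableSpace.generateFrom realRects := by
  refine le_antisymm ?_ (MeasurableSpace.generateFrom_le ?_)
  · refine iSup_le fun t => ?_
    rintro _ ⟨D, hD, rfl⟩
    have hgen (B : Set ℝ) (hB : MeasurableSet B) : MeasurableSet[.generateFrom realRects]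
        {f : ℝ≥0 → WithTop ℝ | f t ∈ ((↑) : ℝ → WithTop ℝ) '' B} :=
      MeasurableSpace.measurableSet_generateFrom
        ⟨{t}, fun _ => B, fun _ => hB, (realRect_singleton t B).symm⟩
    have h1 := hgen _ (WithTop.measurable_coe hD)
    by_cases htop : ⊤ ∈ D
    · have : (fun f : ℝ≥0 → WithTop ℝ => f t) ⁻¹' D =
          {f | f t ∈ ((↑) : ℝ → WithTop ℝ) '' ((↑) ⁻¹' D)} ∪
            {f | f t ∈ ((↑) : ℝ → WithTop ℝ) '' Set.univ}ᶜ := by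
        ext f
        cases hf : f t with
        | top => simp [hf, htop]
        | coe x => simp [hf]
      rw [this]
      exact MeasurableSet.union h1 (hgen _ .univ).compl
    · have : (fun f : ℝ≥0 → WithTop ℝ => f t) ⁻¹' D =
          {f | f t ∈ ((↑) : ℝ → WithTop ℝ) '' ((↑) ⁻¹' D)} := by
        ext f
        cases hf : f t with
        | top => simp [hf, htop]
        | coe x => simp [hf]
      rw [this]
      exact h1
  · rintro _ ⟨I, B, hB, rfl⟩
    exact measurableSet_realRect hB

/-- The process `k` is a Lévy process started at `0` and killed at an independent exponential time:
on the event that it is alive at time `s`, its increment on `[s, s + t]`, on the event that it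
survives this period, has the (sub-probability) law `m t` and is independent of the past. -/
structure IsKilledLevy {Ω : Type*} [MeasurableSpace Ω] (μ : Measure Ω)
    (k : Ω → ℝ≥0 → WithTop ℝ) (m : ℝ≥0 → Measure ℝ) : Prop where
  measurable : ∀ t, Measurable (fun ω => k ω t)
  alive_of_le : ∀ ω s t, s ≤ t → k ω t ≠ ⊤ → k ω s ≠ ⊤
  zero : ∀ᵐ ω ∂μ, k ω 0 = (0 : ℝ)
  incr : ∀ (s t : ℝ≥0) (S : Set (ℝ≥0 → WithTop ℝ)) (C : Set ℝ), MeasurableSet S →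
    MeasurableSet C →
    μ ({ω | (fun u => k ω (min u s)) ∈ S} ∩
      {ω | k ω (s + t) ≠ ⊤ ∧ (k ω (s + t)).untopD 0 - (k ω s).untopD 0 ∈ C}) =
      μ ({ω | (fun u => k ω (min u s)) ∈ S} ∩ {ω | k ω s ≠ ⊤}) * m t C

namespace IsKilledLevy

variable {Ω : Type*} [MeasurableSpace Ω] {μ : Measure Ω} {k : Ω → ℝ≥0 → WithTop ℝ}
  {m : ℝ≥0 → Measure ℝ}

lemma measurableSet_alive (h : IsKilledLevy μ k m) (t : ℝ≥0) : MeasurableSet {ω | k ω t ≠ ⊤} :=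
  (h.measurable t (measurableSet_singleton ⊤)).compl

lemma measurable_value (h : IsKilledLevy μ k m) (t : ℝ≥0) :
    Measurable (fun ω => (k ω t).untopD 0) := (h.measurable t).untopD 0

lemma measure_alive_zero [IsProbabilityMeasure μ] (h : IsKilledLevy μ k m) :
    μ {ω | k ω 0 ≠ ⊤} = 1 := by
  rw [← mem_ae_iff_prob_eq_one (h.measurableSet_alive 0)]
  filter_upwards [h.zero] with ω hω
  simp [hω]

lemma apply_eq [IsProbabilityMeasure μ] (h : IsKilledLevy μ k m) (t : ℝ≥0) {C : Set ℝ}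
    (hC : MeasurableSet C) :
    m t C = μ {ω | k ω t ≠ ⊤ ∧ (k ω t).untopD 0 - (k ω 0).untopD 0 ∈ C} := by
  have h1 := h.incr 0 t Set.univ C .univ hC
  simp only [Set.mem_univ, Set.ofPred_true, Set.univ_inter, zero_add] at h1
  rw [h1, h.measure_alive_zero, one_mul]

lemma measure_alive [IsProbabilityMeasure μ] (h : IsKilledLevy μ k m) (t : ℝ≥0) :
    μ {ω | k ω t ≠ ⊤} = m t Set.univ := by
  simp [h.apply_eq t .univ]

lemma isFiniteMeasure [IsProbabilityMeasure μ] (h : IsKilledLevy μ k m) (t : ℝ≥0) :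
    IsFiniteMeasure (m t) := ⟨by rw [← h.measure_alive]; exact measure_lt_top _ _⟩

/-- The values of the process at the times of `I`, as a function on all times. -/
def values (k : Ω → ℝ≥0 → WithTop ℝ) (I : Finset ℝ≥0) (ω : Ω) : ℝ≥0 → ℝ :=
  fun t => if t ∈ I then (k ω t).untopD 0 else 0

lemma measurable_values (h : IsKilledLevy μ k m) (I : Finset ℝ≥0) : Measurable (values k I) := by
  refine measurable_pi_lambda _ fun t => ?_
  simp only [values]
  split_ifs
  exacts [h.measurable_value t, measurable_const]

/-- Restricted to survival, the values up to time `s` and the increment on `[s, a]` are independent.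
-/
lemma map_values_prodMk [IsProbabilityMeasure μ] (h : IsKilledLevy μ k m) {I : Finset ℝ≥0}
    {s a : ℝ≥0} (hI : ∀ t ∈ I, t ≤ s) (hsa : s ≤ a) :
    (μ.restrict {ω | k ω a ≠ ⊤}).map
        (fun ω => (values k I ω, (k ω a).untopD 0 - (k ω s).untopD 0)) =
      ((μ.restrict {ω | k ω s ≠ ⊤}).map (values k I)).prod (m (a - s)) := by
  have := h.isFiniteMeasure
  have hv := h.measurable_values I
  have hd : Measurable (fun ω => (k ω a).untopD 0 - (k ω s).untopD 0) :=
    (h.measurable_value a).sub (h.measurable_value s)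
  refine (Measure.prod_eq fun S C hS hC => ?_).symm
  rw [Measure.map_apply (hv.prodMk hd) (hS.prod hC), Measure.map_apply hv hS,
    Measure.restrict_apply (hv hS), Measure.restrict_apply ((hv.prodMk hd) (hS.prod hC))]
  set S' : Set (ℝ≥0 → WithTop ℝ) :=
    (fun f t => if t ∈ I then (f t).untopD 0 else 0) ⁻¹' S with hS'
  have hS'm : MeasurableSet S' := by
    refine measurable_pi_lambda _ (fun t => ?_) hS
    split_ifs
    exacts [(measurable_pi_apply t).untopD 0, measurable_const]
  have key : {ω | (fun u => k ω (min u s)) ∈ S'} = values k I ⁻¹' S := by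
    ext ω
    have : (fun t => if t ∈ I then (k ω (min t s)).untopD 0 else 0) = values k I ω := by
      funext t
      simp only [values]
      split_ifs with ht
      · rw [min_eq_left (hI t ht)]
      · rfl
    simp only [hS', Set.mem_preimage, Set.mem_ofPred_eq, this]
  have h1 := h.incr s (a - s) S' C hS'm hC
  rw [key, add_tsub_cancel_of_le hsa] at h1
  rw [← h1]
  congr 1
  ext ω
  simp only [Set.mem_inter_iff, Set.mem_preimage, Set.mem_prod, Set.mem_ofPred_eq]
  tauto

lemma map_values_zero [IsProbabilityMeasure μ] (h : IsKilledLevy μ k m) :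
    (μ.restrict {ω | k ω 0 ≠ ⊤}).map (values k {0}) = Measure.dirac 0 := by
  rw [Measure.restrict_eq_self_of_ae_mem (by filter_upwards [h.zero] with ω hω; simp [hω]),
    Measure.map_congr (g := fun _ => 0), Measure.map_const, measure_univ, one_smul]
  filter_upwards [h.zero] with ω hω
  funext t
  simp only [values, Pi.zero_apply]
  split_ifs with ht
  · rw [Finset.mem_singleton.1 ht, hω, WithTop.untopD_coe]
  · rfl

lemma map_values_insert [IsProbabilityMeasure μ] (h : IsKilledLevy μ k m) {I : Finset ℝ≥0}
    {s a : ℝ≥0} (hs : s ∈ I) (hI : ∀ t ∈ I, t ≤ s) (hsa : s ≤ a) :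
    (μ.restrict {ω | k ω a ≠ ⊤}).map (values k (insert a I)) =
      (((μ.restrict {ω | k ω s ≠ ⊤}).map (values k I)).prod (m (a - s))).map
        (fun p => Function.update p.1 a (p.1 s + p.2)) := by
  rw [← h.map_values_prodMk hI hsa, Measure.map_map]
  · congr 1
    funext ω t
    have hs' : values k I ω s = (k ω s).untopD 0 := by simp [values, hs]
    rcases eq_or_ne t a with rfl | hta
    · simp only [Function.comp_apply, Function.update_self]
      rw [hs']
      simp [values]
    · simp only [Function.comp_apply, Function.update_of_ne hta]
      simp [values, hta]
  · refine measurable_pi_lambda _ fun t => ?_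
    rcases eq_or_ne t a with rfl | hta
    · simp only [Function.update_self]
      exact ((measurable_pi_apply s).comp measurable_fst).add measurable_snd
    · simp only [Function.update_of_ne hta]
      exact (measurable_pi_apply t).comp measurable_fst
  · exact (h.measurable_values _).prodMk ((h.measurable_value a).sub (h.measurable_value s))

lemma measure_realRect [IsProbabilityMeasure μ] (h : IsKilledLevy μ k m) {I : Finset ℝ≥0}
    {B : ℝ≥0 → Set ℝ} (hB : ∀ t, MeasurableSet (B t)) {s : ℝ≥0} (hs : s ∈ insert 0 I)
    (hle : ∀ t ∈ I, t ≤ s) : μ (k ⁻¹' realRect I B) =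
      (μ.restrict {ω | k ω s ≠ ⊤}).map (values k (insert 0 I)) {v | ∀ t ∈ I, v t ∈ B t} := by
  have hUniv : MeasurableSet {v : ℝ≥0 → ℝ | ∀ t ∈ I, v t ∈ B t} := by
    have : {v : ℝ≥0 → ℝ | ∀ t ∈ I, v t ∈ B t} =
        ⋂ t ∈ I, (fun v : ℝ≥0 → ℝ => v t) ⁻¹' B t := by ext; simp
    rw [this]
    exact .biInter (Finset.countable_toSet _) fun t _ => measurable_pi_apply t (hB t)
  rw [Measure.map_apply (h.measurable_values _) hUniv,
    Measure.restrict_apply (h.measurable_values _ hUniv)]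
  refine measure_congr ?_
  filter_upwards [h.zero] with ω h0
  refine propext ⟨fun hω => ⟨fun t ht => ?_, ?_⟩, fun hω t ht => ?_⟩
  · obtain ⟨x, hx, hxt⟩ := hω t ht
    simpa [values, ht, hxt] using hx
  · rcases Finset.mem_insert.1 hs with rfl | h1
    · simp [h0]
    · obtain ⟨x, -, hx⟩ := hω s h1
      simp [hx]
  · obtain ⟨x, hx⟩ := WithTop.ne_top_iff_exists.1 (h.alive_of_le ω t s (hle t ht) hω.2)
    refine ⟨x, ?_, hx.symm⟩
    simpa [values, ht, ← hx] using hω.1 t ht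

variable {Ω' : Type*} [MeasurableSpace Ω'] {μ' : Measure Ω'} {k' : Ω' → ℝ≥0 → WithTop ℝ}

lemma map_values_congr [IsProbabilityMeasure μ] [IsProbabilityMeasure μ']
    (h : IsKilledLevy μ k m) (h' : IsKilledLevy μ' k' m) (I : Finset ℝ≥0) :
    ∀ s ∈ insert 0 I, (∀ t ∈ insert 0 I, t ≤ s) →
      (μ.restrict {ω | k ω s ≠ ⊤}).map (values k (insert 0 I)) =
        (μ'.restrict {ω | k' ω s ≠ ⊤}).map (values k' (insert 0 I)) := by
  induction I using Finset.induction_on_max with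
  | empty =>
    intro s hs _
    obtain rfl : s = 0 := by simpa using hs
    simp only [insert_empty_eq]
    rw [h.map_values_zero, h'.map_values_zero]
  | insert a I hI ih =>
    intro a' ha' hmax
    rcases eq_or_ne a 0 with rfl | ha0
    · simp only [Finset.insert_idem] at ha' hmax ⊢
      exact ih a' ha' hmax
    obtain rfl : a' = a := by
      refine le_antisymm ?_ (hmax a (by simp))
      simp only [Finset.mem_insert] at ha'
      rcases ha' with rfl | rfl | h1
      exacts [zero_le, le_rfl, (hI _ h1).le]
    set J : Finset ℝ≥0 := insert 0 I with hJ
    have hJne : J.Nonempty := ⟨0, by simp [hJ]⟩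
    have hsJ := J.max'_mem hJne
    have hle : ∀ t ∈ J, t ≤ J.max' hJne := fun t ht => J.le_max' t ht
    have hsa : J.max' hJne ≤ a' := by
      rcases Finset.mem_insert.1 hsJ with h1 | h1
      · rw [h1]; exact zero_le
      · exact (hI _ h1).le
    rw [Finset.insert_comm, h.map_values_insert hsJ hle hsa, h'.map_values_insert hsJ hle hsa,
      ih _ hsJ hle]

/-- The law of a killed Lévy process is determined by the laws of its increments. -/
theorem map_eq [IsProbabilityMeasure μ] [IsProbabilityMeasure μ']
    (h : IsKilledLevy μ k m) (h' : IsKilledLevy μ' k' m) : μ.map k = μ'.map k' := by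
  have hk : Measurable k := measurable_pi_lambda _ h.measurable
  have hk' : Measurable k' := measurable_pi_lambda _ h'.measurable
  have := Measure.isProbabilityMeasure_map (μ := μ) hk.aemeasurable
  have := Measure.isProbabilityMeasure_map (μ := μ') hk'.aemeasurable
  refine ext_of_generate_finite realRects generateFrom_realRects isPiSystem_realRects ?_ (by simp)
  rintro _ ⟨I, B, hB, rfl⟩
  rw [Measure.map_apply hk (measurableSet_realRect hB),
    Measure.map_apply hk' (measurableSet_realRect hB)]
  -- The time `0` is added, since the joint law of the values is built up from the value at time
  -- `0`.
  set J : Finset ℝ≥0 := insert 0 I with hJ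
  have hJne : J.Nonempty := ⟨0, by simp [hJ]⟩
  have hsJ := J.max'_mem hJne
  have hle : ∀ t ∈ J, t ≤ J.max' hJne := fun t ht => J.le_max' t ht
  have hle' : ∀ t ∈ I, t ≤ J.max' hJne := fun t ht => hle t (Finset.mem_insert_of_mem ht)
  rw [h.measure_realRect hB hsJ hle', h'.measure_realRect hB hsJ hle',
    h.map_values_congr h' I _ hsJ hle]

end IsKilledLevy

/-! ### Exponential lifetimes -/

/-- A nonincreasing multiplicative function on the half-line is exponential. -/
lemma exists_eq_exp_of_mul {φ : ℝ≥0 → ℝ} (hmul : ∀ s t, φ (s + t) = φ s * φ t)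
    (hanti : Antitone φ) (hpos : ∃ t, 0 < t ∧ 0 < φ t) (hlt : ∃ t, φ t < 1) :
    ∃ q : ℝ, 0 < q ∧ ∀ t, φ t = Real.exp (-(q * t)) := by
  obtain ⟨t₀, ht₀, hφ₀⟩ := hpos
  have h0 : φ 0 = 1 := by
    have h1 := hmul 0 t₀
    rw [zero_add] at h1
    exact (mul_eq_right₀ hφ₀.ne').1 h1.symm
  have hpow (n : ℕ) (t : ℝ≥0) : φ (n * t) = φ t ^ n := by
    induction n with
    | zero => simp [h0]
    | succ n ih => rw [Nat.cast_succ, add_mul, one_mul, hmul, ih, pow_succ]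
  have hp (t : ℝ≥0) : 0 < φ t := by
    obtain ⟨n, hn⟩ := exists_nat_ge (t / t₀)
    rw [div_le_iff₀ ht₀] at hn
    exact (pow_pos hφ₀ n).trans_le ((hpow n t₀).symm.le.trans (hanti hn))
  have hlog (n : ℕ) (t : ℝ≥0) : -Real.log (φ (n * t)) = n * -Real.log (φ t) := by
    rw [hpow, Real.log_pow]; ring
  have hmono {s t : ℝ≥0} (h : s ≤ t) : -Real.log (φ s) ≤ -Real.log (φ t) :=
    neg_le_neg (Real.log_le_log (hp t) (hanti h))
  set q := -Real.log (φ 1) with hq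
  -- By linearity at integer times and monotonicity, the deviation from linearity at time `n * t`
  -- is at most `q`, for all `n`.
  have hlin (t : ℝ≥0) : -Real.log (φ t) = q * t := by
    have hb (n : ℕ) : |n * (-Real.log (φ t) - q * t)| ≤ q := by
      have h1 := hmono (Nat.floor_le (zero_le : 0 ≤ (n : ℝ≥0) * t))
      have h2 := hmono (Nat.lt_floor_add_one ((n : ℝ≥0) * t)).le
      have e (j : ℕ) : -Real.log (φ j) = j * q := by
        have := hlog j 1
        rwa [mul_one] at this
      have e2 := e (⌊(n : ℝ≥0) * t⌋₊ + 1)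
      rw [hlog, e] at h1
      rw [Nat.cast_succ] at e2
      rw [hlog, e2] at h2
      have hq0 : 0 ≤ q := by
        have := hmono (zero_le : (0 : ℝ≥0) ≤ 1)
        rwa [h0, Real.log_one, neg_zero] at this
      have f1 : ((⌊(n : ℝ≥0) * t⌋₊ : ℕ) : ℝ) ≤ n * t := by
        exact_mod_cast NNReal.coe_le_coe.2 (Nat.floor_le (zero_le : 0 ≤ (n : ℝ≥0) * t))
      have f2 : (n : ℝ) * t ≤ (⌊(n : ℝ≥0) * t⌋₊ : ℕ) + 1 := by
        exact_mod_cast NNReal.coe_le_coe.2 (Nat.lt_floor_add_one ((n : ℝ≥0) * t)).le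
      push_cast at h2
      rw [abs_le]
      constructor <;> nlinarith
    by_contra hne
    have hne' : 0 < |-Real.log (φ t) - q * t| := abs_pos.2 (sub_ne_zero.2 hne)
    obtain ⟨n, hn⟩ := exists_nat_gt (q / |-Real.log (φ t) - q * t|)
    rw [div_lt_iff₀ hne'] at hn
    have := hb n
    rw [abs_mul, Nat.abs_cast] at this
    exact absurd hn (not_lt.2 this)
  refine ⟨q, ?_, fun t => ?_⟩
  · obtain ⟨t, ht⟩ := hlt
    have h1 := Real.log_neg (hp t) ht
    have h2 := hlin t
    by_contra! hq0
    have := mul_nonpos_of_nonpos_of_nonneg hq0 t.coe_nonneg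
    linarith
  · rw [← hlin, neg_neg, Real.exp_log (hp t)]

/-- The probability of survival is multiplicative in time, hence exponential. -/
lemma IsKilledLevy.exists_rate {Ω : Type*} [MeasurableSpace Ω] {μ : Measure Ω}
    [IsProbabilityMeasure μ] {k : Ω → ℝ≥0 → WithTop ℝ} {m : ℝ≥0 → Measure ℝ}
    (h : IsKilledLevy μ k m) (hbirth : ∀ᵐ ω ∂μ, ∃ t, 0 < t ∧ k ω t ≠ ⊤)
    (hdeath : ∀ᵐ ω ∂μ, ∃ t, k ω t = ⊤) :
    ∃ q : ℝ, 0 < q ∧ ∀ t, μ {ω | k ω t ≠ ⊤} = ENNReal.ofReal (Real.exp (-(q * t))) := by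
  suffices hφ : ∃ q : ℝ, 0 < q ∧
      ∀ t : ℝ≥0, (μ {ω | k ω t ≠ ⊤}).toReal = Real.exp (-(q * t)) by
    obtain ⟨q, hq, hφ⟩ := hφ
    exact ⟨q, hq, fun t => by rw [← hφ, ENNReal.ofReal_toReal (measure_ne_top _ _)]⟩
  refine exists_eq_exp_of_mul (φ := fun t => (μ {ω | k ω t ≠ ⊤}).toReal)
    (fun s t => ?_) (fun s t hst => ?_) ?_ ?_
  · have h1 := h.incr s t Set.univ Set.univ .univ .univ
    simp only [Set.mem_univ, Set.ofPred_true, Set.univ_inter, and_true] at h1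
    rw [h1, ENNReal.toReal_mul, ← h.measure_alive]
  · exact ENNReal.toReal_mono (measure_ne_top _ _)
      (measure_mono fun ω hω => h.alive_of_le ω s t hst hω)
  · by_contra! hcon
    have h1 (n : ℕ) : ∀ᵐ ω ∂μ, k ω (1 / ((n : ℝ≥0) + 1)) = ⊤ := by
      have h2 := hcon (1 / ((n : ℝ≥0) + 1)) (by positivity)
      have h3 := (ENNReal.toReal_eq_zero_iff _).1 (le_antisymm h2 ENNReal.toReal_nonneg)
      have h4 := h3.resolve_right (measure_ne_top _ _)
      rw [← ae_iff (p := fun ω => k ω (1 / ((n : ℝ≥0) + 1)) = ⊤)] at h4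
      exact h4
    have h2 : ∀ᵐ ω ∂μ, False := by
      filter_upwards [ae_all_iff.2 h1, hbirth] with ω h3 h4
      obtain ⟨t, ht, ht'⟩ := h4
      obtain ⟨n, hn⟩ := exists_nat_one_div_lt (NNReal.coe_pos.2 ht)
      refine h.alive_of_le ω _ t ?_ ht' (h3 n)
      rw [← NNReal.coe_le_coe]
      push_cast
      exact hn.le
    simp [ae_iff] at h2
  · by_contra! hcon
    have h1 (n : ℕ) : ∀ᵐ ω ∂μ, k ω n ≠ ⊤ := by
      change {ω | k ω n ≠ ⊤} ∈ ae μ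
      rw [mem_ae_iff_prob_eq_one (h.measurableSet_alive n)]
      refine le_antisymm prob_le_one ?_
      rw [← ENNReal.ofReal_toReal (measure_ne_top μ {ω | k ω n ≠ ⊤}), ← ENNReal.ofReal_one]
      exact ENNReal.ofReal_le_ofReal (hcon n)
    have h2 : ∀ᵐ ω ∂μ, False := by
      filter_upwards [ae_all_iff.2 h1, hdeath] with ω h3 h4
      obtain ⟨t, ht⟩ := h4
      obtain ⟨n, hn⟩ := exists_nat_ge t
      exact h.alive_of_le ω t n hn (h3 n) ht
    simp [ae_iff] at h2


/-! ### Independent increments -/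

/-- The function `f` stopped at time `s`. -/
def stoppedFun {E : Type*} (s : ℝ≥0) (f : ℝ≥0 → E) : ℝ≥0 → E := fun u => f (min u s)

lemma measurable_stoppedFun {E : Type*} [MeasurableSpace E] (s : ℝ≥0) :
    Measurable (stoppedFun s : (ℝ≥0 → E) → ℝ≥0 → E) :=
  measurable_pi_lambda _ fun _ => measurable_pi_apply _

lemma measurable_increment {Ω : Type*} [MeasurableSpace Ω] {ξ : Ω → ℝ≥0 → ℝ} (hξ : Measurable ξ)
    (s t : ℝ≥0) : Measurable (fun ω => ξ ω t - ξ ω s) :=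
  Measurable.sub ((measurable_pi_apply t).comp hξ) ((measurable_pi_apply s).comp hξ)

/-- The increment of `ξ` on `[s, t]` has law `n` and is independent of the path up to time `s`. -/
def HasIncrLaw {Ω : Type*} [MeasurableSpace Ω] (ξ : Ω → ℝ≥0 → ℝ) (μ : Measure Ω) (n : Measure ℝ)
    (s t : ℝ≥0) : Prop :=
  μ.map (fun ω => (stoppedFun s (ξ ω), ξ ω t - ξ ω s)) =
    (μ.map (fun ω => stoppedFun s (ξ ω))).prod n

namespace HasIncrLaw

variable {Ω : Type*} [MeasurableSpace Ω] {ξ : Ω → ℝ≥0 → ℝ} {μ : Measure Ω} {n n' : Measure ℝ}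
  {s t u : ℝ≥0}

/-- Adjacent increments add up to an increment. -/
lemma trans [IsProbabilityMeasure μ] [IsProbabilityMeasure n] [IsProbabilityMeasure n']
    (hξ : Measurable ξ) (hst : s ≤ t) (h : HasIncrLaw ξ μ n s t) (h' : HasIncrLaw ξ μ n' t u) :
    HasIncrLaw ξ μ ((n.prod n').map fun p => p.1 + p.2) s u := by
  have hd := measurable_increment hξ
  have hs (r : ℝ≥0) : Measurable (fun ω => stoppedFun r (ξ ω)) :=
    (measurable_stoppedFun r).comp hξ
  let F : (ℝ≥0 → ℝ) → (ℝ≥0 → ℝ) × ℝ := fun f => (stoppedFun s f, f t - f s)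
  have hF : Measurable F := (measurable_stoppedFun s).prodMk
    (measurable_increment measurable_id s t)
  have hFξ (ω : Ω) : F (stoppedFun t (ξ ω)) = (stoppedFun s (ξ ω), ξ ω t - ξ ω s) := by
    simp only [F, stoppedFun, min_self, min_eq_left hst, Prod.mk.injEq, and_true]
    funext v
    change ξ ω (min (min v s) t) = ξ ω (min v s)
    rw [min_assoc, min_eq_left hst]
  have h1 : μ.map (fun ω => ((stoppedFun s (ξ ω), ξ ω t - ξ ω s), ξ ω u - ξ ω t)) =
      ((μ.map (fun ω => stoppedFun s (ξ ω))).prod n).prod n' := by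
    have h2 := congrArg (Measure.map (Prod.map F id)) h'
    have : IsProbabilityMeasure (μ.map fun ω => stoppedFun t (ξ ω)) :=
      Measure.isProbabilityMeasure_map (hs t).aemeasurable
    rw [Measure.map_map (hF.prodMap measurable_id) ((hs t).prodMk (hd t u)),
      ← Measure.map_prod_map _ _ hF measurable_id, Measure.map_id,
      Measure.map_map hF (hs t)] at h2
    simp only [Function.comp_def, Prod.map, hFξ, id] at h2
    rw [h2, ← h]
  have h3 := congrArg (Measure.map fun p : ((ℝ≥0 → ℝ) × ℝ) × ℝ => (p.1.1, p.1.2 + p.2)) h1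
  have : IsProbabilityMeasure (μ.map fun ω => stoppedFun s (ξ ω)) :=
    Measure.isProbabilityMeasure_map (hs s).aemeasurable
  rw [Measure.map_map (by fun_prop) (((hs s).prodMk (hd s t)).prodMk
    (hd t u))] at h3
  have h4 : ((μ.map fun ω => stoppedFun s (ξ ω)).prod n).prod n' =
      ((μ.map fun ω => stoppedFun s (ξ ω)).prod (n.prod n')).map
        MeasurableEquiv.prodAssoc.symm := by
    rw [← Measure.prodAssoc_prod, Measure.map_map (by fun_prop) (by fun_prop)]
    simp
  rw [h4, Measure.map_map (by fun_prop) (by fun_prop)] at h3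
  rw [HasIncrLaw]
  have h5 := Measure.map_prod_map (μ.map fun ω => stoppedFun s (ξ ω)) (n.prod n')
    (measurable_id (α := ℝ≥0 → ℝ)) (g := fun p : ℝ × ℝ => p.1 + p.2) (by fun_prop)
  rw [Measure.map_id] at h5
  rw [h5]
  refine Eq.trans ?_ (h3.trans ?_)
  · congr 1
    funext ω
    simp
  · rfl

/-- Enlarging the probability space does not affect the increments. -/
lemma comp_fst {Ω' : Type*} [MeasurableSpace Ω'] {μ' : Measure Ω'} [IsProbabilityMeasure μ']
    [SFinite μ] (hξ : Measurable ξ) (h : HasIncrLaw ξ μ n s t) :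
    HasIncrLaw (fun ω : Ω × Ω' => ξ ω.1) (μ.prod μ') n s t := by
  have hd := measurable_increment hξ
  have hs : Measurable (fun ω => stoppedFun s (ξ ω)) := (measurable_stoppedFun s).comp hξ
  have hfst : (μ.prod μ').map Prod.fst = μ := by
    rw [Measure.map_fst_prod, measure_univ, one_smul]
  have h1 := Measure.map_map (μ := μ.prod μ') (hs.prodMk (hd s t)) measurable_fst
  have h2 := Measure.map_map (μ := μ.prod μ') hs measurable_fst
  rw [hfst] at h1 h2
  rw [HasIncrLaw] at h ⊢
  simp only [Function.comp_def] at h1 h2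
  rw [← h1, ← h2, h]

lemma map_sub [IsProbabilityMeasure μ] [SFinite n] (hξ : Measurable ξ)
    (h : HasIncrLaw ξ μ n s t) : μ.map (fun ω => ξ ω t - ξ ω s) = n := by
  have hd := measurable_increment hξ
  have hs : Measurable (fun ω => stoppedFun s (ξ ω)) := (measurable_stoppedFun s).comp hξ
  have h1 := congrArg (Measure.map Prod.snd) h
  have : IsProbabilityMeasure (μ.map fun ω => stoppedFun s (ξ ω)) :=
    Measure.isProbabilityMeasure_map hs.aemeasurable
  rw [Measure.map_map measurable_snd (hs.prodMk (hd s t)), Measure.map_snd_prod,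
    measure_univ, one_smul] at h1
  exact h1

lemma measure_inter [SFinite n] (hξ : Measurable ξ) (h : HasIncrLaw ξ μ n s t)
    {S : Set (ℝ≥0 → ℝ)} {C : Set ℝ} (hS : MeasurableSet S) (hC : MeasurableSet C) :
    μ ({ω | stoppedFun s (ξ ω) ∈ S} ∩ {ω | ξ ω t - ξ ω s ∈ C}) =
      μ {ω | stoppedFun s (ξ ω) ∈ S} * n C := by
  have hd := measurable_increment hξ
  have hs : Measurable (fun ω => stoppedFun s (ξ ω)) := (measurable_stoppedFun s).comp hξ
  have h1 := congrArg (fun ρ => ρ (S ×ˢ C)) h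
  beta_reduce at h1
  rw [Measure.map_apply (hs.prodMk (hd s t)) (hS.prod hC), Measure.prod_prod,
    Measure.map_apply hs hS] at h1
  exact h1

end HasIncrLaw

/-- A càdlàg process with stationary increments that are independent of the past is a Lévy
process. -/
lemma isLevyProcess_of_hasIncrLaw {Ω : Type*} [MeasurableSpace Ω] {μ : Measure Ω}
    [IsProbabilityMeasure μ] {ξ : Ω → ℝ≥0 → ℝ} {n : ℝ≥0 → Measure ℝ}
    [∀ t, IsProbabilityMeasure (n t)] (hξ : Measurable ξ) (hc : ∀ ω, IsCadlag (ξ ω))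
    (h0 : ∀ᵐ ω ∂μ, ξ ω 0 = 0) (h : ∀ s t, s ≤ t → HasIncrLaw ξ μ (n (t - s)) s t) :
    IsLevyProcess (fun t ω => ξ ω t) μ where
  measurable t := (measurable_pi_apply t).comp hξ
  cadlag := hc
  zero := h0
  indep := by
    refine .of_nat fun t ht _ => iIndepFun_of_forall_range fun N B hB => ?_
    induction N with
    | zero => simp
    | succ N ih =>
      rw [Finset.prod_range_succ, ← ih]
      have hinc := h (t N) (t (N + 1)) (ht N.le_succ)
      set S : Set (ℝ≥0 → ℝ) :=
        ⋂ i ∈ Finset.range N, (fun f => f (t (i + 1)) - f (t i)) ⁻¹' B i with hS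
      have hSm : MeasurableSet S := .biInter (Finset.countable_toSet _) fun i _ =>
        measurable_increment measurable_id _ _ (hB i)
      have hSξ : ⋂ i ∈ Finset.range N, (fun ω => ξ ω (t (i + 1)) - ξ ω (t i)) ⁻¹' B i =
          {ω | stoppedFun (t N) (ξ ω) ∈ S} := by
        ext ω
        simp only [hS, Set.mem_iInter, Finset.mem_range, Set.mem_preimage, Set.mem_ofPred_eq]
        refine forall₂_congr fun i hi => ?_
        rw [stoppedFun, stoppedFun, min_eq_left (ht (by omega)), min_eq_left (ht (by omega))]
      have h1 := hinc.measure_inter hξ hSm (hB N)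
      have h2 : μ ((fun ω => ξ ω (t (N + 1)) - ξ ω (t N)) ⁻¹' B N) =
          n (t (N + 1) - t N) (B N) := by
        rw [← Measure.map_apply (measurable_increment hξ _ _) (hB N), hinc.map_sub hξ]
      rw [h2, hSξ, ← h1, ← hSξ]
      congr 1
      ext ω
      simp only [Set.mem_iInter, Finset.mem_range, Set.mem_inter_iff, Set.mem_preimage,
        Set.mem_ofPred_eq]
      constructor
      · exact fun hh => ⟨fun i hi => hh i (by omega), hh N (by omega)⟩
      · rintro ⟨hh1, hh2⟩ i hi
        rcases Nat.lt_succ_iff_lt_or_eq.1 hi with hi | rfl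
        exacts [hh1 i hi, hh2]
  stationary s t := by
    refine ⟨(measurable_increment hξ _ _).aemeasurable, ((measurable_pi_apply t).comp hξ).aemeasurable, ?_⟩
    have h1 := (h s (s + t) le_self_add).map_sub hξ
    have h2 := (h 0 t zero_le).map_sub hξ
    rw [add_tsub_cancel_left] at h1
    rw [tsub_zero] at h2
    rw [h1, ← h2]
    refine Measure.map_congr ?_
    filter_upwards [h0] with ω hω
    rw [hω, sub_zero]

/-! ### A Lévy process out of a killed Lévy process -/

namespace IsKilledLevy

variable {Ω : Type*} [MeasurableSpace Ω] {μ : Measure Ω} {k : Ω → ℝ≥0 → WithTop ℝ}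
  {m : ℝ≥0 → Measure ℝ}

/-- The values of the killed process, extended by `0` after its lifetime. -/
def realValue (k : Ω → ℝ≥0 → WithTop ℝ) (ω : Ω) (t : ℝ≥0) : ℝ := (k ω t).untopD 0

lemma measurable_realValue (h : IsKilledLevy μ k m) : Measurable (realValue k) :=
  measurable_pi_lambda _ h.measurable_value

/-- The law of the increment on `[0, t]` conditionally on survival up to time `t`. -/
def condLaw (μ : Measure Ω) (k : Ω → ℝ≥0 → WithTop ℝ) (t : ℝ≥0) : Measure ℝ :=
  (ProbabilityTheory.cond μ {ω | k ω t ≠ ⊤}).map (fun ω => realValue k ω t - realValue k ω 0)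

section Rate

variable {q : ℝ}

lemma measure_alive_ne_zero
    (hq : ∀ t, μ {ω | k ω t ≠ ⊤} = ENNReal.ofReal (Real.exp (-(q * t)))) (t : ℝ≥0) :
    μ {ω | k ω t ≠ ⊤} ≠ 0 := by
  rw [hq, Ne, ENNReal.ofReal_eq_zero, not_le]
  exact Real.exp_pos _

variable [IsProbabilityMeasure μ]

lemma isProbabilityMeasure_condLaw (h : IsKilledLevy μ k m)
    (hq : ∀ t, μ {ω | k ω t ≠ ⊤} = ENNReal.ofReal (Real.exp (-(q * t)))) (t : ℝ≥0) :
    IsProbabilityMeasure (condLaw μ k t) := by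
  have := ProbabilityTheory.cond_isProbabilityMeasure (measure_alive_ne_zero hq t)
  exact Measure.isProbabilityMeasure_map
    (measurable_increment h.measurable_realValue 0 t).aemeasurable

lemma apply_eq_mul_condLaw (h : IsKilledLevy μ k m)
    (hq : ∀ t, μ {ω | k ω t ≠ ⊤} = ENNReal.ofReal (Real.exp (-(q * t)))) (t : ℝ≥0) {C : Set ℝ}
    (hC : MeasurableSet C) :
    m t C = ENNReal.ofReal (Real.exp (-(q * t))) * condLaw μ k t C := by
  have hm := measurable_increment h.measurable_realValue 0 t
  rw [h.apply_eq t hC, condLaw, Measure.map_apply hm hC,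
    ProbabilityTheory.cond_apply (h.measurableSet_alive t), ← hq, ← mul_assoc,
    ENNReal.mul_inv_cancel (measure_alive_ne_zero hq t) (measure_ne_top _ _), one_mul]
  rfl

/-- Conditionally on survival up to a later time, increments are independent of the past. -/
lemma measure_inter_alive (h : IsKilledLevy μ k m)
    (hq : ∀ t, μ {ω | k ω t ≠ ⊤} = ENNReal.ofReal (Real.exp (-(q * t)))) {s t T : ℝ≥0}
    (hst : s ≤ t) (htT : t ≤ T) {S : Set (ℝ≥0 → ℝ)} {C : Set ℝ} (hS : MeasurableSet S)
    (hC : MeasurableSet C) :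
    μ ({ω | stoppedFun s (realValue k ω) ∈ S} ∩ {ω | realValue k ω t - realValue k ω s ∈ C} ∩
        {ω | k ω T ≠ ⊤}) =
      μ ({ω | stoppedFun s (realValue k ω) ∈ S} ∩ {ω | k ω T ≠ ⊤}) *
        condLaw μ k (t - s) C := by
  set S₁ : Set (ℝ≥0 → WithTop ℝ) := (fun f u => (f u).untopD 0) ⁻¹' S
  have hg : Measurable (fun (f : ℝ≥0 → WithTop ℝ) u => (f u).untopD 0) :=
    measurable_pi_lambda _ fun u => (measurable_pi_apply u).untopD 0
  have hS₁ : MeasurableSet S₁ := hg hS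
  set S₂ : Set (ℝ≥0 → WithTop ℝ) := {f | stoppedFun s f ∈ S₁} ∩
    {f | f t ≠ ⊤ ∧ (f t).untopD 0 - (f s).untopD 0 ∈ C}
  have hS₂ : MeasurableSet S₂ := (measurable_stoppedFun s hS₁).inter
    ((measurable_pi_apply t (measurableSet_singleton ⊤)).compl.inter
      ((((measurable_pi_apply t).untopD 0).sub ((measurable_pi_apply s).untopD 0)) hC))
  -- Survival up to `T` is an event for the increment on `[t, T]`, as well as for the one on `[s,
  -- T]`.
  have e1 := h.incr s (t - s) S₁ C hS₁ hC
  have e2 := h.incr t (T - t) S₂ Set.univ hS₂ .univ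
  have e3 := h.incr s (T - s) S₁ Set.univ hS₁ .univ
  rw [add_tsub_cancel_of_le hst] at e1
  rw [add_tsub_cancel_of_le htT] at e2
  rw [add_tsub_cancel_of_le (hst.trans htT)] at e3
  simp only [Set.mem_univ, and_true] at e2 e3
  have f2 : {ω | (fun u => k ω (min u t)) ∈ S₂} = {ω | (fun u => k ω (min u s)) ∈ S₁} ∩
      {ω | k ω t ≠ ⊤ ∧ (k ω t).untopD 0 - (k ω s).untopD 0 ∈ C} := by
    ext ω
    have h1 : stoppedFun s (fun u => k ω (min u t)) = fun u => k ω (min u s) := by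
      funext u
      rw [stoppedFun, min_assoc, min_eq_left hst]
    simp only [S₂, Set.mem_inter_iff, Set.mem_ofPred_eq, h1, min_self, min_eq_left hst]
  rw [f2] at e2
  have f3 : {ω | (fun u => k ω (min u s)) ∈ S₁} ∩
      {ω | k ω t ≠ ⊤ ∧ (k ω t).untopD 0 - (k ω s).untopD 0 ∈ C} ∩ {ω | k ω t ≠ ⊤} =
      {ω | (fun u => k ω (min u s)) ∈ S₁} ∩
      {ω | k ω t ≠ ⊤ ∧ (k ω t).untopD 0 - (k ω s).untopD 0 ∈ C} := by
    ext ω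
    simp only [Set.mem_inter_iff, Set.mem_ofPred_eq]
    tauto
  rw [f3, e1] at e2
  have f4 : {ω | stoppedFun s (realValue k ω) ∈ S} ∩
      {ω | realValue k ω t - realValue k ω s ∈ C} ∩ {ω | k ω T ≠ ⊤} =
      {ω | (fun u => k ω (min u s)) ∈ S₁} ∩
      {ω | k ω t ≠ ⊤ ∧ (k ω t).untopD 0 - (k ω s).untopD 0 ∈ C} ∩ {ω | k ω T ≠ ⊤} := by
    ext ω
    have := h.alive_of_le ω t T htT
    simp only [Set.mem_inter_iff, Set.mem_ofPred_eq, S₁, Set.mem_preimage, realValue]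
    change (_ ∧ _) ∧ _ ↔ (_ ∧ _) ∧ _
    tauto
  have f5 : {ω | stoppedFun s (realValue k ω) ∈ S} = {ω | (fun u => k ω (min u s)) ∈ S₁} := rfl
  rw [f4, f5, e2, e3, h.apply_eq_mul_condLaw hq _ hC, ← h.measure_alive, ← h.measure_alive, hq, hq]
  have hE : ENNReal.ofReal (Real.exp (-(q * (T - s : ℝ≥0)))) =
      ENNReal.ofReal (Real.exp (-(q * (t - s : ℝ≥0)))) *
        ENNReal.ofReal (Real.exp (-(q * (T - t : ℝ≥0)))) := by
    rw [← ENNReal.ofReal_mul (Real.exp_pos _).le, ← Real.exp_add, NNReal.coe_sub hst,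
      NNReal.coe_sub htT, NNReal.coe_sub (hst.trans htT)]
    congr 2
    ring
  rw [hE]
  ring

/-- The laws of the increments conditioned on survival form a convolution semigroup. -/
lemma condLaw_add (h : IsKilledLevy μ k m)
    (hq : ∀ t, μ {ω | k ω t ≠ ⊤} = ENNReal.ofReal (Real.exp (-(q * t)))) (s t : ℝ≥0) :
    condLaw μ k (s + t) = ((condLaw μ k s).prod (condLaw μ k t)).map fun p => p.1 + p.2 := by
  have hd := measurable_increment h.measurable_realValue
  have := h.isProbabilityMeasure_condLaw hq
  set A : Set Ω := {ω | k ω (s + t) ≠ ⊤} with hA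
  have hAm : MeasurableSet A := h.measurableSet_alive _
  have key : (condLaw μ k s).prod (condLaw μ k t) = (ProbabilityTheory.cond μ A).map
      (fun ω => (realValue k ω s - realValue k ω 0, realValue k ω (s + t) - realValue k ω s)) := by
    refine Measure.prod_eq fun C D hC hD => ?_
    have hm : Measurable fun ω =>
        (realValue k ω s - realValue k ω 0, realValue k ω (s + t) - realValue k ω s) :=
      (hd 0 s).prodMk (hd s _)
    rw [Measure.map_apply hm (hC.prod hD), ProbabilityTheory.cond_apply hAm]
    have e1 := h.measure_inter_alive hq (s := s) (t := s + t) (T := s + t) le_self_add le_rfl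
      (S := {f | f s - f 0 ∈ C})
      (measurable_increment measurable_id 0 s hC) hD
    have e2 := h.measure_inter_alive hq (s := 0) (t := s) (T := s + t) zero_le le_self_add
      (S := Set.univ) .univ hC
    simp only [Set.mem_univ, Set.ofPred_true, Set.univ_inter, tsub_zero] at e2
    simp only [stoppedFun, Set.mem_ofPred_eq, min_self, min_eq_left (zero_le : 0 ≤ s),
      add_tsub_cancel_left] at e1
    rw [e2, Set.inter_comm _ A, ← Set.inter_assoc] at e1
    have e3 : A ∩ (fun ω => (realValue k ω s - realValue k ω 0,
        realValue k ω (s + t) - realValue k ω s)) ⁻¹' C ×ˢ D =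
        A ∩ {ω | realValue k ω s - realValue k ω 0 ∈ C} ∩
          {ω | realValue k ω (s + t) - realValue k ω s ∈ D} := by
      rw [Set.inter_assoc]; rfl
    rw [e3, e1, mul_assoc, ← mul_assoc, ENNReal.inv_mul_cancel (measure_alive_ne_zero hq _)
      (measure_ne_top _ _), one_mul]
  rw [key, Measure.map_map (by fun_prop) ((hd 0 s).prodMk (hd s _)), condLaw]
  congr 1
  funext ω
  simp

variable {seg : Ω → Path}

/-- The law of the process on `[0, 1]` conditionally on survival up to time `1`. -/
lemma hasIncrLaw_segment (h : IsKilledLevy μ k m)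
    (hq : ∀ t, μ {ω | k ω t ≠ ⊤} = ENNReal.ofReal (Real.exp (-(q * t))))
    (hseg : Measurable seg)
    (hk : ∀ ω, k ω 1 ≠ ⊤ → ∀ u, (seg ω).1 u = realValue k ω (min u 1)) {s t : ℝ≥0} (hst : s ≤ t)
    (ht : t ≤ 1) :
    HasIncrLaw (fun ω : Path => ω.1) ((ProbabilityTheory.cond μ {ω | k ω 1 ≠ ⊤}).map seg)
      (condLaw μ k (t - s)) s t := by
  have := h.isProbabilityMeasure_condLaw hq
  have := ProbabilityTheory.cond_isProbabilityMeasure (measure_alive_ne_zero hq 1)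
  have hs : Measurable (fun ω : Path => stoppedFun s ω.1) :=
    (measurable_stoppedFun s).comp measurable_subtype_coe
  have hd := measurable_increment (ξ := fun ω : Path => ω.1) measurable_subtype_coe s t
  have hA := h.measurableSet_alive 1
  rw [HasIncrLaw, Measure.map_map hs hseg, Measure.map_map (hs.prodMk hd) hseg]
  have := Measure.isProbabilityMeasure_map (μ := ProbabilityTheory.cond μ {ω | k ω 1 ≠ ⊤})
    (hs.comp hseg).aemeasurable
  refine (Measure.prod_eq fun S C hS hC => ?_).symm
  rw [Measure.map_apply ((hs.prodMk hd).comp hseg) (hS.prod hC),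
    Measure.map_apply (hs.comp hseg) hS, ProbabilityTheory.cond_apply hA,
    ProbabilityTheory.cond_apply hA, mul_assoc]
  congr 1
  have hstopped (ω : Ω) (hω : k ω 1 ≠ ⊤) :
      stoppedFun s (seg ω).1 = stoppedFun s (realValue k ω) := by
    funext u
    rw [stoppedFun, stoppedFun, hk ω hω, min_assoc, min_eq_left (hst.trans ht)]
  have e := h.measure_inter_alive hq hst ht hS hC
  have f1 : {ω | k ω 1 ≠ ⊤} ∩ ((fun ω : Path => stoppedFun s ω.1) ∘ seg) ⁻¹' S =
      {ω | stoppedFun s (realValue k ω) ∈ S} ∩ {ω | k ω 1 ≠ ⊤} := by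
    ext ω
    simp only [Set.mem_inter_iff, Set.mem_ofPred_eq, Set.mem_preimage, Function.comp_apply]
    rw [and_comm]
    refine and_congr_left fun hω => ?_
    rw [hstopped ω hω]
  have f2 : {ω | k ω 1 ≠ ⊤} ∩
      ((fun ω : Path => (stoppedFun s ω.1, ω.1 t - ω.1 s)) ∘ seg) ⁻¹' S ×ˢ C =
      {ω | stoppedFun s (realValue k ω) ∈ S} ∩ {ω | realValue k ω t - realValue k ω s ∈ C} ∩
        {ω | k ω 1 ≠ ⊤} := by
    ext ω
    simp only [Set.mem_inter_iff, Set.mem_ofPred_eq, Set.mem_preimage, Function.comp_apply,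
      Set.mem_prod]
    rw [and_comm]
    refine and_congr_left fun hω => ?_
    rw [hstopped ω hω, hk ω hω, hk ω hω, min_eq_left ht, min_eq_left (hst.trans ht)]
  rw [f1, f2, e]

end Rate

end IsKilledLevy

/-! ### Gluing independent segments -/

/-- The path whose increments on `[j, j + 1]` are those of the `j`-th path on `[0, 1]`. -/
def glue (Z : ℕ → Path) (t : ℝ≥0) : ℝ :=
  ∑ j ∈ Finset.range (⌊t⌋₊ + 1), ((Z j).1 (min (t - j) 1) - (Z j).1 0)

/-- The summation may be extended, since the `j`-th path contributes only after time `j`. -/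
lemma glue_eq_sum (Z : ℕ → Path) {t : ℝ≥0} {N : ℕ} (h : t ≤ N) :
    glue Z t = ∑ j ∈ Finset.range N, ((Z j).1 (min (t - j) 1) - (Z j).1 0) := by
  have hz (j : ℕ) (hj : t ≤ j) : (Z j).1 (min (t - j) 1) - (Z j).1 0 = 0 := by
    rw [tsub_eq_zero_of_le hj, min_eq_left zero_le, sub_self]
  rw [glue]
  rcases le_total (⌊t⌋₊ + 1) N with hN | hN
  · refine Finset.sum_subset (Finset.range_mono hN) fun j _ hj => hz j ?_
    refine (Nat.lt_floor_add_one t).le.trans ?_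
    rw [Finset.mem_range, not_lt] at hj
    exact_mod_cast hj
  · refine (Finset.sum_subset (Finset.range_mono hN) fun j _ hj => hz j ?_).symm
    refine h.trans ?_
    rw [Finset.mem_range, not_lt] at hj
    exact_mod_cast hj

lemma isCadlag_sum {ι : Type*} (I : Finset ι) {f : ι → ℝ≥0 → ℝ} (h : ∀ i, IsCadlag (f i)) :
    IsCadlag (fun t => ∑ i ∈ I, f i t) := by
  classical
  induction I using Finset.induction_on with
  | empty => simpa using isCadlag_const 0
  | insert i I hi ih => simpa [Finset.sum_insert hi] using (h i).add ih

lemma isCadlag_glue (Z : ℕ → Path) : IsCadlag (glue Z) := by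
  refine IsCadlag.congr_of_eqOn_Iio fun t => ?_
  refine ⟨fun u => ∑ j ∈ Finset.range (⌊t⌋₊ + 1), ((Z j).1 (min (u - j) 1) - (Z j).1 0), ?_,
    (⌊t⌋₊ + 1 : ℕ), by exact_mod_cast Nat.lt_floor_add_one t, ?_⟩
  · refine isCadlag_sum _ (f := fun j t => (Z j).1 (min (t - j) 1) - (Z j).1 0) fun j => ?_
    have hmono : Monotone fun t : ℝ≥0 => min (t - j) 1 := fun a b hab =>
      min_le_min_right _ (tsub_le_tsub_right hab _)
    simpa only [sub_eq_add_neg] using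
      ((Z j).2.comp_monotone (by fun_prop) hmono).add (isCadlag_const (-(Z j).1 0))
  · intro u hu
    exact glue_eq_sum Z (Set.mem_Iio.1 hu).le

lemma measurable_glue : Measurable glue := by
  refine measurable_pi_lambda _ fun t => Finset.measurable_sum _ fun j _ => ?_
  exact ((measurable_coord _).comp (measurable_pi_apply j)).sub
    ((measurable_coord _).comp (measurable_pi_apply j))

lemma glue_zero (Z : ℕ → Path) : glue Z 0 = 0 := by
  rw [glue_eq_sum Z (N := 0) (by simp)]; simp

section

variable {ν : Measure Path} [IsProbabilityMeasure ν] {n : ℝ≥0 → Measure ℝ}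
  [∀ t, IsProbabilityMeasure (n t)] {s t : ℝ≥0}

/-- An increment of the glued path inside `[k, k + 1]` is an increment of the `k`-th path, and the
past is a functional of the first `k` paths and of the past of the `k`-th one. -/
lemma hasIncrLaw_glue_of_le_of_le
    (hν : ∀ s t, s ≤ t → t ≤ 1 → HasIncrLaw (fun ω : Path => ω.1) ν (n (t - s)) s t)
    (hst : s ≤ t) {k : ℕ} (hk : k ≤ s) (hk' : t ≤ (k + 1 : ℕ)) :
    HasIncrLaw glue (Measure.infinitePi fun _ : ℕ => ν) (n (t - s)) s t := by
  set μ := Measure.infinitePi fun _ : ℕ => ν with hμ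
  set a : ℝ≥0 := s - k with ha
  set b : ℝ≥0 := t - k with hb
  have hab : a ≤ b := tsub_le_tsub_right hst _
  have hb1 : b ≤ 1 := by
    rw [hb, tsub_le_iff_left]
    exact_mod_cast hk'
  have hts : b - a = t - s := tsub_tsub_tsub_cancel_right hk
  -- `R Z` is the contribution of the first `k` paths, which is constant after time `k`.
  let R₀ : (Finset.range k → Path) → ℝ≥0 → ℝ := fun z u =>
    ∑ j : Finset.range k, ((z j).1 (min (u - j) 1) - (z j).1 0)
  have hR₀ : Measurable R₀ := measurable_pi_lambda _ fun u => Finset.measurable_sum _ fun j _ =>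
    ((measurable_coord _).comp (measurable_pi_apply j)).sub
      ((measurable_coord _).comp (measurable_pi_apply j))
  let R : (ℕ → Path) → ℝ≥0 → ℝ := fun Z => R₀ fun i => Z i
  have hR : Measurable R :=
    hR₀.comp (measurable_pi_lambda _ fun i : Finset.range k => measurable_pi_apply (i : ℕ))
  have hsum (Z : ℕ → Path) {u : ℝ≥0} (hu : u ≤ (k + 1 : ℕ)) :
      glue Z u = R Z u + ((Z k).1 (min (u - k) 1) - (Z k).1 0) := by
    rw [glue_eq_sum Z hu, Finset.sum_range_succ, ← Finset.sum_coe_sort (Finset.range k)]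
  let G : (ℝ≥0 → ℝ) × (ℝ≥0 → ℝ) → ℝ≥0 → ℝ := fun p u => p.1 (min u s) + (p.2 (u - k) - p.2 0)
  have hG : Measurable G := by
    refine measurable_pi_lambda _ fun u => ?_
    have h1 : Measurable fun p : (ℝ≥0 → ℝ) × (ℝ≥0 → ℝ) => p.1 (min u s) :=
      (measurable_pi_apply _).comp measurable_fst
    exact h1.add (((measurable_pi_apply (u - k : ℝ≥0)).comp measurable_snd).sub
      ((measurable_pi_apply 0).comp measurable_snd))
  have hstopped (Z : ℕ → Path) : stoppedFun s (glue Z) = G (R Z, stoppedFun a (Z k).1) := by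
    funext u
    simp only [stoppedFun, G]
    rw [hsum Z ((min_le_right _ _).trans (hst.trans hk')), min_eq_left (zero_le : 0 ≤ a)]
    have h1 : min (min u s - k) 1 = min (u - k) a := by
      have h2 : min u s - k = min (u - k) a := by
        rcases le_total u s with h | h
        · rw [min_eq_left h, min_eq_left (tsub_le_tsub_right h _)]
        · rw [min_eq_right h, min_eq_right (tsub_le_tsub_right h _)]
      rw [h2, min_eq_left ((min_le_right _ _).trans (hab.trans hb1))]
    rw [h1]
  have hinc (Z : ℕ → Path) : glue Z t - glue Z s = (Z k).1 b - (Z k).1 a := by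
    rw [hsum Z hk', hsum Z (hst.trans hk'), min_eq_left hb1, min_eq_left (hab.trans hb1)]
    have h1 : R Z t = R Z s := by
      refine Finset.sum_congr rfl fun j _ => ?_
      have hj : ((j : ℕ) : ℝ≥0) + 1 ≤ k := by exact_mod_cast Finset.mem_range.1 j.2
      rw [min_eq_right, min_eq_right]
      · rw [le_tsub_iff_left (le_self_add.trans (hj.trans hk))]
        exact hj.trans hk
      · rw [le_tsub_iff_left (le_self_add.trans (hj.trans (hk.trans hst)))]
        exact hj.trans (hk.trans hst)
    rw [h1]
    ring
  have hZk : μ.map (fun Z => Z k) = ν := Measure.infinitePi_map_eval (fun _ => ν) k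
  have hind : IndepFun R (fun Z : ℕ → Path => Z k) μ := by
    have h1 : iIndepFun (fun (i : ℕ) (Z : ℕ → Path) => Z i) μ :=
      iIndepFun_infinitePi (P := fun _ : ℕ => ν) (X := fun _ z => z) fun _ => measurable_id
    have h2 := h1.indepFun_finset (Finset.range k) {k} (by simp) fun i => measurable_pi_apply i
    exact h2.comp (φ := R₀) (ψ := fun z : ({k} : Finset ℕ) → Path => z ⟨k, by simp⟩) hR₀
      (measurable_pi_apply _)
  -- The pair of `R` and the `k`-th path has a product law; the past and the increment are
  -- functionals of this pair.
  have e : μ.map (fun Z => (R Z, Z k)) = (μ.map R).prod ν := by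
    rw [(indepFun_iff_map_prod_eq_prod_map_map hR.aemeasurable
      (measurable_pi_apply k).aemeasurable).1 hind, hZk]
  have hsa : Measurable (fun ω : Path => stoppedFun a ω.1) :=
    (measurable_stoppedFun a).comp measurable_subtype_coe
  have hd := measurable_increment (ξ := fun ω : Path => ω.1) measurable_subtype_coe a b
  have : IsProbabilityMeasure (μ.map R) := Measure.isProbabilityMeasure_map hR.aemeasurable
  have : IsProbabilityMeasure (ν.map fun ω : Path => stoppedFun a ω.1) :=
    Measure.isProbabilityMeasure_map hsa.aemeasurable
  have hRk : Measurable fun Z : ℕ → Path => (R Z, Z k) := hR.prodMk (measurable_pi_apply k)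
  have e1 : μ.map (fun Z => stoppedFun s (glue Z)) =
      ((μ.map R).prod (ν.map fun ω : Path => stoppedFun a ω.1)).map G := by
    have h1 := Measure.map_prod_map (μ.map R) ν measurable_id hsa
    rw [Measure.map_id] at h1
    rw [h1, ← e, Measure.map_map (measurable_id.prodMap hsa) hRk,
      Measure.map_map hG ((measurable_id.prodMap hsa).comp hRk)]
    exact congrArg (μ.map ·) (funext hstopped)
  have e2 : μ.map (fun Z => (R Z, (stoppedFun a (Z k).1, (Z k).1 b - (Z k).1 a))) =
      (μ.map R).prod ((ν.map fun ω : Path => stoppedFun a ω.1).prod (n (t - s))) := by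
    have h1 := Measure.map_prod_map (μ.map R) ν measurable_id (hsa.prodMk hd)
    rw [Measure.map_id, ← e, Measure.map_map (measurable_id.prodMap (hsa.prodMk hd)) hRk,
      hν a b hab hb1, hts] at h1
    exact h1.symm
  have e3 : ((μ.map R).prod (ν.map fun ω : Path => stoppedFun a ω.1)).prod (n (t - s)) =
      ((μ.map R).prod ((ν.map fun ω : Path => stoppedFun a ω.1).prod (n (t - s)))).map
        MeasurableEquiv.prodAssoc.symm := by
    rw [← Measure.prodAssoc_prod, Measure.map_map (by fun_prop) (by fun_prop)]
    simp
  have h1 := Measure.map_prod_map ((μ.map R).prod (ν.map fun ω : Path => stoppedFun a ω.1))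
    (n (t - s)) hG measurable_id
  have hm : Measurable fun Z : ℕ → Path =>
      (R Z, (stoppedFun a (Z k).1, (Z k).1 b - (Z k).1 a)) :=
    hR.prodMk ((hsa.prodMk hd).comp (measurable_pi_apply k))
  rw [HasIncrLaw, e1]
  rw [Measure.map_id] at h1
  rw [h1, e3, ← e2, Measure.map_map (by fun_prop) hm,
    Measure.map_map (hG.prodMap measurable_id) (Measurable.comp (by fun_prop) hm)]
  refine congrArg (μ.map ·) (funext fun Z => ?_)
  simp only [hstopped, hinc]
  rfl

/-- The glued path has independent increments with the laws `n`: cut the interval at the integers.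
-/
lemma hasIncrLaw_glue
    (hadd : ∀ s t, n (s + t) = ((n s).prod (n t)).map fun p => p.1 + p.2)
    (hν : ∀ s t, s ≤ t → t ≤ 1 → HasIncrLaw (fun ω : Path => ω.1) ν (n (t - s)) s t)
    (hst : s ≤ t) :
    HasIncrLaw glue (Measure.infinitePi fun _ : ℕ => ν) (n (t - s)) s t := by
  suffices h : ∀ N : ℕ, ∀ s t : ℝ≥0, s ≤ t → t ≤ N →
      HasIncrLaw glue (Measure.infinitePi fun _ : ℕ => ν) (n (t - s)) s t from
    h (⌊t⌋₊ + 1) s t hst (by exact_mod_cast (Nat.lt_floor_add_one t).le)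
  intro N
  induction N with
  | zero =>
    intro s t hst ht
    have ht0 : t = 0 := by simpa using ht
    subst ht0
    exact hasIncrLaw_glue_of_le_of_le hν hst (k := 0) (by simp) (by simp)
  | succ N ih =>
    intro s t hst ht
    rcases le_total t N with htN | htN
    · exact ih s t hst htN
    rcases le_total (N : ℝ≥0) s with hsN | hsN
    · exact hasIncrLaw_glue_of_le_of_le hν hst hsN ht
    have h1 := (ih s N hsN le_rfl).trans measurable_glue hsN
      (hasIncrLaw_glue_of_le_of_le hν htN le_rfl ht)
    rw [← hadd] at h1
    rwa [add_comm, tsub_add_tsub_cancel htN hsN] at h1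

end

/-- The tail of the exponential distribution. -/
lemma expMeasure_Ioi {q : ℝ} (hq : 0 < q) (t : ℝ≥0) :
    expMeasure q (Set.Ioi (t : ℝ)) = ENNReal.ofReal (Real.exp (-(q * t))) := by
  have := isProbabilityMeasure_expMeasure hq
  have h1 : (expMeasure q (Set.Iic (t : ℝ))) = ENNReal.ofReal (1 - Real.exp (-(q * t))) := by
    rw [← ofReal_cdf, cdf_expMeasure_eq hq, if_pos (NNReal.coe_nonneg t)]
  rw [← Set.compl_Iic, prob_compl_eq_one_sub measurableSet_Iic, h1, ← ENNReal.ofReal_one,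
    ← ENNReal.ofReal_sub _ (by simpa using by positivity)]
  congr 1
  ring


/-- The path `f` killed at the time `z`. -/
def killAt (f : ℝ≥0 → ℝ) (z : ℝ≥0) : ℝ≥0 → WithTop ℝ := fun t =>
  if t < z then ((f t : ℝ) : WithTop ℝ) else ⊤

lemma killAt_ne_top_iff {f : ℝ≥0 → ℝ} {z t : ℝ≥0} : killAt f z t ≠ ⊤ ↔ t < z := by
  rw [killAt]
  split_ifs with h <;> simp [h]

lemma killAt_of_lt {f : ℝ≥0 → ℝ} {z t : ℝ≥0} (h : t < z) : killAt f z t = (f t : ℝ) := if_pos h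

/-- By the lack of memory of the exponential distribution, killing a Lévy process at an independent
exponential time yields a killed Lévy process. -/
lemma isKilledLevy_killAt {Ω : Type*} [MeasurableSpace Ω] {μ : Measure Ω}
    [IsProbabilityMeasure μ] {ξ : Ω → ℝ≥0 → ℝ} {n m : ℝ≥0 → Measure ℝ}
    [∀ t, IsProbabilityMeasure (n t)] {q : ℝ} (hq : 0 < q) (hξ : Measurable ξ)
    (h0 : ∀ ω, ξ ω 0 = 0) (h : ∀ s t, s ≤ t → HasIncrLaw ξ μ (n (t - s)) s t)
    (hm : ∀ t C, MeasurableSet C → m t C = ENNReal.ofReal (Real.exp (-(q * t))) * n t C) :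
    IsKilledLevy (μ.prod (expMeasure q)) (fun ω => killAt (ξ ω.1) ω.2.toNNReal) m := by
  have := isProbabilityMeasure_expMeasure hq
  have hlt (ω : Ω × ℝ) (t : ℝ≥0) : t < ω.2.toNNReal ↔ ω.2 ∈ Set.Ioi (t : ℝ) :=
    Real.lt_toNNReal_iff_coe_lt
  refine ⟨fun t => ?_, fun ω s t hst ht => ?_, ?_, fun s t S C hS hC => ?_⟩
  · refine Measurable.ite ?_ ?_ measurable_const
    · exact measurableSet_lt measurable_const measurable_snd.real_toNNReal
    · exact WithTop.measurable_coe.comp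
        ((measurable_pi_apply t).comp (hξ.comp measurable_fst))
  · rw [killAt_ne_top_iff] at ht ⊢
    exact hst.trans_lt ht
  · have h1 : (μ.prod (expMeasure q)) (Set.univ ×ˢ Set.Ioi (0 : ℝ)) = 1 := by
      rw [Measure.prod_prod, measure_univ, one_mul]
      simpa using expMeasure_Ioi hq 0
    have h2 := (mem_ae_iff_prob_eq_one (MeasurableSet.univ.prod measurableSet_Ioi)).2 h1
    filter_upwards [h2] with ω hω
    rw [killAt_of_lt ((hlt ω 0).2 hω.2), h0]
  · set S' : Set (ℝ≥0 → ℝ) := (fun f u => ((f u : ℝ) : WithTop ℝ)) ⁻¹' S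
    have hS' : MeasurableSet S' :=
      (measurable_pi_lambda _ fun u => WithTop.measurable_coe.comp (measurable_pi_apply u)) hS
    have hpast (ω : Ω × ℝ) (hω : s < ω.2.toNNReal) :
        (fun u => killAt (ξ ω.1) ω.2.toNNReal (min u s)) ∈ S ↔ stoppedFun s (ξ ω.1) ∈ S' := by
      have : (fun u => killAt (ξ ω.1) ω.2.toNNReal (min u s)) =
          fun u => ((stoppedFun s (ξ ω.1) u : ℝ) : WithTop ℝ) :=
        funext fun u => killAt_of_lt ((min_le_right _ _).trans_lt hω)
      rw [this]
      rfl
    have e1 : {ω : Ω × ℝ | (fun u => killAt (ξ ω.1) ω.2.toNNReal (min u s)) ∈ S} ∩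
        {ω | killAt (ξ ω.1) ω.2.toNNReal (s + t) ≠ ⊤ ∧
          (killAt (ξ ω.1) ω.2.toNNReal (s + t)).untopD 0 -
            (killAt (ξ ω.1) ω.2.toNNReal s).untopD 0 ∈ C} =
        ({ω | stoppedFun s (ξ ω) ∈ S'} ∩ {ω | ξ ω (s + t) - ξ ω s ∈ C}) ×ˢ
          Set.Ioi ((s + t : ℝ≥0) : ℝ) := by
      ext ω
      simp only [Set.mem_inter_iff, Set.mem_ofPred_eq, Set.mem_prod, killAt_ne_top_iff, ← hlt]
      constructor
      · rintro ⟨h1, h2, h3⟩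
        have h4 : s < ω.2.toNNReal := le_self_add.trans_lt h2
        rw [killAt_of_lt h2, killAt_of_lt h4] at h3
        exact ⟨⟨(hpast ω h4).1 h1, h3⟩, h2⟩
      · rintro ⟨⟨h1, h3⟩, h2⟩
        have h4 : s < ω.2.toNNReal := le_self_add.trans_lt h2
        rw [killAt_of_lt h2, killAt_of_lt h4]
        exact ⟨(hpast ω h4).2 h1, h2, h3⟩
    have e2 : {ω : Ω × ℝ | (fun u => killAt (ξ ω.1) ω.2.toNNReal (min u s)) ∈ S} ∩
        {ω | killAt (ξ ω.1) ω.2.toNNReal s ≠ ⊤} =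
        {ω | stoppedFun s (ξ ω) ∈ S'} ×ˢ Set.Ioi (s : ℝ) := by
      ext ω
      simp only [Set.mem_inter_iff, Set.mem_ofPred_eq, Set.mem_prod, killAt_ne_top_iff, ← hlt]
      exact ⟨fun h => ⟨(hpast ω h.2).1 h.1, h.2⟩, fun h => ⟨(hpast ω h.2).2 h.1, h.2⟩⟩
    have h1 := (h s (s + t) le_self_add).measure_inter hξ hS' hC
    rw [add_tsub_cancel_left] at h1
    rw [e1, e2, Measure.prod_prod, Measure.prod_prod, h1, expMeasure_Ioi hq, expMeasure_Ioi hq,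
      hm t C hC, NNReal.coe_add, mul_add, neg_add, Real.exp_add,
      ENNReal.ofReal_mul (Real.exp_pos _).le]
    ring

/-- A killed Lévy process whose paths on `[0, 1]` are càdlàg has the same law as a Lévy process
killed at an independent exponential time: the Lévy process is glued from independent copies of the
segment on `[0, 1]`, conditioned on survival up to time `1`. -/
lemma IsKilledLevy.exists_isLevyProcess {Ω : Type*} [MeasurableSpace Ω] {μ : Measure Ω}
    [IsProbabilityMeasure μ] {k : Ω → ℝ≥0 → WithTop ℝ} {m : ℝ≥0 → Measure ℝ}
    (h : IsKilledLevy μ k m) {q : ℝ} (hq0 : 0 < q)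
    (hq : ∀ t, μ {ω | k ω t ≠ ⊤} = ENNReal.ofReal (Real.exp (-(q * t)))) {seg : Ω → Path}
    (hseg : Measurable seg)
    (hk : ∀ ω, k ω 1 ≠ ⊤ → ∀ u, (seg ω).1 u = realValue k ω (min u 1)) :
    ∃ (Ω' : Type) (_ : MeasurableSpace Ω') (μ' : Measure Ω') (ξ : ℝ≥0 → Ω' → ℝ) (ζ : Ω' → ℝ≥0),
      IsProbabilityMeasure μ' ∧ IsLevyProcess ξ μ' ∧ Measurable ζ ∧
      μ'.map (fun ω => (ζ ω : ℝ)) = expMeasure q ∧ IndepFun (fun ω (t : ℝ≥0) => ξ t ω) ζ μ' ∧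
      μ'.map (fun ω => killAt (fun t => ξ t ω) (ζ ω)) = μ.map k := by
  have := isProbabilityMeasure_expMeasure hq0
  have := h.isProbabilityMeasure_condLaw hq
  have := ProbabilityTheory.cond_isProbabilityMeasure (measure_alive_ne_zero hq 1)
  set ν := (ProbabilityTheory.cond μ {ω | k ω 1 ≠ ⊤}).map seg with hν
  have : IsProbabilityMeasure ν := Measure.isProbabilityMeasure_map hseg.aemeasurable
  have hinc (s t : ℝ≥0) (hst : s ≤ t) :
      HasIncrLaw glue (Measure.infinitePi fun _ : ℕ => ν) (condLaw μ k (t - s)) s t :=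
    hasIncrLaw_glue (h.condLaw_add hq) (fun s t => h.hasIncrLaw_segment hq hseg hk) hst
  have hmap : ((Measure.infinitePi fun _ : ℕ => ν).prod (expMeasure q)).map Prod.snd =
      expMeasure q := by
    rw [Measure.map_snd_prod, measure_univ, one_smul]
  refine ⟨(ℕ → Path) × ℝ, inferInstance, (Measure.infinitePi fun _ : ℕ => ν).prod (expMeasure q),
    fun t ω => glue ω.1 t, fun ω => ω.2.toNNReal, inferInstance, ?_,
    measurable_snd.real_toNNReal, ?_, indepFun_prod measurable_glue measurable_real_toNNReal, ?_⟩
  · exact isLevyProcess_of_hasIncrLaw (measurable_glue.comp measurable_fst)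
      (fun ω => isCadlag_glue ω.1) (.of_forall fun ω => glue_zero ω.1)
      fun s t hst => (hinc s t hst).comp_fst measurable_glue
  · have hpos : ∀ᵐ x ∂(expMeasure q), 0 < x := by
      have h1 : expMeasure q (Set.Ioi 0) = 1 := by simpa using expMeasure_Ioi hq0 0
      exact (mem_ae_iff_prob_eq_one measurableSet_Ioi).2 h1
    have h1 : ∀ᵐ ω ∂((Measure.infinitePi fun _ : ℕ => ν).prod (expMeasure q)), 0 < ω.2 := by
      rw [← hmap] at hpos
      exact ae_of_ae_map measurable_snd.aemeasurable hpos
    refine (Measure.map_congr ?_).trans hmap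
    filter_upwards [h1] with ω hω
    exact Real.coe_toNNReal _ hω.le
  · exact (isKilledLevy_killAt hq0 measurable_glue glue_zero hinc
      fun t C hC => h.apply_eq_mul_condLaw hq t hC).map_eq h


/-! ### The Lamperti time change as a measurable functional -/

/-- The exponential of the killed path `k`, equal to `0` from the killing time on, recovered from the
values of `k` on the grids `gridAbove`. Unlike the evaluation of a function on `ℝ≥0` at a varying
time, it is jointly measurable; it is the true exponential when `k` is right-continuous. -/
def expPath (k : ℝ≥0 → WithTop ℝ) (u : ℝ≥0) : ℝ≥0∞ :=
  limsup (fun n => if k (gridAbove n u) = ⊤ then 0 else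
    ENNReal.ofReal (Real.exp ((k (gridAbove n u)).untopD 0))) atTop

/-- The integral of `expPath k ^ α` up to time `s`. -/
def expPathIntegral (α : ℝ) (k : ℝ≥0 → WithTop ℝ) (s : ℝ≥0) : ℝ≥0∞ :=
  ∫⁻ u in Set.Icc (0 : ℝ) s, expPath k u.toNNReal ^ α

/-- The first time at which `expPathIntegral` exceeds `t`, as an infimum over countably many
times. -/
def expPathTime (α : ℝ) (k : ℝ≥0 → WithTop ℝ) (t : ℝ≥0) : ℝ≥0∞ :=
  ⨅ n : ℕ, if (t : ℝ≥0∞) < expPathIntegral α k (TopologicalSpace.denseSeq ℝ≥0 n) then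
    (TopologicalSpace.denseSeq ℝ≥0 n : ℝ≥0∞) else ⊤

/-- The Lamperti transform of a killed path, in a form which is measurable on the product space. -/
def lampertiMap (α ε : ℝ) (k : ℝ≥0 → WithTop ℝ) (t : ℝ≥0) : WithTop ℝ :=
  if expPathTime α k t = ⊤ then ⊤ else
    ((ε * (expPath k (expPathTime α k t).toNNReal).toReal : ℝ) : WithTop ℝ)

lemma measurable_expPath :
    Measurable (fun p : ℝ≥0 × (ℝ≥0 → WithTop ℝ) => expPath p.2 p.1) := by
  refine .limsup fun n => ?_
  refine measurable_comp_gridAbove (X := fun t (k : ℝ≥0 → WithTop ℝ) =>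
    if k t = ⊤ then (0 : ℝ≥0∞) else ENNReal.ofReal (Real.exp ((k t).untopD 0))) (fun t => ?_) n
  exact Measurable.ite (measurable_pi_apply t (measurableSet_singleton ⊤)) measurable_const
    ((measurable_pi_apply t).untopD 0).exp.ennreal_ofReal

lemma measurable_expPathIntegral (α : ℝ) (s : ℝ≥0) :
    Measurable (fun k => expPathIntegral α k s) := by
  refine Measurable.lintegral_prod_right' (f := fun p : (ℝ≥0 → WithTop ℝ) × ℝ =>
    expPath p.1 p.2.toNNReal ^ α) ?_
  exact (measurable_expPath.comp ((measurable_real_toNNReal.comp measurable_snd).prodMk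
    measurable_fst)).pow_const α

lemma measurable_expPathTime (α : ℝ) (t : ℝ≥0) : Measurable (fun k => expPathTime α k t) :=
  .iInf fun _ => Measurable.ite (measurableSet_lt measurable_const
    (measurable_expPathIntegral α _)) measurable_const measurable_const

lemma measurable_lampertiMap (α ε : ℝ) : Measurable (lampertiMap α ε) := by
  refine measurable_pi_lambda _ fun t => ?_
  have h := measurable_expPathTime α t
  refine Measurable.ite (h (measurableSet_singleton ⊤)) measurable_const ?_
  exact ((measurable_expPath.comp (h.ennreal_toNNReal.prodMk
    measurable_id)).ennreal_toReal.const_mul ε).withTop_coe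

section KillAt

variable {α : ℝ} {f : ℝ≥0 → ℝ} {z : ℝ≥0}

lemma expPath_killAt_of_lt {u : ℝ≥0} (hf : ContinuousWithinAt f (Set.Ici u) u) (h : u < z) :
    expPath (killAt f z) u = ENNReal.ofReal (Real.exp (f u)) := by
  refine Tendsto.limsup_eq ?_
  have h1 : Tendsto (fun n => ENNReal.ofReal (Real.exp (f (gridAbove n u)))) atTop
      (𝓝 (ENNReal.ofReal (Real.exp (f u)))) := by
    refine (ENNReal.continuous_ofReal.tendsto _).comp ((Real.continuous_exp.tendsto _).comp ?_)
    exact (hf.tendsto.mono_left (nhdsWithin_mono _ Set.Ioi_subset_Ici_self)).comp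
      (tendsto_gridAbove u)
  refine h1.congr' ?_
  filter_upwards [(tendsto_gridAbove u).eventually (Ioo_mem_nhdsGT h)] with n hn
  rw [killAt_of_lt hn.2, if_neg WithTop.coe_ne_top, WithTop.untopD_coe]

lemma expPath_killAt_of_le {u : ℝ≥0} (h : z ≤ u) : expPath (killAt f z) u = 0 := by
  have h1 (n : ℕ) : killAt f z (gridAbove n u) = ⊤ :=
    if_neg (not_lt.2 (h.trans (lt_gridAbove n u).le))
  simp [expPath, h1]

lemma expPathIntegral_killAt (hα : 0 < α)
    (hf : ∀ s < z, ContinuousWithinAt f (Set.Ici s) s) (s : ℝ≥0) :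
    expPathIntegral α (killAt f z) s = expFunctional α f (min s z) := by
  have h1 : ∀ u ∈ Set.Icc (0 : ℝ) s, expPath (killAt f z) u.toNNReal ^ α =
      (Set.Iio (z : ℝ)).indicator
        (fun u => ENNReal.ofReal (Real.exp (α * f u.toNNReal))) u := by
    intro u hu
    by_cases h : u < z
    · have h' : u.toNNReal < z := Real.toNNReal_lt_iff_lt_coe hu.1 |>.2 h
      rw [Set.indicator_of_mem (Set.mem_Iio.2 h), expPath_killAt_of_lt (hf _ h') h',
        ENNReal.ofReal_rpow_of_pos (Real.exp_pos _), ← Real.exp_mul, mul_comm]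
    · rw [Set.indicator_of_notMem (by simpa using h), expPath_killAt_of_le
        (NNReal.le_toNNReal_of_coe_le (not_lt.1 h)), ENNReal.zero_rpow_of_pos hα]
  rw [expPathIntegral, setLIntegral_congr_fun measurableSet_Icc h1,
    setLIntegral_indicator measurableSet_Iio, expFunctional]
  refine setLIntegral_congr ?_
  -- Both sides agree up to the point `z`.
  have h2 : Set.Icc (0 : ℝ) ((min s z : ℝ≥0) : ℝ) = Set.Iic (z : ℝ) ∩ Set.Icc (0 : ℝ) s := by
    ext x
    simp only [NNReal.coe_min, Set.mem_Icc, le_inf_iff, Set.mem_inter_iff, Set.mem_Iic]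
    tauto
  rw [h2]
  exact Iio_ae_eq_Iic.inter (ae_eq_refl _)

lemma pos_of_lt_expFunctional {s : ℝ≥0} {t : ℝ≥0∞} (h : t < expFunctional α f s) : 0 < s := by
  rw [pos_iff_ne_zero]
  rintro rfl
  simp [expFunctional_zero] at h

lemma lampertiTime_le {s t : ℝ≥0} (h : (t : ℝ≥0∞) < expFunctional α f s) :
    lampertiTime α f t ≤ s :=
  csInf_le (OrderBot.bddBelow _) (Set.mem_ofPred_eq ▸ ⟨pos_of_lt_expFunctional h, h⟩)

lemma lampertiTime_lt {t : ℝ≥0} (h : (t : ℝ≥0∞) < expFunctional α f z) :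
    lampertiTime α f t < z := by
  obtain ⟨s, hs, hts⟩ := exists_lt_expFunctional h
  exact (lampertiTime_le hts).trans_lt hs

lemma expPathTime_killAt (hα : 0 < α)
    (hf : ∀ s < z, ContinuousWithinAt f (Set.Ici s) s) (t : ℝ≥0) :
    expPathTime α (killAt f z) t =
      if (t : ℝ≥0∞) < expFunctional α f z then (lampertiTime α f t : ℝ≥0∞) else ⊤ := by
  split_ifs with h
  · refine le_antisymm ?_ (le_iInf fun n => ?_)
    · refine ENNReal.le_of_forall_pos_le_add fun δ hδ _ => ?_
      obtain ⟨s₀, hs₀, hts₀⟩ := exists_lt_expFunctional h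
      have hne : {s : ℝ≥0 | 0 < s ∧ (t : ℝ≥0∞) < expFunctional α f s}.Nonempty :=
        ⟨s₀, pos_of_lt_expFunctional hts₀, hts₀⟩
      obtain ⟨s, ⟨hs0, hs⟩, hsδ⟩ := exists_lt_of_csInf_lt hne
        (lt_add_of_pos_right (lampertiTime α f t) hδ)
      have hmin : (t : ℝ≥0∞) < expFunctional α f (min s s₀) := by
        rcases le_total s s₀ with hh | hh
        · rwa [min_eq_left hh]
        · rwa [min_eq_right hh]
      obtain ⟨_, ⟨n, rfl⟩, hn⟩ := (TopologicalSpace.denseRange_denseSeq ℝ≥0).exists_between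
        (lt_of_le_of_lt (min_le_left s s₀) hsδ)
      refine (iInf_le _ n).trans ?_
      rw [if_pos]
      · exact_mod_cast hn.2.le
      · rw [expPathIntegral_killAt hα hf]
        refine hmin.trans_le (expFunctional_mono α f (le_min hn.1.le ?_))
        exact (min_le_right _ _).trans hs₀.le
    · split_ifs with hn
      · rw [expPathIntegral_killAt hα hf] at hn
        exact ENNReal.coe_le_coe.2 ((lampertiTime_le hn).trans (min_le_left _ z))
      · exact le_top
  · refine iInf_eq_top.2 fun n => if_neg ?_
    rw [expPathIntegral_killAt hα hf]
    exact fun hn => h (hn.trans_le (expFunctional_mono α f (min_le_right _ _)))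

/-- On right-continuous paths, `lampertiMap` is the Lamperti transform. -/
lemma lampertiMap_killAt (hα : 0 < α) (ε : ℝ)
    (hf : ∀ s < z, ContinuousWithinAt f (Set.Ici s) s) :
    lampertiMap α ε (killAt f z) = lampertiPath α ε f z := by
  funext t
  rw [lampertiMap, lampertiPath, expPathTime_killAt hα hf]
  by_cases h : (t : ℝ≥0∞) < expFunctional α f z
  · have hlt := lampertiTime_lt h
    rw [if_pos h, if_pos h, if_neg ENNReal.coe_ne_top, ENNReal.toNNReal_coe,
      expPath_killAt_of_lt (hf _ hlt) hlt, ENNReal.toReal_ofReal (Real.exp_pos _).le]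
  · rw [if_neg h, if_neg h, if_pos rfl]

end KillAt


/-! ### Inverting the Lamperti transform -/

variable {α : ℝ} {ω : Path}

/-- The values of the Lamperti transform `logPath`, extended by `0` after its lifetime. -/
def logValue (α : ℝ) (ω : Path) (s : ℝ≥0) : ℝ := (logPath α ω s).untopD 0

lemma logValue_eq (hα : 0 < α) {s t : ℝ≥0} (ht : KeepsSign ω t) (hs : clock α ω t = s) :
    logValue α ω s = Real.log (ω.1 t) := by
  rw [logValue, logPath, (invClock_eq_coe_iff hα).2 ⟨ht, hs⟩, WithTop.map_coe, WithTop.untopD_coe]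

lemma lt_of_clock_lt {s t : ℝ≥0} (h : clock α ω s < clock α ω t) : s < t := by
  by_contra! hts
  exact absurd h (not_lt.2 (clock_mono α ω hts))

lemma KeepsSign.clock_lt_iff (hα : 0 < α) {s t : ℝ≥0} (h : KeepsSign ω s) :
    clock α ω s < clock α ω t ↔ s < t :=
  ⟨lt_of_clock_lt, h.clock_lt hα⟩

lemma IsCadlag.log {f : ℝ≥0 → ℝ} (hf : IsCadlag f) {c : ℝ} (hc : 0 < c) (h : ∀ t, c ≤ |f t|) :
    IsCadlag (fun t => Real.log (f t)) := by
  refine ⟨fun t => (hf.1 t).log (abs_pos.1 (hc.trans_le (h t))), fun t => ?_⟩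
  obtain ⟨l, hl⟩ := hf.2 t
  rcases (𝓝[<] t).eq_or_neBot with h0 | h0
  · exact ⟨0, h0 ▸ tendsto_bot⟩
  · have : c ≤ |l| := ge_of_tendsto hl.abs (.of_forall h)
    exact ⟨_, hl.log (abs_pos.1 (hc.trans_le this))⟩

/-- Up to a time at which the path has kept its sign, the Lamperti transform is càdlàg: the inverse
of the clock is increasing and continuous. -/
lemma KeepsSign.isCadlag_logValue_min (hα : 0 < α) {a r : ℝ≥0} (h : KeepsSign ω a)
    (hr : clock α ω a = r) : IsCadlag (fun u => logValue α ω (min u r)) := by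
  have hex (u : ℝ≥0) : ∃ b ≤ a, KeepsSign ω b ∧ clock α ω b = (min u r : ℝ≥0) :=
    h.exists_clock_eq hα (by rw [hr]; exact_mod_cast min_le_right u r)
  choose g hga hgk hgc using hex
  have hlt {b u : ℝ≥0} (hb : b ≤ a) : b < g u ↔ clock α ω b < (min u r : ℝ≥0) := by
    rw [← hgc, (h.mono hb).clock_lt_iff hα]
  have hgt {b u : ℝ≥0} : g u < b ↔ ((min u r : ℝ≥0) : ℝ≥0∞) < clock α ω b := by
    rw [← hgc, (hgk u).clock_lt_iff hα]
  have hmono : Monotone g := by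
    intro u v huv
    by_contra! hvu
    rw [hgt, hgc, ENNReal.coe_lt_coe] at hvu
    exact absurd hvu (not_lt.2 (min_le_min_right r huv))
  -- `g` inverts the strictly increasing clock, so that it has no jumps.
  have hcont : Continuous g := by
    have hmin : Continuous fun u : ℝ≥0 => ((min u r : ℝ≥0) : ℝ≥0∞) := by fun_prop
    refine continuous_iff_continuousAt.2 fun u => tendsto_order.2 ⟨fun b hb => ?_, fun b hb => ?_⟩
    · have hba : b ≤ a := hb.le.trans (hga u)
      filter_upwards [hmin.continuousAt.eventually_const_lt ((hlt hba).1 hb)] with v hv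
      exact (hlt hba).2 hv
    · filter_upwards [hmin.continuousAt.eventually_lt_const (hgt.1 hb)] with v hv
      exact hgt.2 hv
  obtain ⟨c, hc, hk⟩ := h.exists_pos
  have h0 : 0 < |ω.1 0| := abs_pos.2 (h.ne_zero zero_le)
  have hlog : IsCadlag fun t => Real.log ((stopPath a ω).1 t) := by
    refine (stopPath a ω).2.log (c := c / |ω.1 0|) (by positivity) fun t => ?_
    rw [div_le_iff₀ h0, ← abs_mul]
    exact (hk _ (min_le_right t a)).trans (le_abs_self _)
  have heq : (fun u => logValue α ω (min u r)) =
      fun u => Real.log ((stopPath a ω).1 (g u)) := by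
    funext u
    rw [stopPath_apply (hga u), logValue_eq hα (hgk u) (hgc u)]
  rw [heq]
  exact hlog.comp_monotone hcont hmono

/-- The integral of `|X| ^ α` with respect to the clock is the original time. -/
lemma KeepsSign.expFunctional_logValue (hα : 0 < α) {t r : ℝ≥0} (h : KeepsSign ω t)
    (hr : clock α ω t = r) : expFunctional α (logValue α ω) r = t := by
  -- `F` agrees with the Lamperti transform up to time `r`, and it is measurable since it is
  -- càdlàg.
  let F : Path := ⟨_, h.isCadlag_logValue_min hα hr⟩
  rw [expFunctional_congr (g := F.1) fun u hu => by
    change _ = logValue α ω (min u r)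
    rw [min_eq_left hu]]
  set G : ℝ → ℝ≥0∞ := fun v => ENNReal.ofReal (Real.exp (α * F.1 v.toNNReal))
  have hG : Measurable G := (measurable_exp_integrand F.measurable).ennreal_ofReal
  set g : ℝ → ℝ≥0∞ := fun u => ENNReal.ofReal (Real.exp (-α * Real.log (ω.1 u.toNNReal)))
  have hg : Measurable g := (measurable_exp_integrand (measurable_log_path ω)).ennreal_ofReal
  set m : Measure ℝ := (volume.restrict (Set.Icc 0 (t : ℝ))).withDensity g
  set C : ℝ → ℝ := fun u => (clock α ω u.toNNReal).toReal
  have hC : Measurable C :=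
    ((clock_mono α ω).measurable.comp measurable_real_toNNReal).ennreal_toReal
  have hCe {u : ℝ} (hu : u.toNNReal ≤ t) : clock α ω u.toNNReal ≠ ⊤ :=
    (h.mono hu).clock_ne_top hα
  have : IsFiniteMeasure m := isFiniteMeasure_withDensity (h.clock_ne_top hα)
  -- The clock maps the measure `|X u| ^ (-α) du` to the Lebesgue measure.
  have hmap : m.map C = volume.restrict (Set.Icc 0 (r : ℝ)) := by
    refine Measure.ext_of_Iic _ _ fun x => ?_
    rw [Measure.map_apply hC measurableSet_Iic, withDensity_apply _ (hC measurableSet_Iic),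
      Measure.restrict_restrict (hC measurableSet_Iic), Measure.restrict_apply measurableSet_Iic]
    rcases lt_or_ge x 0 with hx | hx
    · have h1 : C ⁻¹' Set.Iic x = ∅ := by
        ext u
        simpa using hx.trans_le ENNReal.toReal_nonneg
      have h2 : Set.Iic x ∩ Set.Icc 0 (r : ℝ) = ∅ := by
        ext u
        simp only [Set.mem_inter_iff, Set.mem_Iic, Set.mem_Icc, Set.mem_empty_iff_false]
        exact ⟨fun hu => by linarith [hu.1, hu.2.1], False.elim⟩
      simp [h1, h2]
    · lift x to ℝ≥0 using hx
      obtain ⟨b, hbt, hbk, hbc⟩ := h.exists_clock_eq hα (s := (min x r : ℝ≥0))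
        (by rw [hr]; exact_mod_cast min_le_right x r)
      have h1 : C ⁻¹' Set.Iic (x : ℝ) ∩ Set.Icc 0 (t : ℝ) = Set.Icc 0 (b : ℝ) := by
        ext u
        simp only [Set.mem_inter_iff, Set.mem_preimage, Set.mem_Iic, Set.mem_Icc, C]
        constructor
        · rintro ⟨hu, hu0, hut⟩
          refine ⟨hu0, ?_⟩
          lift u to ℝ≥0 using hu0
          rw [Real.toNNReal_coe] at hu
          have hut' : u ≤ t := NNReal.coe_le_coe.1 hut
          have hu' : clock α ω u ≤ x := by
            have h3 := hCe (u := u) (by simpa using hut')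
            rw [Real.toNNReal_coe] at h3
            rw [← ENNReal.coe_toNNReal h3]
            exact_mod_cast hu
          refine NNReal.coe_le_coe.2 (not_lt.1 fun hbu => ?_)
          have h4 := hbk.clock_lt hα hbu
          rw [hbc] at h4
          have h5 : clock α ω u ≤ (min x r : ℝ≥0) := by
            rw [ENNReal.coe_min]
            exact le_min hu' (hr ▸ clock_mono α ω hut')
          exact absurd h4 (not_lt.2 h5)
        · rintro ⟨hu0, hub⟩
          lift u to ℝ≥0 using hu0
          have hub' : u ≤ b := NNReal.coe_le_coe.1 hub
          refine ⟨?_, u.2, NNReal.coe_le_coe.2 (hub'.trans hbt)⟩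
          rw [Real.toNNReal_coe]
          refine ENNReal.toReal_le_coe_of_le_coe ((clock_mono α ω hub').trans ?_)
          rw [hbc]
          exact_mod_cast min_le_left x r
      have h2 : Set.Iic (x : ℝ) ∩ Set.Icc 0 (r : ℝ) = Set.Icc 0 ((min x r : ℝ≥0) : ℝ) := by
        ext u
        simp only [NNReal.coe_min, Set.mem_inter_iff, Set.mem_Iic, Set.mem_Icc, le_inf_iff]
        tauto
      rw [h1, h2, Real.volume_Icc, sub_zero, ENNReal.ofReal_coe_nnreal, ← hbc]
      rfl
  change ∫⁻ v, G v ∂(volume.restrict (Set.Icc 0 (r : ℝ))) = t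
  rw [← hmap, lintegral_map hG hC]
  -- The densities `|X| ^ α` and `|X| ^ (-α)` cancel.
  have hone : ∀ u ∈ Set.Icc (0 : ℝ) t, (g * G ∘ C) u = 1 := by
    intro u hu
    have hut : u.toNNReal ≤ t := Real.toNNReal_le_iff_le_coe.2 hu.2
    have hcl : clock α ω u.toNNReal = ((C u).toNNReal : ℝ≥0) := by
      rw [ENNReal.toNNReal_toReal_eq, ENNReal.coe_toNNReal (hCe hut)]
    have hle : (C u).toNNReal ≤ r := by
      rw [← ENNReal.coe_le_coe, ← hcl, ← hr]
      exact clock_mono α ω hut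
    have hF : F.1 (C u).toNNReal = Real.log (ω.1 u.toNNReal) := by
      change logValue α ω (min _ r) = _
      rw [min_eq_left hle, logValue_eq hα (h.mono hut) hcl]
    simp only [Pi.mul_apply, Function.comp_apply, g, G, hF]
    rw [← ENNReal.ofReal_mul (Real.exp_pos _).le, ← Real.exp_add]
    simp
  have hone' : ∫⁻ u in Set.Icc (0 : ℝ) t, (g * G ∘ C) u = ∫⁻ _ in Set.Icc (0 : ℝ) t, 1 :=
    setLIntegral_congr_fun measurableSet_Icc hone
  refine (lintegral_withDensity_eq_lintegral_mul _ hg (hG.comp hC)).trans (hone'.trans ?_)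
  simp

/-- A regular path is bounded away from `0` up to its first loss of sign, so that its Lamperti
transform has a finite lifetime. -/
lemma IsRegular.clock_ne_top (hα : 0 < α) (h : IsRegular ω) {l : ℝ≥0} (hl : life ω = l) :
    clock α ω l ≠ ⊤ := by
  obtain ⟨l', hl', -, -, hneg⟩ := h.exists_life
  obtain rfl : l = l' := WithTop.coe_inj.1 (hl.symm.trans hl')
  have hk {s : ℝ≥0} (hs : s < l) : KeepsSign ω s :=
    lt_life_iff.1 (by rw [hl]; exact_mod_cast hs)
  rcases eq_or_ne l 0 with rfl | hl0
  · simp [clock_zero]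
  have hl0' := pos_iff_ne_zero.2 hl0
  have hne := nhdsLT_neBot_of_pos hl0'
  have hlim := (ω.2.tendsto_leftLim l).mul_const (ω.1 0)
  have hpos : 0 < Function.leftLim ω.1 l * ω.1 0 := by
    refine lt_of_le_of_ne ?_ (mul_ne_zero (right_ne_zero_of_mul hneg.ne) h.zero_ne).symm
    refine ge_of_tendsto hlim ?_
    filter_upwards [self_mem_nhdsWithin] with v hv
    exact ((hk hv).mul_pos le_rfl).le
  obtain ⟨b, hb, hb'⟩ := (mem_nhdsLT_iff_exists_Ioo_subset' hl0').1
    (hlim.eventually_const_lt (half_lt_self hpos))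
  obtain ⟨b', hbb', hb'l⟩ := exists_between (show b < l from hb)
  obtain ⟨c, hc, hcc⟩ := (hk hb'l).exists_pos
  refine clock_ne_top_of_forall_lt hα (c := min c (Function.leftLim ω.1 l * ω.1 0 / 2))
    (by positivity) h.zero_ne fun u hu => ?_
  rcases le_total u b' with hub | hub
  · exact (min_le_left _ _).trans (hcc u hub)
  · exact (min_le_right _ _).trans (le_of_lt (hb' ⟨hbb'.trans_le hub, hu⟩))

/-- The path up to its first change of sign is recovered from its Lamperti transform. -/
lemma IsRegular.exists_logPath_eq (hα : 0 < α) (h : IsRegular ω) (h1 : |ω.1 0| = 1) :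
    ∃ z : ℝ≥0, logPath α ω = killAt (logValue α ω) z ∧
      (∀ s < z, ContinuousWithinAt (logValue α ω) (Set.Ici s) s) ∧
      lampertiPath α (ω.1 0) (logValue α ω) z = killedPath ω := by
  obtain ⟨l, hl, -⟩ := h.exists_life
  have hz := (ENNReal.coe_toNNReal (h.clock_ne_top hα hl)).symm
  set z := (clock α ω l).toNNReal
  have hkeep {t : ℝ≥0} : KeepsSign ω t ↔ t < l := by
    rw [← lt_life_iff, hl, WithTop.coe_lt_coe]
  have hclz {t : ℝ≥0} (ht : t < l) : clock α ω t < z := by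
    rw [← hz]
    exact (hkeep.2 ht).clock_lt hα ht
  have hex {s : ℝ≥0} (hs : s < z) : ∃ b < l, clock α ω b = s := by
    have hs' : (s : ℝ≥0∞) < clock α ω l := by rw [hz]; exact_mod_cast hs
    obtain ⟨t, ht, hst⟩ := exists_lt_expFunctional hs'
    obtain ⟨b, hbt, -, hb⟩ := (hkeep.2 ht).exists_clock_eq hα hst.le
    exact ⟨b, hbt.trans_lt ht, hb⟩
  have halive {s : ℝ≥0} : logPath α ω s ≠ ⊤ ↔ s < z := by
    rw [logPath_ne_top_iff, invClock_ne_top_iff hα]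
    constructor
    · rintro ⟨t, ht, hts⟩
      have := hclz (hkeep.1 ht)
      rw [hts] at this
      exact_mod_cast this
    · intro hs
      obtain ⟨b, hb, hbs⟩ := hex hs
      exact ⟨b, hkeep.2 hb, hbs⟩
  have hA {b s : ℝ≥0} (hb : b < l) (hbs : clock α ω b = s) :
      expFunctional α (logValue α ω) s = b :=
    (hkeep.2 hb).expFunctional_logValue hα hbs
  have hfin {b : ℝ≥0} (hb : b < l) : clock α ω b = ((clock α ω b).toNNReal : ℝ≥0) :=
    (ENNReal.coe_toNNReal ((hkeep.2 hb).clock_ne_top hα)).symm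
  have hAz {t : ℝ≥0} : (t : ℝ≥0∞) < expFunctional α (logValue α ω) z ↔ t < l := by
    constructor
    · intro ht
      obtain ⟨s, hs, hts⟩ := exists_lt_expFunctional ht
      obtain ⟨b, hb, hbs⟩ := hex hs
      rw [hA hb hbs, ENNReal.coe_lt_coe] at hts
      exact hts.trans hb
    · intro ht
      obtain ⟨t', htt', ht'⟩ := exists_between ht
      have h2 := hA ht' (hfin ht')
      have h3 : (clock α ω t').toNNReal ≤ z := by
        rw [← ENNReal.coe_le_coe, ← hfin ht']
        exact (hclz ht').le
      have h4 := expFunctional_mono α (logValue α ω) h3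
      rw [h2] at h4
      exact lt_of_lt_of_le (by exact_mod_cast htt') h4
  refine ⟨z, ?_, fun s hs => ?_, ?_⟩
  · funext s
    by_cases hs : s < z
    · rw [killAt_of_lt hs]
      obtain ⟨x, hx⟩ := WithTop.ne_top_iff_exists.1 (halive.2 hs)
      rw [logValue, ← hx, WithTop.untopD_coe]
    · rw [killAt, if_neg hs]
      by_contra hne
      exact hs (halive.1 hne)
  · obtain ⟨r, hsr, hrz⟩ := exists_between hs
    obtain ⟨b, hb, hbr⟩ := hex hrz
    have h2 := ((hkeep.2 hb).isCadlag_logValue_min hα hbr).1 s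
    refine h2.congr_of_eventuallyEq ?_ (by rw [min_eq_left hsr.le])
    filter_upwards [mem_nhdsWithin_of_mem_nhds (Iio_mem_nhds hsr)] with u hu
    rw [min_eq_left (Set.mem_Iio.1 hu).le]
  · funext t
    rw [lampertiPath, killedPath, hl]
    simp only [hAz, WithTop.coe_lt_coe]
    split_ifs with ht
    · congr 1
      have hτ : lampertiTime α (logValue α ω) t = (clock α ω t).toNNReal := by
        have htz : (clock α ω t).toNNReal < z := by
          rw [← ENNReal.coe_lt_coe, ← hfin ht]
          exact hclz ht
        refine le_antisymm (le_of_forall_gt_imp_ge_of_dense fun a ha => ?_) ?_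
        · obtain ⟨s, hs, hs'⟩ := exists_between (lt_min ha htz)
          obtain ⟨b, hb, hbs⟩ := hex (hs'.trans_le (min_le_right _ _))
          refine (lampertiTime_le ?_).trans (hs'.le.trans (min_le_left _ _))
          rw [hA hb hbs, ENNReal.coe_lt_coe]
          refine lt_of_clock_lt (α := α) (ω := ω) ?_
          rw [hbs, hfin ht]
          exact_mod_cast hs
        · refine le_csInf ⟨z, ?_, hAz.2 ht⟩ ?_
          · exact pos_of_lt_expFunctional (hAz.2 ht)
          · rintro s ⟨-, hs⟩
            by_contra! hlt
            have h2 := expFunctional_mono α (logValue α ω) hlt.le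
            rw [hA ht (hfin ht)] at h2
            exact absurd hs (not_lt.2 h2)
      have hpos := (hkeep.2 ht).mul_pos le_rfl
      rw [hτ, logValue_eq hα (hkeep.2 ht) (hfin ht), ← Real.log_abs,
        Real.exp_log (abs_pos.2 ((hkeep.2 ht).ne_zero le_rfl))]
      rcases (abs_eq zero_le_one).1 h1 with h0 | h0
      · rw [h0, one_mul, abs_of_pos (by rw [h0] at hpos; linarith)]
      · rw [h0, abs_of_neg (by rw [h0] at hpos; linarith)]; ring
    · rfl

lemma IsRegular.lampertiMap_logPath (hα : 0 < α) (h : IsRegular ω) (h1 : |ω.1 0| = 1) :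
    lampertiMap α (ω.1 0) (logPath α ω) = killedPath ω := by
  obtain ⟨z, hz, hc, hl⟩ := h.exists_logPath_eq hα h1
  rw [hz, lampertiMap_killAt hα _ hc, hl]

/-- The ratio at the first change of sign is not affected by the renormalization of the path at an
earlier time. -/
lemma lifeRatio_renorm {a : ℝ≥0} (h : KeepsSign ω a) (hl : life ω ≠ ⊤) :
    lifeRatio ω = lifeRatio (renorm α a ω) := by
  have ha := h.ne_zero le_rfl
  rw [lifeRatio, lifeRatio]
  rw [life_renorm (α := α) h] at hl ⊢
  cases hb : life (renorm α a ω) with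
  | top => simp [hb] at hl
  | coe b =>
    have hb0 : 0 < b := by
      rw [pos_iff_ne_zero]
      rintro rfl
      refine life_le_iff.1 hb.le (keepsSign_zero ?_)
      rw [renorm_zero_apply]
      exact div_ne_zero ha (abs_pos.2 ha).ne'
    rw [WithTop.map_coe, WithTop.untopD_coe, WithTop.untopD_coe, renorm_apply,
      leftLim_renorm ha hb0, div_div_div_cancel_right₀ (abs_pos.2 ha).ne']


/-! ### The Lamperti transform under the law of the process -/

section Law

variable {α : ℝ} {P : ℝ → Measure Path} {ε : ℝ}

lemma measurable_logPath_pi (hα : 0 < α) : Measurable (logPath α) :=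
  measurable_pi_lambda _ fun s => measurable_logPath hα s

/-- The Lamperti transform up to time `s` is determined by the path up to the time `invClock s`. -/
lemma logPath_min_stopPath (hα : 0 < α) {s t : ℝ≥0} {ω : Path} (h : invClock α s ω ≤ t) :
    (fun u => logPath α (stopPath t ω) (min u s)) = fun u => logPath α ω (min u s) := by
  funext u
  refine logPath_stopPath hα ?_
  obtain ⟨v, hv, hvk, hvs⟩ := (invClock_le_iff hα).1 h
  obtain ⟨w, hw, hwk⟩ := hvk.exists_clock_eq hα (s := (min u s : ℝ≥0))
    (by rw [hvs]; exact_mod_cast min_le_right u s)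
  exact (invClock_le_iff hα).2 ⟨w, hw.trans hv, hwk⟩

/-- At the time `s` of the clock, the path renormalized is a copy of the original one, independent
of the past. -/
lemma IsSelfSimilarMarkov.measure_inter_renorm_invClock (hα : 0 < α)
    (hP : IsSelfSimilarMarkov α P) (hε : |ε| = 1) (s : ℝ≥0) {S : Set (ℝ≥0 → WithTop ℝ)}
    (hS : MeasurableSet S) {B : Set Path} (hB : MeasurableSet B) :
    P ε ({ω | (fun u => logPath α ω (min u s)) ∈ S} ∩ {ω | logPath α ω s ≠ ⊤} ∩
        {ω | renorm α ((invClock α s ω).untopD 0) ω ∈ B}) =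
      P ε ({ω | (fun u => logPath α ω (min u s)) ∈ S} ∩ {ω | logPath α ω s ≠ ⊤}) * P ε B := by
  have hε0 := ne_zero_of_abs_eq_one hε
  set A₀ : Set Path := {ω | (fun u => logPath α ω (min u s)) ∈ S} ∩ {ω | logPath α ω s ≠ ⊤}
  -- The strong Markov property is applied on the event of probability one that the path starts at
  -- `ε`, on which the sign at the time of the restart is known.
  set N : Set Path := {ω | ω.1 0 = ε}
  have hA₀ : MeasurableSet A₀ :=
    ((measurable_pi_lambda _ fun u => measurable_logPath hα (min u s)) hS).inter
      (measurable_logPath hα s (measurableSet_singleton ⊤)).compl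
  have hN : MeasurableSet N := measurable_coord 0 (measurableSet_singleton ε)
  have hNae : ∀ᵐ ω ∂(P ε), ω ∈ N := hP.start ε hε0
  have hae (D : Set Path) : (A₀ ∩ N ∩ D : Set Path) =ᵐ[P ε] (A₀ ∩ D : Set Path) := by
    filter_upwards [hNae] with ω hω
    exact propext ⟨fun h => ⟨h.1.1, h.2⟩, fun h => ⟨⟨h.1, hω⟩, h.2⟩⟩
  have h1 := hP.measure_inter_renorm hε0 hε
    (isStoppingTime_of_stopPath (measurableSet_invClock_le hα s) (invClock_stopPath_le_iff hα s))
    (A := A₀ ∩ N) (measurableSet_past_of_stopPath (measurableSet_invClock_le hα s)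
      (invClock_stopPath_le_iff hα s) (hA₀.inter hN) fun t ω ht => ?_) (fun ω hω => ?_) hB
  · rw [measure_congr (hae _)] at h1
    rw [h1]
    have := measure_congr (hae Set.univ)
    rw [Set.inter_univ, Set.inter_univ] at this
    rw [this]
  · have hN' : ω ∈ N ↔ stopPath t ω ∈ N := by
      simp only [N, Set.mem_ofPred_eq, stopPath_apply zero_le]
    have hA' : ω ∈ A₀ ↔ stopPath t ω ∈ A₀ := by
      simp only [A₀, Set.mem_inter_iff, Set.mem_ofPred_eq, logPath_min_stopPath hα ht,
        logPath_stopPath hα ht]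
    exact and_congr hA' hN'
  · obtain ⟨⟨-, h2⟩, h3⟩ := hω
    obtain ⟨t, ht⟩ := WithTop.ne_top_iff_exists.1 (logPath_ne_top_iff.1 h2)
    have hk := ((invClock_eq_coe_iff hα).1 ht.symm).1.mul_pos le_rfl
    rw [show ω.1 0 = ε from h3] at hk
    exact ⟨t, ht.symm, hk⟩

/-- The Lamperti transform is a killed Lévy process. -/
lemma IsSelfSimilarMarkov.isKilledLevy_logPath (hα : 0 < α) (hP : IsSelfSimilarMarkov α P)
    (hε : |ε| = 1) : IsKilledLevy (P ε) (logPath α)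
      fun t => ((P ε).restrict {ω | logPath α ω t ≠ ⊤}).map fun ω => logValue α ω t where
  measurable := measurable_logPath hα
  alive_of_le ω s t hst ht := logPath_ne_top_iff.2
    (invClock_ne_top_of_le hα hst (logPath_ne_top_iff.1 ht))
  zero := by
    filter_upwards [hP.start ε (ne_zero_of_abs_eq_one hε)] with ω hω
    rw [logPath_zero hα (hω ▸ ne_zero_of_abs_eq_one hε), hω, ← Real.log_abs, hε, Real.log_one]
  incr s t S C hS hC := by
    have hv : Measurable fun ω => logValue α ω t := (measurable_logPath hα t).untopD 0
    have ha : MeasurableSet {ω | logPath α ω t ≠ ⊤} :=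
      (measurable_logPath hα t (measurableSet_singleton ⊤)).compl
    rw [Measure.map_apply hv hC, Measure.restrict_apply (hv hC), Set.inter_comm (_ ⁻¹' C),
      ← hP.measure_inter_renorm_invClock hα hε s hS (ha.inter (hv hC))]
    congr 1
    ext ω
    simp only [Set.mem_inter_iff, Set.mem_ofPred_eq, Set.mem_preimage, and_assoc]
    refine and_congr_right fun _ => ?_
    cases hi : invClock α s ω with
    | top =>
      have h1 : logPath α ω s = ⊤ := by simp [logPath, hi]
      refine iff_of_false (fun h => ?_) (fun h => h.1 h1)
      exact logPath_ne_top_iff.1 h.1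
        (by_contra fun hne => invClock_ne_top_of_le hα le_self_add hne hi)
    | coe a =>
      have h1 : logPath α ω s = (Real.log (ω.1 a) : ℝ) := by rw [logPath, hi, WithTop.map_coe]
      rw [h1, WithTop.untopD_coe, WithTop.untopD_coe, logPath_add hα hi, logValue]
      cases logPath α (renorm α a ω) t with
      | top => simp
      | coe x => simp

/-- The lifetime of the Lamperti transform is exponential: it is positive and, by regularity of the
path, finite. -/
lemma IsSelfSimilarMarkov.exists_rate_logPath (hα : 0 < α) (hP : IsSelfSimilarMarkov α P)
    (hH : ∀ x, x ≠ 0 → ∀ᵐ ω ∂(P x), signChange 1 ω < hitZero ω) (hε : |ε| = 1) :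
    ∃ q : ℝ, 0 < q ∧
      ∀ t, P ε {ω | logPath α ω t ≠ ⊤} = ENNReal.ofReal (Real.exp (-(q * t))) := by
  have hε0 := ne_zero_of_abs_eq_one hε
  have := hP.isProbabilityMeasure ε hε0
  refine (hP.isKilledLevy_logPath hα hε).exists_rate ?_ ?_
  · filter_upwards [hP.start ε hε0] with ω hω
    obtain ⟨t, ht, hk⟩ := (keepsSign_zero (hω ▸ hε0)).exists_gt
    have h1 := ENNReal.coe_toNNReal (hk.clock_ne_top hα)
    refine ⟨(clock α ω t).toNNReal, ?_, ?_⟩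
    · rw [← ENNReal.coe_pos, h1]
      exact zero_le.trans_lt ((keepsSign_zero (hω ▸ hε0)).clock_lt hα ht)
    · rw [logPath_ne_top_iff, invClock_ne_top_iff hα]
      exact ⟨t, hk, h1.symm⟩
  · filter_upwards [hP.start ε hε0, hP.ae_isRegular hH hε0] with ω hω hr
    obtain ⟨z, hz, -⟩ := hr.exists_logPath_eq hα (hω ▸ hε)
    exact ⟨z, by rw [hz, killAt, if_neg (lt_irrefl z)]⟩

/-- The Lamperti transform on `[0, 1]`, on the event that it is alive at time `1`. -/
def logSegment (α : ℝ) (hα : 0 < α) (ω : Path) : Path :=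
  ⟨fun u => if logPath α ω 1 = ⊤ then 0 else logValue α ω (min u 1), by
    split_ifs with h
    · exact isCadlag_const 0
    · obtain ⟨a, ha, hr⟩ := (invClock_ne_top_iff hα).1 (logPath_ne_top_iff.1 h)
      exact ha.isCadlag_logValue_min hα hr⟩

lemma measurable_logSegment (hα : 0 < α) : Measurable (logSegment α hα) :=
  measurable_path_mk _ fun u => Measurable.ite (measurable_logPath hα 1 (measurableSet_singleton ⊤))
    measurable_const ((measurable_logPath hα (min u 1)).untopD 0)

/-- The Lamperti representation of the path up to its first change of sign. -/
lemma IsSelfSimilarMarkov.isTimeChangedKilledLevy_killedPath (hα : 0 < α)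
    (hP : IsSelfSimilarMarkov α P)
    (hH : ∀ x, x ≠ 0 → ∀ᵐ ω ∂(P x), signChange 1 ω < hitZero ω) (hε : |ε| = 1) :
    IsTimeChangedKilledLevy α ε killedPath (P ε) := by
  have hε0 := ne_zero_of_abs_eq_one hε
  have := hP.isProbabilityMeasure ε hε0
  have hk := hP.isKilledLevy_logPath hα hε
  obtain ⟨q, hq0, hq⟩ := hP.exists_rate_logPath hα hH hε
  obtain ⟨Ω', mΩ', μ', ξ, ζ, hμ', hξ, hζ, hlaw, hind, hmap⟩ :=
    hk.exists_isLevyProcess hq0 hq (measurable_logSegment hα) fun ω hω u => by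
      simp only [logSegment, if_neg hω]
      rfl
  refine ⟨Ω', mΩ', μ', ξ, ζ, q, hμ', hξ, hq0, hζ, hlaw, hind, ?_⟩
  have hkill : Measurable fun ω => killAt (fun t => ξ t ω) (ζ ω) :=
    measurable_pi_lambda _ fun t => Measurable.ite (measurableSet_lt measurable_const hζ)
      (hξ.measurable t).withTop_coe measurable_const
  have h1 : IdentDistrib (logPath α) (fun ω => killAt (fun t => ξ t ω) (ζ ω)) (P ε) μ' :=
    ⟨(measurable_logPath_pi hα).aemeasurable, hkill.aemeasurable, hmap.symm⟩
  have h2 := h1.comp (measurable_lampertiMap α ε)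
  have h3 : lampertiMap α ε ∘ (fun ω => killAt (fun t => ξ t ω) (ζ ω)) =
      fun ω => lampertiPath α ε (fun t => ξ t ω) (ζ ω) := by
    funext ω
    exact lampertiMap_killAt hα ε fun s _ => (hξ.cadlag ω).1 s
  rw [h3] at h2
  refine IdentDistrib.trans (.of_ae_eq measurable_killedPath.aemeasurable ?_) h2
  filter_upwards [hP.start ε hε0, hP.ae_isRegular hH hε0] with ω hω hr
  rw [Function.comp_apply, ← hω, hr.lampertiMap_logPath hα (hω ▸ hε)]

/-- The event that the Lamperti transform takes given real values up to time `s` belongs to the past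
of the time `invClock s`, while the jump ratio is a functional of the path restarted at this time.
As the jump ratio has the same law for the restarted path, it is independent of the event. -/
lemma IsSelfSimilarMarkov.indepFun_logPath_lifeRatio (hα : 0 < α)
    (hP : IsSelfSimilarMarkov α P)
    (hH : ∀ x, x ≠ 0 → ∀ᵐ ω ∂(P x), signChange 1 ω < hitZero ω) (hε : |ε| = 1) :
    IndepFun (logPath α) lifeRatio (P ε) := by
  have hε0 := ne_zero_of_abs_eq_one hε
  have := hP.isProbabilityMeasure ε hε0
  have hl : ∀ᵐ ω ∂(P ε), life ω ≠ ⊤ := by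
    filter_upwards [hP.ae_isRegular hH hε0] with ω hω
    obtain ⟨l, hl, -⟩ := hω.exists_life
    rw [hl]
    exact WithTop.coe_ne_top
  rw [IndepFun_iff_Indep]
  refine IndepSets.indep (measurable_logPath_pi hα).comap_le measurable_lifeRatio.comap_le
    (isPiSystem_realRects.comap (logPath α))
    (MeasurableSpace.isPiSystem_measurableSet.comap lifeRatio) ?_ ?_ ?_
  · rw [generateFrom_realRects, MeasurableSpace.comap_generateFrom]
    rfl
  · conv_lhs => rw [← MeasurableSpace.generateFrom_measurableSet (α := ℝ),
      MeasurableSpace.comap_generateFrom]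
    rfl
  rw [IndepSets_iff]
  rintro _ _ ⟨_, ⟨I, B, hB, rfl⟩, rfl⟩ ⟨D, hD, rfl⟩
  rcases I.eq_empty_or_nonempty with rfl | hI
  · simp [realRect]
  set s := I.max' hI
  have hR (ω : Path) : logPath α ω ∈ realRect I B ↔
      (fun u => logPath α ω (min u s)) ∈ realRect I B ∧ logPath α ω s ≠ ⊤ := by
    have h1 : logPath α ω ∈ realRect I B ↔ (fun u => logPath α ω (min u s)) ∈ realRect I B :=
      forall₂_congr fun t ht => by
        change _ ↔ ∃ x ∈ B t, logPath α ω (min t s) = x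
        rw [min_eq_left (I.le_max' t ht)]
    rw [← h1, iff_self_and]
    intro h2
    obtain ⟨x, -, hx⟩ := h2 s (I.max'_mem hI)
    rw [hx]
    exact WithTop.coe_ne_top
  have hset : logPath α ⁻¹' realRect I B =
      {ω | (fun u => logPath α ω (min u s)) ∈ realRect I B} ∩ {ω | logPath α ω s ≠ ⊤} :=
    Set.ext hR
  rw [hset, ← hP.measure_inter_renorm_invClock hα hε s (measurableSet_realRect hB)
    (measurable_lifeRatio hD)]
  refine measure_congr ?_
  filter_upwards [hl] with ω hω
  refine propext (and_congr_right fun h => ?_)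
  obtain ⟨a, ha⟩ := WithTop.ne_top_iff_exists.1 (logPath_ne_top_iff.1 h.2)
  change lifeRatio ω ∈ D ↔ lifeRatio (renorm α ((invClock α s ω).untopD 0) ω) ∈ D
  rw [← ha, WithTop.untopD_coe,
    ← lifeRatio_renorm ((invClock_eq_coe_iff hα).1 ha.symm).1 hω]

lemma IsSelfSimilarMarkov.indepFun_killedPath_lifeRatio (hα : 0 < α)
    (hP : IsSelfSimilarMarkov α P)
    (hH : ∀ x, x ≠ 0 → ∀ᵐ ω ∂(P x), signChange 1 ω < hitZero ω) (hε : |ε| = 1) :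
    IndepFun killedPath lifeRatio (P ε) := by
  have hε0 := ne_zero_of_abs_eq_one hε
  refine ((hP.indepFun_logPath_lifeRatio hα hH hε).comp (measurable_lampertiMap α ε)
    measurable_id).congr ?_ (ae_eq_refl _)
  filter_upwards [hP.start ε hε0, hP.ae_isRegular hH hε0] with ω hω hr
  rw [Function.comp_apply, ← hω, hr.lampertiMap_logPath hα (hω ▸ hε)]

end Law


/-! ### Reduction to the starting points `1` and `-1` -/

/-- Independence under an image measure. -/
lemma iIndepFun_comp_of_map {Ω Ω' ι E : Type*} [MeasurableSpace Ω] [MeasurableSpace Ω']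
    [MeasurableSpace E] {μ : Measure Ω} [IsProbabilityMeasure μ] {g : Ω → Ω'} (hg : Measurable g)
    {f : ι → Ω' → E} (hf : ∀ i, Measurable (f i)) (h : iIndepFun f (μ.map g)) :
    iIndepFun (fun i ω => f i (g ω)) μ := by
  have := Measure.isProbabilityMeasure_map (μ := μ) hg.aemeasurable
  rw [iIndepFun_iff_map_fun_eq_infinitePi_map hf,
    Measure.map_map (measurable_pi_lambda _ hf) hg] at h
  simp only [Measure.map_map (hf _) hg] at h
  exact (iIndepFun_iff_map_fun_eq_infinitePi_map fun i => (hf i).comp hg).2 h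

lemma IsPersistent.signChange_ne_top {α : ℝ} {ω : Path} (h : IsPersistent α ω) (n : ℕ) :
    signChange n ω ≠ ⊤ := ne_top_of_lt (h.wellDefined n).1

lemma IsPersistent.signChange_pos {α : ℝ} {ω : Path} (h : IsPersistent α ω) (n : ℕ) :
    0 < signChange (n + 1) ω := zero_le.trans_lt (h.wellDefined n).1

/-- The path restarted at its `n`-th change of sign (at time `0` for `n = 0`) and rescaled so as to
start from `1` or `-1`. -/
def nthRestart (α : ℝ) (n : ℕ) (ω : Path) : Path := (restart α)^[n] (renorm α 0 ω)

lemma measurable_renorm_zero (α : ℝ) : Measurable (renorm α 0) :=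
  measurable_renorm α measurable_const measurable_id

lemma measurable_nthRestart (α : ℝ) (n : ℕ) : Measurable (nthRestart α n) :=
  ((measurable_restart α).iterate n).comp (measurable_renorm_zero α)

variable {α : ℝ} {P : ℝ → Measure Path} {x : ℝ}

lemma signChange_eq_renorm_zero {ω : Path} (h0 : ω.1 0 ≠ 0) (n : ℕ) : signChange n ω =
    ((0 : ℝ≥0) : ℝ≥0∞) + (‖ω.1 0‖₊ ^ α : ℝ≥0) * signChange n (renorm α 0 ω) :=
  signChange_add (j := 0) h0 (by simp [signChange]) n

lemma piece_eq_killedPath {ω : Path} (h0 : ω.1 0 ≠ 0) (h : IsPersistent α (renorm α 0 ω)) (n : ℕ) :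
    piece α n ω = killedPath (nthRestart α n ω) := by
  have hadd := signChange_eq_renorm_zero (α := α) h0
  rw [piece_renorm h0 (hadd n) (hadd (n + 1)) (h.signChange_ne_top n), h.piece_eq n, nthRestart]
  rw [renorm_zero_apply, abs_div_abs h0]

lemma jumpRatio_eq_lifeRatio {ω : Path} (h0 : ω.1 0 ≠ 0) (h : IsPersistent α (renorm α 0 ω))
    (n : ℕ) : jumpRatio n ω = lifeRatio (nthRestart α n ω) := by
  have hadd := signChange_eq_renorm_zero (α := α) h0
  rw [jumpRatio_renorm h0 (hadd (n + 1)) (h.signChange_ne_top (n + 1)) (h.signChange_pos n),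
    h.jumpRatio_eq n, nthRestart]

lemma real_sign_eq (hx : x ≠ 0) : Real.sign x = x / |x| := by
  rcases lt_or_gt_of_ne hx with h | h
  · rw [Real.sign_of_neg h, abs_of_neg h, div_neg, div_self hx]
  · rw [Real.sign_of_pos h, abs_of_pos h, div_self hx]

lemma abs_sign_mul_neg_one_pow (hx : x ≠ 0) (n : ℕ) : |Real.sign x * (-1) ^ n| = 1 := by
  rw [abs_mul, abs_neg_one_pow, mul_one, real_sign_eq hx, abs_div_abs hx]

namespace IsSelfSimilarMarkov

lemma ae_isPersistent_renorm (hP : IsSelfSimilarMarkov α P)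
    (hH : ∀ x, x ≠ 0 → ∀ᵐ ω ∂(P x), signChange 1 ω < hitZero ω) (hx : x ≠ 0) :
    ∀ᵐ ω ∂(P x), ω.1 0 ≠ 0 ∧ IsPersistent α (renorm α 0 ω) := by
  have h1 := hP.ae_isPersistent hH (ne_zero_of_abs_eq_one (abs_div_abs hx))
  rw [← hP.map_renorm_zero hx] at h1
  filter_upwards [hP.start x hx, ae_of_ae_map (measurable_renorm_zero α).aemeasurable h1]
    with ω hω h
  exact ⟨hω ▸ hx, h⟩

lemma piece_ae_eq (hP : IsSelfSimilarMarkov α P)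
    (hH : ∀ x, x ≠ 0 → ∀ᵐ ω ∂(P x), signChange 1 ω < hitZero ω) (hx : x ≠ 0) (n : ℕ) :
    piece α n =ᵐ[P x] fun ω => killedPath (nthRestart α n ω) := by
  filter_upwards [hP.ae_isPersistent_renorm hH hx] with ω h
  exact piece_eq_killedPath h.1 h.2 n

lemma jumpRatio_ae_eq (hP : IsSelfSimilarMarkov α P)
    (hH : ∀ x, x ≠ 0 → ∀ᵐ ω ∂(P x), signChange 1 ω < hitZero ω) (hx : x ≠ 0) (n : ℕ) :
    jumpRatio n =ᵐ[P x] fun ω => lifeRatio (nthRestart α n ω) := by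
  filter_upwards [hP.ae_isPersistent_renorm hH hx] with ω h
  exact jumpRatio_eq_lifeRatio h.1 h.2 n

lemma map_nthRestart (hP : IsSelfSimilarMarkov α P)
    (hH : ∀ x, x ≠ 0 → ∀ᵐ ω ∂(P x), signChange 1 ω < hitZero ω) (hx : x ≠ 0) (n : ℕ) :
    (P x).map (nthRestart α n) = P (Real.sign x * (-1) ^ n) := by
  rw [real_sign_eq hx, ← hP.map_iterate_restart hH (abs_div_abs hx) n, ← hP.map_renorm_zero hx,
    Measure.map_map ((measurable_restart α).iterate n) (measurable_renorm_zero α)]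
  rfl

lemma identDistrib_nthRestart (hP : IsSelfSimilarMarkov α P)
    (hH : ∀ x, x ≠ 0 → ∀ᵐ ω ∂(P x), signChange 1 ω < hitZero ω) (hx : x ≠ 0) (n : ℕ) :
    IdentDistrib (nthRestart α n) id (P x) (P (Real.sign x * (-1) ^ n)) :=
  ⟨(measurable_nthRestart α n).aemeasurable, aemeasurable_id, by
    rw [hP.map_nthRestart hH hx, Measure.map_id]⟩

lemma iIndepFun_nthRestart (hP : IsSelfSimilarMarkov α P)
    (hH : ∀ x, x ≠ 0 → ∀ᵐ ω ∂(P x), signChange 1 ω < hitZero ω) (hx : x ≠ 0) {E : Type*}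
    [MeasurableSpace E] {Y : Path → E} (hY : Measurable Y)
    (hYs : ∀ (t : ℝ≥0) ω, life ω ≤ t → Y (stopPath t ω) = Y ω) :
    iIndepFun (fun n ω => Y (nthRestart α n ω)) (P x) := by
  have := hP.isProbabilityMeasure x hx
  refine iIndepFun_comp_of_map (measurable_renorm_zero α)
    (f := fun n ω => Y ((restart α)^[n] ω))
    (fun n => hY.comp ((measurable_restart α).iterate n)) ?_
  rw [hP.map_renorm_zero hx]
  exact hP.iIndepFun_restart hH hY hYs (abs_div_abs hx)

lemma identDistrib_piece (hP : IsSelfSimilarMarkov α P)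
    (hH : ∀ x, x ≠ 0 → ∀ᵐ ω ∂(P x), signChange 1 ω < hitZero ω) (hx : x ≠ 0) (n : ℕ) :
    IdentDistrib (piece α n) killedPath (P x) (P (Real.sign x * (-1) ^ n)) :=
  (IdentDistrib.of_ae_eq (measurable_killedPath.comp (measurable_nthRestart α n)).aemeasurable
    (hP.piece_ae_eq hH hx n).symm).symm.trans
      ((hP.identDistrib_nthRestart hH hx n).comp measurable_killedPath)

lemma identDistrib_jumpRatio (hP : IsSelfSimilarMarkov α P)
    (hH : ∀ x, x ≠ 0 → ∀ᵐ ω ∂(P x), signChange 1 ω < hitZero ω) (hx : x ≠ 0) (n : ℕ) :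
    IdentDistrib (jumpRatio n) lifeRatio (P x) (P (Real.sign x * (-1) ^ n)) :=
  (IdentDistrib.of_ae_eq (measurable_lifeRatio.comp (measurable_nthRestart α n)).aemeasurable
    (hP.jumpRatio_ae_eq hH hx n).symm).symm.trans
      ((hP.identDistrib_nthRestart hH hx n).comp measurable_lifeRatio)

lemma killedPath_ae_eq_firstPiece (hP : IsSelfSimilarMarkov α P)
    (hH : ∀ x, x ≠ 0 → ∀ᵐ ω ∂(P x), signChange 1 ω < hitZero ω) (hx : x ≠ 0) :
    killedPath =ᵐ[P x] firstPiece := by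
  filter_upwards [hP.ae_isRegular hH hx] with ω h using h.firstPiece_eq.symm

lemma lifeRatio_ae_eq_jumpRatio (hP : IsSelfSimilarMarkov α P)
    (hH : ∀ x, x ≠ 0 → ∀ᵐ ω ∂(P x), signChange 1 ω < hitZero ω) (hx : x ≠ 0) :
    lifeRatio =ᵐ[P x] jumpRatio 0 := by
  filter_upwards [hP.ae_isRegular hH hx] with ω h using h.jumpRatio_eq.symm

lemma indepFun_piece_jumpRatio (hα : 0 < α) (hP : IsSelfSimilarMarkov α P)
    (hH : ∀ x, x ≠ 0 → ∀ᵐ ω ∂(P x), signChange 1 ω < hitZero ω) (hx : x ≠ 0) (n : ℕ) :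
    IndepFun (piece α n) (jumpRatio n) (P x) := by
  have hε := abs_sign_mul_neg_one_pow hx n
  have := hP.isProbabilityMeasure x hx
  have := hP.isProbabilityMeasure _ (ne_zero_of_abs_eq_one hε)
  refine (indepFun_of_identDistrib_pair (hP.indepFun_killedPath_lifeRatio hα hH hε)
    ((hP.identDistrib_nthRestart hH hx n).comp
      (measurable_killedPath.prodMk measurable_lifeRatio)).symm).congr
    (hP.piece_ae_eq hH hx n).symm (hP.jumpRatio_ae_eq hH hx n).symm

end IsSelfSimilarMarkov

lemma IsTimeChangedKilledLevy.of_identDistrib {Ω Ω₁ : Type*} [MeasurableSpace Ω]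
    [MeasurableSpace Ω₁] {ε : ℝ} {Z : Ω → ℝ≥0 → WithTop ℝ} {Z₁ : Ω₁ → ℝ≥0 → WithTop ℝ}
    {μ : Measure Ω} {μ₁ : Measure Ω₁} (h : IdentDistrib Z Z₁ μ μ₁)
    (h₁ : IsTimeChangedKilledLevy α ε Z₁ μ₁) : IsTimeChangedKilledLevy α ε Z μ := by
  obtain ⟨Ω', mΩ', μ', ξ, ζ, q, h1, h2, h3, h4, h5, h6, h7⟩ := h₁
  exact ⟨Ω', mΩ', μ', ξ, ζ, q, h1, h2, h3, h4, h5, h6, h.trans h7⟩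

end SelfSimilarMarkov

end

open SelfSimilarMarkov in
theorem theorem4 (α : ℝ) (hα : 0 < α) (P : ℝ → Measure Path) (hP : IsSelfSimilarMarkov α P)
    (hH : ∀ x, x ≠ 0 → ∀ᵐ ω ∂(P x), signChange 1 ω < hitZero ω) :
    ∀ x, x ≠ 0 →
      -- the sign change times, path pieces and jump ratios are a.s. well defined
      (∀ᵐ ω ∂(P x), ∀ n, signChange n ω < signChange (n + 1) ω ∧
        signChange (n + 1) ω < hitZero ω ∧
        valueH n ω ≠ 0 ∧ valueH (n + 1) ω * leftValueH (n + 1) ω < 0) ∧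
      -- the path pieces: independence, law, Lamperti representation
      (iIndepFun (fun n ω => piece α n ω) (P x) ∧
        (∀ n : ℕ, IdentDistrib (piece α n) firstPiece (P x) (P (Real.sign x * (-1) ^ n))) ∧
        (∀ n : ℕ, IsTimeChangedKilledLevy α (Real.sign x * (-1) ^ n) (piece α n) (P x))) ∧
      -- the jump ratios: independence and law
      (iIndepFun (fun n ω => jumpRatio n ω) (P x) ∧
        (∀ n : ℕ, IdentDistrib (jumpRatio n) (jumpRatio 0)
          (P x) (P (Real.sign x * (-1) ^ n)))) ∧
      -- independence of each piece and its jump ratio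
      (∀ n : ℕ, IndepFun (piece α n) (jumpRatio n) (P x)) := by
  intro x hx
  have hε (n : ℕ) := abs_sign_mul_neg_one_pow hx n
  have hε0 (n : ℕ) := ne_zero_of_abs_eq_one (hε n)
  have hpiece := fun n => hP.piece_ae_eq hH hx n
  have hratio := fun n => hP.jumpRatio_ae_eq hH hx n
  refine ⟨?_, ⟨?_, fun n => ?_, fun n => ?_⟩, ⟨?_, fun n => ?_⟩, fun n => ?_⟩
  · filter_upwards [hP.ae_isPersistent hH hx] with ω hω n using hω.wellDefined n
  · exact (hP.iIndepFun_nthRestart hH hx measurable_killedPath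
      fun _ _ => killedPath_stopPath).congr fun n => (hpiece n).symm
  · exact (hP.identDistrib_piece hH hx n).trans (.of_ae_eq measurable_killedPath.aemeasurable
      (hP.killedPath_ae_eq_firstPiece hH (hε0 n)))
  · exact (hP.isTimeChangedKilledLevy_killedPath hα hH (hε n)).of_identDistrib
      (hP.identDistrib_piece hH hx n)
  · exact (hP.iIndepFun_nthRestart hH hx measurable_lifeRatio
      fun _ _ => lifeRatio_stopPath).congr fun n => (hratio n).symm
  · exact (hP.identDistrib_jumpRatio hH hx n).trans (.of_ae_eq measurable_lifeRatio.aemeasurable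
      (hP.lifeRatio_ae_eq_jumpRatio hH (hε0 n)))
  · exact hP.indepFun_piece_jumpRatio hα hH hx n
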